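/- An exact category is an additive category $\mathcal A$ with a family of kernel–cokernel pairs $A\overset{i}{\rightarrowtail} B\overset{p}{\twoheadrightarrow} C$ (the exact sequences; the maps $i$ are called admissible monomorphisms, the maps $p$ admissible epimorphisms), closed under isomorphism, such that identities of zero objects are admissible epimorphisms, admissible epimorphisms are closed under composition, pullbacks of admissible epimorphisms along arbitrary morphisms exist and are admissible epimorphisms, and pushouts of admissible monomorphisms along arbitrary morphisms exist and are admissible monomorphisms. An exact functor is an additive functor that preserves exact sequences. For an exact category $\mathcal A$ let $S_\bullet(\mathcal A)$ be the simplicial groupoid with $S_n(\mathcal A)$ the full subgroupoid of the maximal subgroupoid of $\operatorname{Fun}(\operatorname{Ar}[n],\mathcal A)$, where $\operatorname{Ar}[n]=\operatorname{Fun}([1],[n])$ is the poset of pairs $i\le j$ in $[n]$, on the diagrams $(a_{ij})$ such that each $a_{ii}$ is a zero object, all horizontal maps $a_{ij}\to a_{il}$ are admissible monomorphisms, all vertical maps $a_{ij}\to a_{kj}$ are admissible epimorphisms, and all squares with corners $a_{ij},a_{il},a_{kj},a_{kl}$ ($i\le k\le j\le l$) are bicartesian. For a simplicial object $X$ let $P^{\triangleleft}X$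 be the simplicial object with $(P^{\triangleleft}X)_n=X_{n+1}$ obtained by precomposing $X$ with $[n]\mapsto[0]\star[n]$, and let $d_0\colon P^{\triangleleft}X\to X$ be given by the extra face maps. For an exact functor $f\colon\mathcal A\to\mathcal B$ the relative $S_\bullet$-construction is the (strict, levelwise) pullback of simplicial groupoids $$S^{\mathrm{rel}}_\bullet(f)=P^{\triangleleft}S_\bullet(\mathcal B)\times_{S_\bullet(\mathcal B)}S_\bullet(\mathcal A)$$ of $d_0\colon P^{\triangleleft}S_\bullet(\mathcal B)\to S_\bullet(\mathcal B)$ and $S_\bullet(f)\colon S_\bullet(\mathcal A)\to S_\bullet(\mathcal B)$. A simplicial groupoid $X$ is called $2$-Segal if for every $n\ge2$ and every triangulation $T$ of the convex $(n+1)$-gon with vertices $0,\dots,n$, the canonical functor from $X_n$ to $X_T$ is an equivalence of groupoids. Here $\Delta^T\subset\Delta[n]$ is the simplicial subset formed by the triangles of $T$, and $X_T$ is the homotopy limit (pseudo-limit) of the groupoids $X_m$ over the category of simplices $\Delta[m]\to\Delta^T$. **Corollary.** For every exact functor $f\colon\mathcal A\to\mathcal B$ between exact categories, the simplicial groupoid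 $S^{\mathrm{rel}}_\bullet(f)$ is $2$-Segal. -/

import Mathlib

open CategoryTheory CategoryTheory.Limits Opposite

universe w v u

namespace RelSdot

section ExactCategories

/-- The morphisms occurring as the first map of a sequence of the family `S`. -/
def admMono {C : Type u} [Category.{v} C] [Preadditive C]
    (S : ObjectProperty (ShortComplex C)) : MorphismProperty C :=
  fun _ Y i => ∃ (Z : C) (p : Y ⟶ Z) (w : i ≫ p = 0), S (ShortComplex.mk i p w)

/-- The morphisms occurring as the second map of a sequence of the family `S`. -/
def admEpi {C : Type u} [Category.{v} C] [Preadditive C]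
    (S : ObjectProperty (ShortComplex C)) : MorphismProperty C :=
  fun Y _ p => ∃ (X : C) (i : X ⟶ Y) (w : i ≫ p = 0), S (ShortComplex.mk i p w)

/-- The structure of an exact category (Keller's axioms) on an additive category `C`:
a family of exact sequences, i.e. kernel-cokernel pairs, satisfying the usual closure axioms. -/
class ExactCategory (C : Type u) [Category.{v} C] [Preadditive C] [HasFiniteBiproducts C] where
  /-- the distinguished family of exact sequences -/
  exactSeq : ObjectProperty (ShortComplex C)
  isKernel : ∀ T : ShortComplex C, exactSeq T →
    Nonempty (IsLimit (KernelFork.ofι T.f T.zero))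
  isCokernel : ∀ T : ShortComplex C, exactSeq T →
    Nonempty (IsColimit (CokernelCofork.ofπ T.g T.zero))
  closed_iso : ∀ T T' : ShortComplex C, Nonempty (T ≅ T') → exactSeq T → exactSeq T'
  id_zero : ∀ Z : C, IsZero Z → admEpi exactSeq (𝟙 Z)
  comp_epi : ∀ {X Y Z : C} (p : X ⟶ Y) (q : Y ⟶ Z),
    admEpi exactSeq p → admEpi exactSeq q → admEpi exactSeq (p ≫ q)
  pullback_epi : ∀ {X Y' X' : C} (f : X ⟶ X') (p' : Y' ⟶ X'), admEpi exactSeq p' →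
    ∃ (Y : C) (f' : Y ⟶ Y') (p : Y ⟶ X), IsPullback f' p p' f ∧ admEpi exactSeq p
  pushout_mono : ∀ {X X' Y : C} (g : X ⟶ X') (i : X ⟶ Y), admMono exactSeq i →
    ∃ (Y' : C) (g' : Y ⟶ Y') (i' : X' ⟶ Y'), IsPushout i g g' i' ∧ admMono exactSeq i'

/-- The admissible monomorphisms of an exact category. -/
def adMono (C : Type u) [Category.{v} C] [Preadditive C] [HasFiniteBiproducts C]
    [ExactCategory C] : MorphismProperty C :=
  admMono (ExactCategory.exactSeq (C := C))

/-- The admissible epimorphisms of an exact category. -/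
def adEpi (C : Type u) [Category.{v} C] [Preadditive C] [HasFiniteBiproducts C]
    [ExactCategory C] : MorphismProperty C :=
  admEpi (ExactCategory.exactSeq (C := C))

/-- An exact functor: an additive functor that preserves the exact sequences. -/
class ExactFunctor {A B : Type u} [Category.{v} A] [Preadditive A] [HasFiniteBiproducts A]
    [ExactCategory A] [Category.{v} B] [Preadditive B] [HasFiniteBiproducts B]
    [ExactCategory B] (F : A ⥤ B) : Prop extends F.Additive where
  map_exactSeq : ∀ T : ShortComplex A,
    ExactCategory.exactSeq T → ExactCategory.exactSeq (T.map F)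

end ExactCategories

section ExactFunctorLemmas

variable {C : Type u} [Category.{v} C] [Preadditive C]

lemma isPullback_of_rows {X Y Z W Q : C} {i : X ⟶ Y} {p : X ⟶ Z} {q : Y ⟶ W} {j : Z ⟶ W}
    {a : Y ⟶ Q} {b : W ⟶ Q} (sq : i ≫ q = p ≫ j) (hab : q ≫ b = a)
    (w₁ : i ≫ a = 0) (w₂ : j ≫ b = 0)
    (h₁ : IsLimit (KernelFork.ofι i w₁)) (h₂ : IsLimit (KernelFork.ofι j w₂)) :
    IsPullback i p q j := by
  have mi : Mono i := ⟨fun f g h => Fork.IsLimit.hom_ext h₁ (by simpa using h)⟩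
  have mj : Mono j := ⟨fun f g h => Fork.IsLimit.hom_ext h₂ (by simpa using h)⟩
  have key : ∀ s : PullbackCone q j, s.fst ≫ a = 0 := fun s => by
    rw [← hab, ← Category.assoc, s.condition, Category.assoc, w₂, comp_zero]
  have hl : ∀ s : PullbackCone q j,
      (KernelFork.IsLimit.lift' h₁ s.fst (key s)).1 ≫ i = s.fst :=
    fun s => (KernelFork.IsLimit.lift' h₁ s.fst (key s)).2
  refine ⟨⟨sq⟩, ⟨PullbackCone.IsLimit.mk sq
    (fun s => (KernelFork.IsLimit.lift' h₁ s.fst (key s)).1) hl ?_ ?_⟩⟩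
  · intro s
    rw [← cancel_mono j, Category.assoc, ← sq, ← Category.assoc, hl, s.condition]
  · intro s m hm _
    rw [← cancel_mono i, hm, hl]

lemma isPushout_of_cols {X Y Z W K : C} {i : X ⟶ Y} {p : X ⟶ Z} {q : Y ⟶ W} {j : Z ⟶ W}
    {a : K ⟶ X} {b : K ⟶ Y} (sq : i ≫ q = p ≫ j) (hab : a ≫ i = b)
    (w₁ : a ≫ p = 0) (w₂ : b ≫ q = 0)
    (h₁ : IsColimit (CokernelCofork.ofπ p w₁)) (h₂ : IsColimit (CokernelCofork.ofπ q w₂)) :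
    IsPushout i p q j := by
  have ep : Epi p := ⟨fun f g h => Cofork.IsColimit.hom_ext h₁ (by simpa using h)⟩
  have eq : Epi q := ⟨fun f g h => Cofork.IsColimit.hom_ext h₂ (by simpa using h)⟩
  have key : ∀ s : PushoutCocone i p, b ≫ s.inl = 0 := fun s => by
    rw [← hab, Category.assoc, s.condition, ← Category.assoc, w₁, zero_comp]
  have hl : ∀ s : PushoutCocone i p,
      q ≫ (CokernelCofork.IsColimit.desc' h₂ s.inl (key s)).1 = s.inl :=
    fun s => (CokernelCofork.IsColimit.desc' h₂ s.inl (key s)).2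
  refine ⟨⟨sq⟩, ⟨PushoutCocone.IsColimit.mk sq
    (fun s => (CokernelCofork.IsColimit.desc' h₂ s.inl (key s)).1) hl ?_ ?_⟩⟩
  · intro s
    rw [← cancel_epi p, ← Category.assoc, ← sq, Category.assoc, hl, s.condition]
  · intro s m hm _
    rw [← cancel_epi q, hm, hl]

variable {A B : Type u} [Category.{v} A] [Preadditive A] [HasFiniteBiproducts A]
    [ExactCategory A] [Category.{v} B] [Preadditive B] [HasFiniteBiproducts B]
    [ExactCategory B] (F : A ⥤ B) [ExactFunctor F]

lemma ExactFunctor.map_adMono {X Y : A} {i : X ⟶ Y} (h : adMono A i) :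
    adMono B (F.map i) := by
  obtain ⟨Z, p, w, h⟩ := h
  exact ⟨_, _, _, ExactFunctor.map_exactSeq (F := F) _ h⟩

lemma ExactFunctor.map_adEpi {X Y : A} {p : X ⟶ Y} (h : adEpi A p) :
    adEpi B (F.map p) := by
  obtain ⟨Z, i, w, h⟩ := h
  exact ⟨_, _, _, ExactFunctor.map_exactSeq (F := F) _ h⟩

/-- In an exact category, for a pushout square with admissible monomorphisms `i`, `j`,
any exact sequence starting with `i` induces one starting with `j`. -/
lemma exists_exactSeq_right {X Y Z W : A} {i : X ⟶ Y} {p : X ⟶ Z} {q : Y ⟶ W} {j : Z ⟶ W}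
    (hi : adMono A i) (hj : adMono A j) (sq : IsPushout i p q j) :
    ∃ (Q : A) (b : W ⟶ Q) (w₁ : i ≫ q ≫ b = 0) (w₂ : j ≫ b = 0),
      ExactCategory.exactSeq (ShortComplex.mk i (q ≫ b) w₁) ∧
      ExactCategory.exactSeq (ShortComplex.mk j b w₂) := by
  obtain ⟨Q, a, w, ha⟩ := hi
  obtain ⟨Q', b', w', hb'⟩ := hj
  obtain ⟨ca⟩ := ExactCategory.isCokernel _ ha
  obtain ⟨cb'⟩ := ExactCategory.isCokernel _ hb'
  have hw : i ≫ a = p ≫ (0 : Z ⟶ Q) := by rw [w, comp_zero]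
  let b : W ⟶ Q := sq.desc a 0 hw
  have hb₁ : q ≫ b = a := sq.inl_desc _ _ _
  have hb₂ : j ≫ b = 0 := sq.inr_desc _ _ _
  have key : ∀ {T : A} (k : W ⟶ T) (_ : j ≫ k = 0), i ≫ q ≫ k = 0 := fun k hk => by
    rw [← Category.assoc, sq.w, Category.assoc, hk, comp_zero]
  have cb : IsColimit (CokernelCofork.ofπ b hb₂) := by
    refine CokernelCofork.IsColimit.ofπ b hb₂
      (fun k hk => (CokernelCofork.IsColimit.desc' ca (q ≫ k) (key k hk)).1) ?_ ?_
    · intro T k hk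
      have hl : a ≫ (CokernelCofork.IsColimit.desc' ca (q ≫ k) (key k hk)).1 = q ≫ k :=
        (CokernelCofork.IsColimit.desc' ca (q ≫ k) (key k hk)).2
      apply sq.hom_ext
      · rw [← Category.assoc, hb₁, hl]
      · rw [← Category.assoc, hb₂, hk, zero_comp]
    · intro T k hk m hm
      refine Cofork.IsColimit.hom_ext ca ?_
      refine Eq.trans ?_ (CokernelCofork.IsColimit.desc' ca (q ≫ k) (key k hk)).2.symm
      change a ≫ m = q ≫ k
      rw [← hm, ← hb₁, Category.assoc]
  let e : Q' ≅ Q := cb'.coconePointUniqueUpToIso cb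
  have he : b' ≫ e.hom = b := cb'.comp_coconePointUniqueUpToIso_hom cb WalkingParallelPair.one
  refine ⟨Q, b, by rw [hb₁, w], hb₂, ?_, ?_⟩
  · simpa only [hb₁] using ha
  · let E : ShortComplex.mk j b' w' ≅ ShortComplex.mk j b hb₂ :=
      ShortComplex.isoMk (Iso.refl _) (Iso.refl _) e (by simp) (by simp [he])
    exact ExactCategory.closed_iso _ _ ⟨E⟩ hb'

/-- The dual statement for pullback squares and admissible epimorphisms. -/
lemma exists_exactSeq_left {X Y Z W : A} {i : X ⟶ Y} {p : X ⟶ Z} {q : Y ⟶ W} {j : Z ⟶ W}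
    (hp : adEpi A p) (hq : adEpi A q) (sq : IsPullback i p q j) :
    ∃ (K : A) (a : K ⟶ X) (w₁ : a ≫ p = 0) (w₂ : (a ≫ i) ≫ q = 0),
      ExactCategory.exactSeq (ShortComplex.mk a p w₁) ∧
      ExactCategory.exactSeq (ShortComplex.mk (a ≫ i) q w₂) := by
  obtain ⟨K', a', w', ha'⟩ := hp
  obtain ⟨K, b, w, hb⟩ := hq
  obtain ⟨ka'⟩ := ExactCategory.isKernel _ ha'
  obtain ⟨kb⟩ := ExactCategory.isKernel _ hb
  have hw : b ≫ q = (0 : K ⟶ Z) ≫ j := by rw [w, zero_comp]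
  let a : K ⟶ X := sq.lift b 0 hw
  have ha₁ : a ≫ i = b := sq.lift_fst _ _ _
  have ha₂ : a ≫ p = 0 := sq.lift_snd _ _ _
  have key : ∀ {T : A} (k : T ⟶ X) (_ : k ≫ p = 0), (k ≫ i) ≫ q = 0 := fun k hk => by
    rw [Category.assoc, sq.w, ← Category.assoc, hk, zero_comp]
  have ka : IsLimit (KernelFork.ofι a ha₂) := by
    refine KernelFork.IsLimit.ofι a ha₂
      (fun k hk => (KernelFork.IsLimit.lift' kb (k ≫ i) (key k hk)).1) ?_ ?_
    · intro T k hk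
      have hl : (KernelFork.IsLimit.lift' kb (k ≫ i) (key k hk)).1 ≫ b = k ≫ i :=
        (KernelFork.IsLimit.lift' kb (k ≫ i) (key k hk)).2
      apply sq.hom_ext
      · rw [Category.assoc, ha₁, hl]
      · rw [Category.assoc, ha₂, hk, comp_zero]
    · intro T k hk m hm
      refine Fork.IsLimit.hom_ext kb ?_
      refine Eq.trans ?_ (KernelFork.IsLimit.lift' kb (k ≫ i) (key k hk)).2.symm
      change m ≫ b = k ≫ i
      rw [← hm, ← ha₁, Category.assoc]
  let e : K' ≅ K := ka'.conePointUniqueUpToIso ka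
  have he : e.hom ≫ a = a' :=
    ka'.conePointUniqueUpToIso_hom_comp ka WalkingParallelPair.zero
  refine ⟨K, a, ha₂, by rw [ha₁, w], ?_, ?_⟩
  · let E : ShortComplex.mk a' p w' ≅ ShortComplex.mk a p ha₂ :=
      ShortComplex.isoMk e (Iso.refl _) (Iso.refl _) (by simp [he]) (by simp)
    exact ExactCategory.closed_iso _ _ ⟨E⟩ ha'
  · simpa only [ha₁] using hb

/-- An exact functor preserves bicartesian squares whose horizontal maps are admissible
monomorphisms and whose vertical maps are admissible epimorphisms. -/
lemma ExactFunctor.map_bicartesian {X Y Z W : A} {i : X ⟶ Y} {p : X ⟶ Z} {q : Y ⟶ W}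
    {j : Z ⟶ W} (hi : adMono A i) (hj : adMono A j) (hp : adEpi A p) (hq : adEpi A q)
    (sq : BicartesianSq i p q j) :
    BicartesianSq (F.map i) (F.map p) (F.map q) (F.map j) := by
  have hw : F.map i ≫ F.map q = F.map p ≫ F.map j := by
    rw [← F.map_comp, ← F.map_comp, sq.w]
  obtain ⟨Q, b, w₁, w₂, h₁, h₂⟩ := exists_exactSeq_right hi hj sq.toIsPushout
  obtain ⟨K, a, w₃, w₄, h₃, h₄⟩ := exists_exactSeq_left hp hq sq.toIsPullback
  obtain ⟨k₁⟩ := ExactCategory.isKernel _ (ExactFunctor.map_exactSeq (F := F) _ h₁)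
  obtain ⟨k₂⟩ := ExactCategory.isKernel _ (ExactFunctor.map_exactSeq (F := F) _ h₂)
  obtain ⟨c₃⟩ := ExactCategory.isCokernel _ (ExactFunctor.map_exactSeq (F := F) _ h₃)
  obtain ⟨c₄⟩ := ExactCategory.isCokernel _ (ExactFunctor.map_exactSeq (F := F) _ h₄)
  exact BicartesianSq.of_isPullback_isPushout
    (isPullback_of_rows hw (F.map_comp q b).symm _ _ k₁ k₂)
    (isPushout_of_cols hw (F.map_comp a i).symm _ _ c₃ c₄)

end ExactFunctorLemmas

section Sdot

/-- The category `Ar[n] = Fun([1],[n])`, as the poset of pairs `i ≤ j` in `[n]`. -/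
abbrev Ar (n : SimplexCategory) : Type :=
  {p : Fin (n.len + 1) × Fin (n.len + 1) // p.1 ≤ p.2}

namespace Ar

variable {n : SimplexCategory}

/-- The object `(i,j)` of `Ar[n]`. -/
abbrev mk (i j : Fin (n.len + 1)) (h : i ≤ j) : Ar n := ⟨(i, j), h⟩

/-- The horizontal morphism `(i,j) ⟶ (i,l)` of `Ar[n]`. -/
def hor (i j l : Fin (n.len + 1)) (hij : i ≤ j) (hjl : j ≤ l) :
    mk i j hij ⟶ mk i l (hij.trans hjl) :=
  homOfLE ⟨le_rfl, hjl⟩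

/-- The vertical morphism `(i,j) ⟶ (k,j)` of `Ar[n]`. -/
def ver (i k j : Fin (n.len + 1)) (hik : i ≤ k) (hkj : k ≤ j) :
    mk i j (hik.trans hkj) ⟶ mk k j hkj :=
  homOfLE ⟨hik, le_rfl⟩

/-- The functor `Ar[m] ⥤ Ar[n]` induced by a monotone map `[m] ⟶ [n]`. -/
def map {m n : SimplexCategory} (α : m ⟶ n) : Ar m ⥤ Ar n :=
  Monotone.functor
    (f := fun p : Ar m => mk (α.toOrderHom p.1.1) (α.toOrderHom p.1.2)
      (α.toOrderHom.monotone p.2))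
    (fun _ _ h => ⟨α.toOrderHom.monotone h.1, α.toOrderHom.monotone h.2⟩)

end Ar

variable (A : Type u) [Category.{v} A] [Preadditive A] [HasFiniteBiproducts A] [ExactCategory A]

/-- The `Ar[n]`-diagrams with diagonal entries zero objects, horizontal maps admissible
monomorphisms, vertical maps admissible epimorphisms and all squares bicartesian. -/
structure IsSdot {n : SimplexCategory} (D : Ar n ⥤ A) : Prop where
  zero : ∀ i, IsZero (D.obj (Ar.mk i i le_rfl))
  mono : ∀ i j l (hij : i ≤ j) (hjl : j ≤ l), adMono A (D.map (Ar.hor i j l hij hjl))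
  epi : ∀ i k j (hik : i ≤ k) (hkj : k ≤ j), adEpi A (D.map (Ar.ver i k j hik hkj))
  square : ∀ i k j l (hik : i ≤ k) (hkj : k ≤ j) (hjl : j ≤ l),
    BicartesianSq
      (D.map (Ar.hor i j l (hik.trans hkj) hjl))
      (D.map (Ar.ver i k j hik hkj))
      (D.map (Ar.ver i k l hik (hkj.trans hjl)))
      (D.map (Ar.hor k j l hkj hjl))

variable {A} in
lemma IsSdot.comp_map {m n : SimplexCategory} (α : m ⟶ n) {D : Ar n ⥤ A} (h : IsSdot A D) :
    IsSdot A (Ar.map α ⋙ D) where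
  zero i := h.zero _
  mono i j l hij hjl :=
    h.mono _ _ _ (α.toOrderHom.monotone hij) (α.toOrderHom.monotone hjl)
  epi i k j hik hkj :=
    h.epi _ _ _ (α.toOrderHom.monotone hik) (α.toOrderHom.monotone hkj)
  square i k j l hik hkj hjl :=
    h.square _ _ _ _ (α.toOrderHom.monotone hik) (α.toOrderHom.monotone hkj)
      (α.toOrderHom.monotone hjl)

/-- The property `IsSdot` as a property of objects of the functor category. -/
def sdotProp (n : SimplexCategory) : ObjectProperty (Ar n ⥤ A) := fun D => IsSdot A D

/-- The simplicial groupoid `S_•(A)`: in degree `n` it is the full subgroupoid of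
`Fun(Ar[n], A)_iso` on the diagrams satisfying `IsSdot`. -/
def sdot : SimplicialObject Grpd.{v, max u v} where
  obj n := Grpd.of (Core (sdotProp A n.unop).FullSubcategory)
  map {n m} α := Functor.core ((sdotProp A m.unop).lift
    ((sdotProp A n.unop).ι ⋙ (Functor.whiskeringLeft _ _ A).obj (Ar.map α.unop))
    (fun D => D.property.comp_map α.unop))
  map_id _ := rfl
  map_comp _ _ := rfl

variable {A}
variable {B : Type u} [Category.{v} B] [Preadditive B] [HasFiniteBiproducts B] [ExactCategory B]

lemma IsSdot.comp_functor {n : SimplexCategory} {D : Ar n ⥤ A} (h : IsSdot A D)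
    (F : A ⥤ B) [ExactFunctor F] : IsSdot B (D ⋙ F) where
  zero i := F.map_isZero (h.zero i)
  mono i j l hij hjl := ExactFunctor.map_adMono F (h.mono i j l hij hjl)
  epi i k j hik hkj := ExactFunctor.map_adEpi F (h.epi i k j hik hkj)
  square i k j l hik hkj hjl := ExactFunctor.map_bicartesian F (h.mono _ _ _ _ _)
    (h.mono _ _ _ _ _) (h.epi _ _ _ _ _) (h.epi _ _ _ _ _) (h.square i k j l hik hkj hjl)

/-- The map of simplicial groupoids `S_•(F)` given by postcomposition with `F`. -/
def sdotMap (F : A ⥤ B) [ExactFunctor F] : sdot A ⟶ sdot B where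
  app n := Functor.core ((sdotProp B n.unop).lift
    ((sdotProp A n.unop).ι ⋙ (Functor.whiskeringRight _ _ _).obj F)
    (fun D => D.property.comp_functor F))
  naturality _ _ _ := rfl

end Sdot

section PathObject

/-- The functor `[n] ↦ [0] ⋆ [n] = [n+1]` on the simplex category: a monotone map `α` goes
to the map with `0 ↦ 0` and `i + 1 ↦ α i + 1`. -/
def coneFunctor : SimplexCategory ⥤ SimplexCategory where
  obj n := SimplexCategory.mk (n.len + 1)
  map {m n} α := SimplexCategory.mkHom
    { toFun := Fin.cases 0 (fun i => (α.toOrderHom i).succ)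
      monotone' := by
        intro i j h
        induction i using Fin.cases with
        | zero => exact Fin.zero_le _
        | succ i =>
          induction j using Fin.cases with
          | zero => exact absurd h (by simp)
          | succ j =>
            exact Fin.succ_le_succ_iff.2 (α.toOrderHom.monotone (Fin.succ_le_succ_iff.1 h)) }
  map_id n := by
    ext i : 3
    induction i using Fin.cases <;> rfl
  map_comp α β := by
    ext i : 3
    induction i using Fin.cases <;> rfl

/-- The natural map `[n] ⟶ [0] ⋆ [n]`, `i ↦ i + 1`. -/
def coneIncl : 𝟭 SimplexCategory ⟶ coneFunctor where
  app n := SimplexCategory.δ (n := n.len) 0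
  naturality _ _ _ := rfl

variable {C : Type u} [Category.{v} C]

/-- The initial path object of a simplicial object. -/
def initialPath (X : SimplicialObject C) : SimplicialObject C := coneFunctor.op ⋙ X

/-- The map from the initial path object given in each degree by the face map `d₀`. -/
def initialPathD₀ (X : SimplicialObject C) : initialPath X ⟶ X where
  app n := X.map (coneIncl.app n.unop).op
  naturality m n α := by
    change X.map _ ≫ X.map _ = X.map _ ≫ X.map _
    rw [← X.map_comp, ← X.map_comp]
    exact congrArg X.map (congrArg Quiver.Hom.op (coneIncl.naturality α.unop))

end PathObject

section StrictPullback

/-- Objects of the strict pullback of groupoids. -/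
@[ext]
structure GrpdPullback {X Y Z : Grpd.{v, u}} (f : X ⟶ Z) (g : Y ⟶ Z) : Type u where
  fst : X
  snd : Y
  eq : f.obj fst = g.obj snd

namespace GrpdPullback

variable {X Y Z : Grpd.{v, u}} {f : X ⟶ Z} {g : Y ⟶ Z}

/-- Morphisms of the strict pullback of groupoids. -/
@[ext]
structure Hom (p q : GrpdPullback f g) : Type v where
  fst : p.fst ⟶ q.fst
  snd : p.snd ⟶ q.snd
  w : f.map fst ≫ eqToHom q.eq = eqToHom p.eq ≫ g.map snd

instance : Groupoid.{v} (GrpdPullback f g) where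
  Hom p q := Hom p q
  id p := ⟨𝟙 _, 𝟙 _, by simp⟩
  comp a b := ⟨a.fst ≫ b.fst, a.snd ≫ b.snd, by
    rw [f.map_comp, g.map_comp, Category.assoc, b.w, ← Category.assoc, a.w, Category.assoc]⟩
  id_comp a := Hom.ext (Category.id_comp _) (Category.id_comp _)
  comp_id a := Hom.ext (Category.comp_id _) (Category.comp_id _)
  assoc a b c := Hom.ext (Category.assoc _ _ _) (Category.assoc _ _ _)
  inv {p q} a := ⟨Groupoid.inv a.fst, Groupoid.inv a.snd, by
    have h := a.w
    rw [Groupoid.inv_eq_inv, Groupoid.inv_eq_inv, Functor.map_inv, Functor.map_inv,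
      IsIso.inv_comp_eq, ← Category.assoc, h, Category.assoc, IsIso.hom_inv_id,
      Category.comp_id]⟩
  inv_comp a := Hom.ext (Groupoid.inv_comp _) (Groupoid.inv_comp _)
  comp_inv a := Hom.ext (Groupoid.comp_inv _) (Groupoid.comp_inv _)

variable (f g)

/-- The first projection. -/
def π₁ : Grpd.of (GrpdPullback f g) ⟶ X where
  obj p := p.fst
  map a := Hom.fst a
  map_id _ := rfl
  map_comp _ _ := rfl

/-- The second projection. -/
def π₂ : Grpd.of (GrpdPullback f g) ⟶ Y where
  obj p := p.snd
  map a := Hom.snd a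
  map_id _ := rfl
  map_comp _ _ := rfl

lemma condition : π₁ f g ≫ f = π₂ f g ≫ g := by
  refine CategoryTheory.Functor.ext (C := GrpdPullback f g) (D := Z) GrpdPullback.eq
    fun p q a => ?_
  have h := Hom.w a
  change f.map (Hom.fst a) = eqToHom p.eq ≫ g.map (Hom.snd a) ≫ eqToHom q.eq.symm
  rw [← Category.assoc, ← h]
  simp

variable {f g}

/-- The map into the strict pullback given by a commutative square. -/
def lift {T : Grpd.{v, u}} (a : T ⟶ X) (b : T ⟶ Y) (h : a ≫ f = b ≫ g) :
    T ⟶ Grpd.of (GrpdPullback f g) where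
  obj t := ⟨a.obj t, b.obj t, Functor.congr_obj h t⟩
  map {s t} m := ⟨a.map m, b.map m, by
    have := Functor.congr_hom h m
    change f.map (a.map m) = _ ≫ g.map (b.map m) ≫ _ at this
    rw [this]
    simp⟩
  map_id t := Hom.ext (a.map_id t) (b.map_id t)
  map_comp m n := Hom.ext (a.map_comp m n) (b.map_comp m n)

lemma fst_conj {p q p' q' : GrpdPullback f g} (h : p = p') (m : p' ⟶ q') (h' : q' = q) :
    Hom.fst (eqToHom h ≫ m ≫ eqToHom h') = eqToHom (congrArg GrpdPullback.fst h) ≫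
      Hom.fst m ≫ eqToHom (congrArg GrpdPullback.fst h') := by
  subst h h'
  simp

lemma snd_conj {p q p' q' : GrpdPullback f g} (h : p = p') (m : p' ⟶ q') (h' : q' = q) :
    Hom.snd (eqToHom h ≫ m ≫ eqToHom h') = eqToHom (congrArg GrpdPullback.snd h) ≫
      Hom.snd m ≫ eqToHom (congrArg GrpdPullback.snd h') := by
  subst h h'
  simp

lemma hom_ext {T : Grpd.{v, u}} {a b : T ⟶ Grpd.of (GrpdPullback f g)}
    (h₁ : a ≫ π₁ f g = b ≫ π₁ f g) (h₂ : a ≫ π₂ f g = b ≫ π₂ f g) : a = b := by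
  refine CategoryTheory.Functor.ext (C := T) (D := GrpdPullback f g)
    (fun t => GrpdPullback.ext (Functor.congr_obj h₁ t) (Functor.congr_obj h₂ t))
    (fun s t m => Hom.ext ?_ ?_)
  · exact (Functor.congr_hom h₁ m).trans (fst_conj _ (b.map m) _).symm
  · exact (Functor.congr_hom h₂ m).trans (snd_conj _ (b.map m) _).symm

lemma isPullback (f : X ⟶ Z) (g : Y ⟶ Z) : IsPullback (π₁ f g) (π₂ f g) f g :=
  ⟨⟨condition f g⟩, ⟨PullbackCone.IsLimit.mk _ (fun s => lift s.fst s.snd s.condition)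
    (fun _ => rfl) (fun _ => rfl) (fun _ _ h₁ h₂ => hom_ext h₁ h₂)⟩⟩

end GrpdPullback

/-- The (strict, levelwise) pullback of simplicial groupoids. -/
def simplicialPullback {X Y Z : SimplicialObject Grpd.{v, u}} (f : X ⟶ Z) (g : Y ⟶ Z) :
    SimplicialObject Grpd.{v, u} where
  obj n := Grpd.of (GrpdPullback (f.app n) (g.app n))
  map {n m} α := GrpdPullback.lift
    (GrpdPullback.π₁ (f.app n) (g.app n) ≫ X.map α)
    (GrpdPullback.π₂ (f.app n) (g.app n) ≫ Y.map α)
    (by rw [Category.assoc, Category.assoc, f.naturality, g.naturality, ← Category.assoc,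
          ← Category.assoc, GrpdPullback.condition])
  map_id n := GrpdPullback.hom_ext
    (by change _ ≫ X.map (𝟙 n) = _; rw [X.map_id]; rfl)
    (by change _ ≫ Y.map (𝟙 n) = _; rw [Y.map_id]; rfl)
  map_comp α β := GrpdPullback.hom_ext
    (by change _ ≫ X.map (α ≫ β) = _; rw [X.map_comp]; rfl)
    (by change _ ≫ Y.map (α ≫ β) = _; rw [Y.map_comp]; rfl)

/-- The construction `simplicialPullback` is the pullback in simplicial groupoids. -/
lemma isPullback_simplicialPullback {X Y Z : SimplicialObject Grpd.{v, u}}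
    (f : X ⟶ Z) (g : Y ⟶ Z) :
    ∃ (p : simplicialPullback f g ⟶ X) (q : simplicialPullback f g ⟶ Y),
      IsPullback p q f g := by
  let p : simplicialPullback f g ⟶ X :=
    { app := fun n => GrpdPullback.π₁ (f.app n) (g.app n)
      naturality := fun _ _ _ => rfl }
  let q : simplicialPullback f g ⟶ Y :=
    { app := fun n => GrpdPullback.π₂ (f.app n) (g.app n)
      naturality := fun _ _ _ => rfl }
  have hw : p ≫ f = q ≫ g := by
    ext n
    exact GrpdPullback.condition (f.app n) (g.app n)
  refine ⟨p, q, ⟨hw⟩, ⟨PullbackCone.IsLimit.mk hw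
    (fun s =>
      { app := fun n => GrpdPullback.lift (s.fst.app n) (s.snd.app n)
          (NatTrans.congr_app s.condition n)
        naturality := fun m n α => GrpdPullback.hom_ext
          (s.fst.naturality α) (s.snd.naturality α) })
    (fun s => rfl) (fun s => rfl) (fun s m h₁ h₂ => ?_)⟩⟩
  ext n
  exact GrpdPullback.hom_ext (NatTrans.congr_app h₁ n) (NatTrans.congr_app h₂ n)

end StrictPullback

/-- The relative `S_•`-construction of an exact functor `F : A ⥤ B`: the pullback of
`d₀ : P S_•(B) ⟶ S_•(B)` along `S_•(F) : S_•(A) ⟶ S_•(B)`. -/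
def relSdot {A B : Type u} [Category.{v} A] [Preadditive A] [HasFiniteBiproducts A]
    [ExactCategory A] [Category.{v} B] [Preadditive B] [HasFiniteBiproducts B]
    [ExactCategory B] (F : A ⥤ B) [ExactFunctor F] : SimplicialObject Grpd.{v, max u v} :=
  simplicialPullback (initialPathD₀ (sdot B)) (sdotMap F)

section HomotopyLimit

variable {J : Type w} [Category.{w} J]

/-- Objects of the homotopy limit (the pseudo-limit) of a diagram of groupoids `K`: families
of objects `x j` with coherent isomorphisms `K(a)(x i) ⟶ x j` for `a : i ⟶ j`. -/
structure HoLim (K : J ⥤ Grpd.{v, u}) : Type (max w v u) where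
  pt : ∀ j, K.obj j
  iso : ∀ {i j : J} (a : i ⟶ j), (K.map a).obj (pt i) ⟶ pt j
  iso_id : ∀ j, iso (𝟙 j) = eqToHom (Functor.congr_obj (K.map_id j) (pt j))
  iso_comp : ∀ {i j k : J} (a : i ⟶ j) (b : j ⟶ k),
    iso (a ≫ b) = eqToHom (Functor.congr_obj (K.map_comp a b) (pt i)) ≫
      (K.map b).map (iso a) ≫ iso b

namespace HoLim

variable {K : J ⥤ Grpd.{v, u}}

/-- Morphisms of the homotopy limit: families of morphisms compatible with the structure
isomorphisms. -/
@[ext]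
structure Hom (x y : HoLim K) : Type (max w v) where
  app : ∀ j, x.pt j ⟶ y.pt j
  w : ∀ {i j : J} (a : i ⟶ j), x.iso a ≫ app j = (K.map a).map (app i) ≫ y.iso a

instance : Category (HoLim K) where
  Hom x y := Hom x y
  id x := ⟨fun j => 𝟙 _, fun a => by simp⟩
  comp f g := ⟨fun j => f.app j ≫ g.app j, fun a => by
    rw [← Category.assoc, f.w, Category.assoc, g.w, Functor.map_comp, Category.assoc]⟩
  id_comp f := Hom.ext (funext fun j => Category.id_comp _)
  comp_id f := Hom.ext (funext fun j => Category.comp_id _)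
  assoc f g h := Hom.ext (funext fun j => Category.assoc _ _ _)

end HoLim

end HomotopyLimit

section TwoSegal

variable {n : ℕ}

/-- A graph on the vertices `0, …, n` of a convex `(n+1)`-gon without crossing edges. -/
def NonCrossing (T : SimpleGraph (Fin (n + 1))) : Prop :=
  ∀ i k j l : Fin (n + 1), i < k → k < j → j < l → ¬ (T.Adj i j ∧ T.Adj k l)

/-- A triangulation of the convex `(n+1)`-gon with vertices `0, …, n`, given by the set of its
edges (sides and diagonals): a maximal non-crossing graph. -/
def IsTriangulation (T : SimpleGraph (Fin (n + 1))) : Prop :=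
  Maximal NonCrossing T

/-- The category of simplices of the simplicial subset `Δ^T` of `Δ[n]`: maps `[m] ⟶ [n]` such
that any two vertices in the image are equal or joined by an edge of `T`. When `T` is a
triangulation, these are the maps whose image lies in a triangle of `T`. -/
abbrev Simplices (T : SimpleGraph (Fin (n + 1))) : Type :=
  ObjectProperty.FullSubcategory (C := Over (SimplexCategory.mk n))
    (fun α => T.IsClique (Set.range α.hom.toOrderHom))

/-- The diagram `σ ↦ X_m`, for `σ : [m] ⟶ [n]` a simplex of `Δ^T`. -/
def simplexDiagram (X : SimplicialObject Grpd.{v, u}) (T : SimpleGraph (Fin (n + 1))) :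
    (Simplices T)ᵒᵖ ⥤ Grpd.{v, u} :=
  (ObjectProperty.ι _ ⋙ Over.forget (SimplexCategory.mk n)).op ⋙ X

lemma simplexDiagram_obj_map (X : SimplicialObject Grpd.{v, u}) (T : SimpleGraph (Fin (n + 1)))
    {σ τ : (Simplices T)ᵒᵖ} (a : σ ⟶ τ) :
    X.map σ.unop.obj.hom.op ≫ (simplexDiagram X T).map a = X.map τ.unop.obj.hom.op := by
  refine (X.map_comp _ _).symm.trans ?_
  exact congrArg X.map (congrArg Quiver.Hom.op (Over.w a.unop.hom))

lemma eqToHom_eq_comp_map {C D : Type*} [Category C] [Category D] (G : C ⥤ D) {x y : C}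
    {z t : D} (h : z = t) (h₁ : z = G.obj x) (h₂ : x = y) (h₃ : G.obj y = t) :
    eqToHom h = eqToHom h₁ ≫ G.map (eqToHom h₂) ≫ eqToHom h₃ := by
  subst h₂ h₃
  simp

lemma eqToHom_comp_map {C D : Type*} [Category C] [Category D] {G H : C ⥤ D} (h : G = H)
    {x y : C} (f : x ⟶ y) :
    eqToHom (Functor.congr_obj h x) ≫ H.map f =
      G.map f ≫ eqToHom (Functor.congr_obj h y) := by
  subst h
  simp

/-- The `2`-Segal map `X_n ⟶ X_T`, where `X_T` is the homotopy limit of `X` over the simplices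
of `Δ^T`; it sends `x` to the family of its restrictions. -/
def twoSegalMap (X : SimplicialObject Grpd.{v, u}) (T : SimpleGraph (Fin (n + 1))) :
    X.obj (op (SimplexCategory.mk n)) ⥤ HoLim (simplexDiagram X T) where
  obj x :=
    { pt := fun σ => (X.map σ.unop.obj.hom.op).obj x
      iso := fun a => eqToHom (Functor.congr_obj (simplexDiagram_obj_map X T a) x)
      iso_id := fun _ => rfl
      iso_comp := fun a b => eqToHom_eq_comp_map ((simplexDiagram X T).map b) _ _ _ _ }
  map {x y} f :=
    { app := fun σ => (X.map σ.unop.obj.hom.op).map f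
      w := fun a => eqToHom_comp_map (simplexDiagram_obj_map X T a) f }
  map_id x := HoLim.Hom.ext (funext fun σ => (X.map σ.unop.obj.hom.op).map_id x)
  map_comp f g := HoLim.Hom.ext (funext fun σ => (X.map σ.unop.obj.hom.op).map_comp f g)

/-- A simplicial groupoid is `2`-Segal if, for every `n ≥ 2` and every triangulation `T` of the
convex `(n+1)`-gon, the map `X_n ⟶ X_T` is an equivalence of groupoids. -/
def IsTwoSegal (X : SimplicialObject Grpd.{v, u}) : Prop :=
  ∀ (n : ℕ), 2 ≤ n → ∀ T : SimpleGraph (Fin (n + 1)), IsTriangulation T →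
    (twoSegalMap X T).IsEquivalence

end TwoSegal

end RelSdot

/-! A triangulation `T` of a polygon has an ear `i, i+1, i+2` whose tip `i+1` is neither the first
nor the last vertex (`IsTriangulation.exists_ear`). If `T'` is what remains after cutting off this
ear, then `X_T` is the homotopy pullback of `X_{T'}` and `X_2` over `X_1`. By induction down to the
triangle, `X` is 2-Segal as soon as `X_{N+1}` is the homotopy pullback of `X_N` and `X_2` over `X_1`
for every ear (`isTwoSegal_of_isLocalSq`).

For `S_•(A)` this is the calculus of filtered objects. A diagram is determined by its row `a_{01} ↣
⋯ ↣ a_{0n}`, the other entries being the quotients `a_{0j}/a_{0i}`. If the term `a_{0,i+1}` is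
missing, but a triangle supplies an admissible subobject `a_{i,i+1}` of `a_{i,i+2} =
a_{0,i+2}/a_{0,i}`, then the missing term must be the preimage of that subobject in `a_{0,i+2}`.
This gives existence (`IsSdot.exists_obj_of_isEar`) and full faithfulness
(`IsSdot.exists_hom_of_isEar`), hence `isHPull_sdotRes`. The input from exact categories is
`adMono_comp`, `adMono_of_isPullback` and Noether's theorem `IsExactPair.quotient`.

The ear squares of the path object are homotopy pullbacks by the pasting law
(`isLocalSq_initialPath`). Finally `d₀` is a levelwise isofibration (`isofibration_initialPathD₀`),
so the strict pullback defining `relSdot` behaves like a homotopy pullback and inherits the ear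
squares from its three constituents (`isLocalSq_simplicialPullback`). -/

namespace RelSdot

/-! ### Consequences of Keller's axioms: isomorphisms and composites of admissible monomorphisms. -/

section ExactLemmas

open scoped ZeroObject

variable {C : Type u} [Category.{v} C] [Preadditive C] [HasFiniteBiproducts C] [ExactCategory C]

lemma exactSeq_of_iso {X Y Z X' Y' Z' : C} {i : X ⟶ Y} {p : Y ⟶ Z} {w : i ≫ p = 0}
    (h : ExactCategory.exactSeq (ShortComplex.mk i p w)) (a : X ≅ X') (b : Y ≅ Y') (c : Z ≅ Z')
    {i' : X' ⟶ Y'} {p' : Y' ⟶ Z'} (h₁ : a.hom ≫ i' = i ≫ b.hom) (h₂ : b.hom ≫ p' = p ≫ c.hom) :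
    ∃ w' : i' ≫ p' = 0, ExactCategory.exactSeq (ShortComplex.mk i' p' w') := by
  have w' : i' ≫ p' = 0 := by
    rw [← cancel_epi a.hom, ← Category.assoc, h₁, Category.assoc, h₂, ← Category.assoc, w]
    simp
  exact ⟨w', ExactCategory.closed_iso _ _ ⟨ShortComplex.isoMk a b c h₁ h₂⟩ h⟩

lemma adMono_of_iso {X Y X' Y' : C} {i : X ⟶ Y} (h : adMono C i) (a : X ≅ X') (b : Y ≅ Y')
    {i' : X' ⟶ Y'} (h₁ : a.hom ≫ i' = i ≫ b.hom) : adMono C i' := by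
  obtain ⟨Z, p, w, h⟩ := h
  obtain ⟨w', h'⟩ := exactSeq_of_iso h a b (Iso.refl Z) (p' := b.inv ≫ p) h₁ (by simp)
  exact ⟨Z, _, w', h'⟩

lemma adEpi_of_iso {X Y X' Y' : C} {p : X ⟶ Y} (h : adEpi C p) (a : X ≅ X') (b : Y ≅ Y')
    {p' : X' ⟶ Y'} (h₁ : a.hom ≫ p' = p ≫ b.hom) : adEpi C p' := by
  obtain ⟨Z, i, w, h⟩ := h
  obtain ⟨w', h'⟩ := exactSeq_of_iso h (Iso.refl Z) a b (i' := i ≫ a.hom) (by simp) h₁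
  exact ⟨Z, _, w', h'⟩

lemma mono_of_adMono {X Y : C} {i : X ⟶ Y} (h : adMono C i) : Mono i := by
  obtain ⟨Z, p, w, h⟩ := h
  obtain ⟨k⟩ := ExactCategory.isKernel _ h
  exact ⟨fun f g h => Fork.IsLimit.hom_ext k (by simpa using h)⟩

lemma epi_of_adEpi {X Y : C} {p : X ⟶ Y} (h : adEpi C p) : Epi p := by
  obtain ⟨Z, i, w, h⟩ := h
  obtain ⟨k⟩ := ExactCategory.isCokernel _ h
  exact ⟨fun f g h => Cofork.IsColimit.hom_ext k (by simpa using h)⟩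

lemma exactSeq_of_isKernel {K X Y : C} {p : X ⟶ Y} (h : adEpi C p) {i : K ⟶ X}
    (w : i ≫ p = 0) (hi : IsLimit (KernelFork.ofι i w)) :
    ExactCategory.exactSeq (ShortComplex.mk i p w) := by
  obtain ⟨K', i', w', h⟩ := h
  obtain ⟨k⟩ := ExactCategory.isKernel _ h
  have he := k.conePointUniqueUpToIso_hom_comp hi WalkingParallelPair.zero
  exact (exactSeq_of_iso h (k.conePointUniqueUpToIso hi) (Iso.refl X) (Iso.refl Y)
    (he.trans (Category.comp_id _).symm) (by simp)).2

lemma exactSeq_of_isCokernel {X Y Q : C} {i : X ⟶ Y} (h : adMono C i) {p : Y ⟶ Q}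
    (w : i ≫ p = 0) (hp : IsColimit (CokernelCofork.ofπ p w)) :
    ExactCategory.exactSeq (ShortComplex.mk i p w) := by
  obtain ⟨K', p', w', h⟩ := h
  obtain ⟨k⟩ := ExactCategory.isCokernel _ h
  have he := k.comp_coconePointUniqueUpToIso_hom hp WalkingParallelPair.one
  exact (exactSeq_of_iso h (Iso.refl X) (Iso.refl Y) (k.coconePointUniqueUpToIso hp) (by simp)
    ((Category.id_comp _).trans he.symm)).2

lemma adEpi_of_isPullback {X Y Z W : C} {i : X ⟶ Y} {p : X ⟶ Z} {q : Y ⟶ W} {j : Z ⟶ W}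
    (sq : IsPullback i p q j) (hq : adEpi C q) : adEpi C p := by
  obtain ⟨T, f', p', sq', hp'⟩ := ExactCategory.pullback_epi j q hq
  exact adEpi_of_iso hp' (sq'.isoIsPullback _ _ sq) (Iso.refl Z) (by simp)

lemma adMono_of_isPushout {X Y Z W : C} {i : X ⟶ Y} {p : X ⟶ Z} {q : Y ⟶ W} {j : Z ⟶ W}
    (sq : IsPushout i p q j) (hi : adMono C i) : adMono C j := by
  obtain ⟨T, f', p', sq', hp'⟩ := ExactCategory.pushout_mono p i hi
  exact adMono_of_iso hp' (Iso.refl Z) (sq'.isoIsPushout _ _ sq) (by simp)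

/-- The axioms only provide identities of zero objects, and only as epimorphisms. The kernel `K ⟶ 0`
of such an identity is an admissible monomorphism and an isomorphism, and its pushout along `0 : K ⟶
X` is an admissible isomorphism out of `X`. -/
lemma adMono_of_isIso {X Y : C} (i : X ⟶ Y) [IsIso i] : adMono C i := by
  have := hasZeroObject_of_hasFiniteBiproducts C
  obtain ⟨K, k, w, h⟩ := ExactCategory.id_zero (0 : C) (isZero_zero C)
  have mk : Mono k := mono_of_adMono ⟨_, _, _, h⟩
  have : IsIso k := isIso_of_source_target_iso_zero k (IsZero.of_mono k (isZero_zero C)).isoZero (Iso.refl 0)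
  obtain ⟨T, g', j, sq, hj⟩ := ExactCategory.pushout_mono (0 : K ⟶ X) k ⟨_, _, _, h⟩
  have : IsIso j := sq.isIso_inr_of_isIso
  exact adMono_of_iso hj (Iso.refl X) ((asIso j).symm ≪≫ asIso i) (by simp)

/-- Keller's argument: closure under composition is an axiom only for epimorphisms. The pushout `p'`
of `p = coker f` along `g` should be the cokernel of `f ≫ g`, but the axioms do not directly make it
an admissible epimorphism. After adding a summand `Y` to its source it becomes, up to a shear, a
composite of two base changes of admissible epimorphisms; the summand is then removed by a pushout.
-/
lemma adMono_comp {X Y Z : C} {f : X ⟶ Y} {g : Y ⟶ Z} (hf : adMono C f) (hg : adMono C g) :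
    adMono C (f ≫ g) := by
  have := hasBinaryBiproducts_of_finite_biproducts C
  obtain ⟨Q, p, w, h⟩ := hf
  obtain ⟨P, p', j, sq, hj⟩ := ExactCategory.pushout_mono p g hg
  obtain ⟨R, b, w₁, w₂, h₁, h₂⟩ := exists_exactSeq_right hg hj sq
  obtain ⟨k₁⟩ := ExactCategory.isKernel _ h₁
  obtain ⟨k₂⟩ := ExactCategory.isKernel _ h₂
  obtain ⟨kf⟩ := ExactCategory.isKernel _ h
  have mf : Mono f := mono_of_adMono ⟨_, _, _, h⟩
  have mg : Mono g := mono_of_adMono hg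
  have mj : Mono j := mono_of_adMono hj
  have pb : IsPullback g p p' j := isPullback_of_rows sq.w rfl _ _ k₁ k₂
  -- A pair `(z, x)` in `Z ×_R P` has `x - p' z` in the kernel `Q` of `b`, so this fibre product is
  -- `Z ⊞ Q`.
  have pb₁ : IsPullback (biprod.fst : Z ⊞ Q ⟶ Z) (biprod.desc p' j) (p' ≫ b) b := by
    refine ⟨⟨by ext <;> simp [w₂]⟩, ⟨PullbackCone.IsLimit.mk _
      (fun s => biprod.lift s.fst (KernelFork.IsLimit.lift' k₂ (s.snd - s.fst ≫ p')
        (by simpa [sub_eq_zero] using s.condition.symm)).1) (fun s => by simp) ?_ ?_⟩⟩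
    · intro s
      have := (KernelFork.IsLimit.lift' k₂ (s.snd - s.fst ≫ p')
        (by simpa [sub_eq_zero] using s.condition.symm)).2
      dsimp at this
      simp [biprod.lift_desc, this]
    · intro s m hm hm'
      have := (KernelFork.IsLimit.lift' k₂ (s.snd - s.fst ≫ p')
        (by simpa [sub_eq_zero] using s.condition.symm)).2
      dsimp at this
      ext
      · simpa using hm
      · rw [← cancel_mono j, biprod.lift_snd, this, ← hm, ← hm', biprod.desc_eq]
        simp
  have pb₂ : IsPullback (biprod.snd : Z ⊞ Y ⟶ Y) (biprod.map (𝟙 Z) p) p biprod.snd := by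
    refine ⟨⟨by simp⟩, ⟨PullbackCone.IsLimit.mk _
      (fun s => biprod.lift (s.snd ≫ biprod.fst) s.fst) (fun s => by simp) (fun s => ?_) ?_⟩⟩
    · ext
      · simp
      · simpa using s.condition
    · intro s m hm hm'
      ext
      · simp [← hm']
      · simpa using hm
  have e₁ : adEpi C (biprod.desc p' j) := adEpi_of_isPullback pb₁ ⟨_, _, _, h₁⟩
  have e₂ : adEpi C (biprod.map (𝟙 Z) p) := adEpi_of_isPullback pb₂ ⟨_, _, _, h⟩
  -- The composite of the two epimorphisms is `(p', g ≫ p')`; this shear clears its second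
  -- component.
  let σ : Z ⊞ Y ≅ Z ⊞ Y :=
    { hom := biprod.lift (biprod.fst - biprod.snd ≫ g) biprod.snd
      inv := biprod.lift (biprod.fst + biprod.snd ≫ g) biprod.snd
      hom_inv_id := by ext <;> simp
      inv_hom_id := by ext <;> simp }
  have e₃ : adEpi C ((biprod.fst : Z ⊞ Y ⟶ Z) ≫ p') := by
    refine adEpi_of_iso (ExactCategory.comp_epi _ _ e₂ e₁) σ.symm (Iso.refl P) ?_
    ext <;> simp [σ, sq.w]
  have w₃ : biprod.map (f ≫ g) (𝟙 Y) ≫ (biprod.fst : Z ⊞ Y ⟶ Z) ≫ p' = 0 := by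
    ext <;> simp [sq.w, reassoc_of% w]
  have k : IsLimit (KernelFork.ofι _ w₃) := by
    have key : ∀ {T : C} (t : T ⟶ Z ⊞ Y), t ≫ (biprod.fst : Z ⊞ Y ⟶ Z) ≫ p' = 0 →
        ∃ s : T ⟶ X, s ≫ f ≫ g = t ≫ biprod.fst := by
      intro T t ht
      have h0 : (t ≫ biprod.fst) ≫ p' = (0 : T ⟶ Q) ≫ j := by simpa using ht
      obtain ⟨s, hs⟩ := KernelFork.IsLimit.lift' kf (pb.lift _ _ h0) (by simp)
      refine ⟨s, ?_⟩
      dsimp at hs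
      rw [← Category.assoc, hs, pb.lift_fst]
    choose s hs using @key
    refine KernelFork.IsLimit.ofι _ w₃ (fun t ht => biprod.lift (s t ht) (t ≫ biprod.snd)) ?_ ?_
    · intro T t ht
      ext
      · simp [hs]
      · simp
    · intro T t ht m hm
      ext
      · rw [← cancel_mono f, ← cancel_mono g]
        simp [hs, ← hm]
      · simp [← hm]
  have m₃ : adMono C (biprod.map (f ≫ g) (𝟙 Y)) := ⟨_, _, _, exactSeq_of_isKernel e₃ w₃ k⟩
  -- Collapsing the summand `Y` on both sides is a pushout and turns `(f ≫ g) ⊞ 𝟙` into `f ≫ g`.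
  refine adMono_of_isPushout (p := biprod.fst) (q := biprod.fst) ⟨⟨by simp⟩,
    ⟨PushoutCocone.IsColimit.mk _ (fun s => biprod.inl ≫ s.inl) ?_ ?_ ?_⟩⟩ m₃
  · intro s
    have hs := biprod.inr ≫= s.condition
    ext
    · simp
    · simpa using hs.symm
  · intro s
    have hs := biprod.inl ≫= s.condition
    simpa using hs
  · intro s m hm _
    simp [← hm]

end ExactLemmas
end RelSdot

namespace RelSdot

/-! ### Exact pairs, isomorphism theorems, and the diagram of quotients of a filtered object. -/

section Quotients

variable {C : Type u} [Category.{v} C] [Preadditive C] [HasFiniteBiproducts C] [ExactCategory C]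

/-- The proposition that `i`, `p` form an exact sequence. -/
def IsExactPair {X Y Z : C} (i : X ⟶ Y) (p : Y ⟶ Z) : Prop :=
  ∃ w : i ≫ p = 0, ExactCategory.exactSeq (ShortComplex.mk i p w)

namespace IsExactPair

variable {X Y Z : C} {i : X ⟶ Y} {p : Y ⟶ Z}

lemma zero (h : IsExactPair i p) : i ≫ p = 0 := h.1

lemma adMono (h : IsExactPair i p) : adMono C i := ⟨_, _, _, h.2⟩

lemma adEpi (h : IsExactPair i p) : adEpi C p := ⟨_, _, _, h.2⟩

lemma mono (h : IsExactPair i p) : Mono i := mono_of_adMono h.adMono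

lemma epi (h : IsExactPair i p) : Epi p := epi_of_adEpi h.adEpi

lemma exists_desc (h : IsExactPair i p) {T : C} (t : Y ⟶ T) (ht : i ≫ t = 0) :
    ∃ s : Z ⟶ T, p ≫ s = t := by
  obtain ⟨k⟩ := ExactCategory.isCokernel _ h.2
  exact ⟨_, (CokernelCofork.IsColimit.desc' k t ht).2⟩

lemma exists_lift (h : IsExactPair i p) {T : C} (t : T ⟶ Y) (ht : t ≫ p = 0) :
    ∃ s : T ⟶ X, s ≫ i = t := by
  obtain ⟨k⟩ := ExactCategory.isKernel _ h.2
  exact ⟨_, (KernelFork.IsLimit.lift' k t ht).2⟩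

/-- Maps between exact pairs induce maps on the quotients. -/
lemma exists_map (h : IsExactPair i p) {X' Y' Z' : C} {i' : X' ⟶ Y'} {p' : Y' ⟶ Z'}
    (h' : IsExactPair i' p') (a : X ⟶ X') (b : Y ⟶ Y') (w : i ≫ b = a ≫ i') :
    ∃ c : Z ⟶ Z', p ≫ c = b ≫ p' :=
  h.exists_desc _ (by rw [← Category.assoc, w, Category.assoc, h'.zero, comp_zero])

lemma exists_iso (h : IsExactPair i p) {X' Y' Z' : C} {i' : X' ⟶ Y'} {p' : Y' ⟶ Z'}
    (h' : IsExactPair i' p') (a : X ≅ X') (b : Y ≅ Y') (w : i ≫ b.hom = a.hom ≫ i') :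
    ∃ c : Z ≅ Z', p ≫ c.hom = b.hom ≫ p' := by
  have := h.epi
  have := h'.epi
  obtain ⟨c, hc⟩ := h.exists_map h' a.hom b.hom w
  obtain ⟨d, hd⟩ := h'.exists_map h a.inv b.inv (by
    rw [Iso.comp_inv_eq, Category.assoc, w, Iso.inv_hom_id_assoc])
  refine ⟨⟨c, d, ?_, ?_⟩, hc⟩
  · rw [← cancel_epi p, reassoc_of% hc, hd]; simp
  · rw [← cancel_epi p', reassoc_of% hd, hc]; simp

lemma of_iso (h : IsExactPair i p) {X' Y' Z' : C} (a : X ≅ X') (b : Y ≅ Y') (c : Z ≅ Z')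
    {i' : X' ⟶ Y'} {p' : Y' ⟶ Z'} (h₁ : a.hom ≫ i' = i ≫ b.hom) (h₂ : b.hom ≫ p' = p ≫ c.hom) :
    IsExactPair i' p' :=
  exactSeq_of_iso h.2 a b c h₁ h₂

/-- The pushout square relating two quotients by the same subobject. -/
lemma isPushout (h : IsExactPair i p) {W Q : C} {j : Y ⟶ W} {q : W ⟶ Q}
    (h' : IsExactPair (i ≫ j) q) {t : Z ⟶ Q} (ht : p ≫ t = j ≫ q) : IsPushout j p q t := by
  obtain ⟨k⟩ := ExactCategory.isCokernel _ h.2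
  obtain ⟨k'⟩ := ExactCategory.isCokernel _ h'.2
  exact isPushout_of_cols ht.symm rfl _ _ k k'

/-- Noether's isomorphism theorem. -/
lemma quotient (h : IsExactPair i p) {W Q R : C} {j : Y ⟶ W} {q : W ⟶ Q}
    (h' : IsExactPair (i ≫ j) q) {r : W ⟶ R} (hj : IsExactPair j r) {t : Z ⟶ Q}
    (ht : p ≫ t = j ≫ q) {s : Q ⟶ R} (hs : q ≫ s = r) : IsExactPair t s := by
  -- Since `t` is the pushout of `j`, both have the same cokernel.
  have sq := h.isPushout h' ht
  obtain ⟨R', b, w₁, w₂, h₁, h₂⟩ :=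
    exists_exactSeq_right hj.adMono (adMono_of_isPushout sq hj.adMono) sq
  obtain ⟨e, he⟩ := exists_iso ⟨w₁, h₁⟩ hj (Iso.refl _) (Iso.refl _) (by simp)
  have := h'.epi
  refine of_iso ⟨w₂, h₂⟩ (Iso.refl _) (Iso.refl _) e (by simp) ?_
  rw [← cancel_epi q]
  simpa [hs] using he.symm

lemma isZero_of_isIso (h : IsExactPair i p) [IsIso i] : IsZero Z := by
  have := h.epi
  have h0 : p = 0 := by rw [← cancel_epi i, h.zero, comp_zero]
  rw [IsZero.iff_id_eq_zero, ← cancel_epi p, h0, zero_comp, zero_comp]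

end IsExactPair

lemma isExactPair_of_isPushout {X Y Z W : C} {i : X ⟶ Y} {p : X ⟶ Z} {q : Y ⟶ W} {j : Z ⟶ W}
    (sq : IsPushout i p q j) (hi : adMono C i) (hZ : IsZero Z) : IsExactPair i q := by
  have w : i ≫ q = 0 := by rw [sq.w, hZ.eq_zero_of_src j, comp_zero]
  refine ⟨w, exactSeq_of_isCokernel hi w (CokernelCofork.IsColimit.ofπ q w
    (fun t ht => sq.desc t 0 (by rw [ht, comp_zero])) (fun t ht => sq.inl_desc _ _ _) ?_)⟩
  intro T t ht m hm
  refine sq.hom_ext ?_ (hZ.eq_of_src _ _)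
  rw [sq.inl_desc, hm]

/-- The pullback of an admissible monomorphism along an admissible epimorphism. -/
lemma adMono_of_isPullback {X Y Z W : C} {i : X ⟶ Y} {p : X ⟶ Z} {q : Y ⟶ W} {j : Z ⟶ W}
    (sq : IsPullback i p q j) (hq : adEpi C q) (hj : adMono C j) : adMono C i := by
  obtain ⟨R, r, h⟩ : ∃ (R : C) (r : W ⟶ R), IsExactPair j r := by
    obtain ⟨R, r, w, h⟩ := hj
    exact ⟨R, r, w, h⟩
  have := h.mono
  have w : i ≫ q ≫ r = 0 := by rw [← Category.assoc, sq.w, Category.assoc, h.zero, comp_zero]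
  -- The map `i` is a kernel of `q ≫ r`, which is a composite of admissible epimorphisms.
  have key : ∀ {T : C} (t : T ⟶ Y), t ≫ q ≫ r = 0 → ∃ s : T ⟶ X, s ≫ i = t := by
    intro T t ht
    obtain ⟨s, hs⟩ := h.exists_lift (t ≫ q) (by simpa using ht)
    exact ⟨sq.lift t s hs.symm, sq.lift_fst _ _ _⟩
  choose s hs using @key
  refine ⟨_, _, w, exactSeq_of_isKernel (ExactCategory.comp_epi _ _ hq h.adEpi) w
    (KernelFork.IsLimit.ofι i w s hs ?_)⟩
  intro T t ht m hm
  refine sq.hom_ext (by rw [hm, hs]) ?_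
  rw [← cancel_mono j, Category.assoc, Category.assoc, ← sq.w, reassoc_of% hm, reassoc_of% hs]

/-- The kernel of a base change of an admissible epimorphism. -/
lemma IsExactPair.of_isPullback {K X Y Z W : C} {i : X ⟶ Y} {p : X ⟶ Z} {q : Y ⟶ W} {j : Z ⟶ W}
    (sq : IsPullback i p q j) {k : K ⟶ Y} (h : IsExactPair k q) {l : K ⟶ X} (h₁ : l ≫ i = k)
    (h₂ : l ≫ p = 0) : IsExactPair l p := by
  refine ⟨h₂, exactSeq_of_isKernel (adEpi_of_isPullback sq h.adEpi) h₂ ?_⟩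
  have key : ∀ {T : C} (t : T ⟶ X), t ≫ p = 0 → ∃ s : T ⟶ K, s ≫ l = t := by
    intro T t ht
    obtain ⟨s, hs⟩ := h.exists_lift (t ≫ i) (by rw [Category.assoc, sq.w, reassoc_of% ht, zero_comp])
    refine ⟨s, sq.hom_ext ?_ ?_⟩
    · rw [Category.assoc, h₁, hs]
    · rw [Category.assoc, h₂, ht, comp_zero]
  have := h.mono
  choose s hs using @key
  refine KernelFork.IsLimit.ofι l h₂ s hs ?_
  intro T t ht m hm
  rw [← cancel_mono k, ← h₁, reassoc_of% hm, reassoc_of% (hs t ht)]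

/-- A chain of admissible monomorphisms, given as subobjects of `T`, has a diagram of
quotients. -/
lemma exists_quotientDiagram (n : SimplexCategory) {T : C} (c : Fin (n.len + 1) → Over T)
    (hm : ∀ k, Mono (c k).hom)
    (hc : ∀ k l, k ≤ l → ∃ f : c k ⟶ c l, adMono C f.left) :
    ∃ (D : Ar n ⥤ C) (_ : IsSdot C D) (π : ∀ p : Ar n, (c p.1.2).left ⟶ D.obj p),
      (∀ (p q : Ar n) (a : p ⟶ q) (f : c p.1.2 ⟶ c q.1.2), π p ≫ D.map a = f.left ≫ π q) ∧
      ∀ (p : Ar n) (f : c p.1.1 ⟶ c p.1.2), IsExactPair f.left (π p) := by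
  choose f hf using hc
  -- Maps between subobjects of `T` are unique; every coherence below reduces to this.
  have hs : ∀ {k l} (g g' : c k ⟶ c l), g = g' := fun {k l} g g' => by
    have := hm l
    ext
    rw [← cancel_mono (c l).hom, Over.w, Over.w]
  have hq : ∀ p : Ar n, ∃ (Q : C) (π : (c p.1.2).left ⟶ Q), IsExactPair (f _ _ p.2).left π :=
    fun p => by
      obtain ⟨Q, π, w, h⟩ := hf _ _ p.2
      exact ⟨Q, π, w, h⟩
  choose Q π hπ using hq
  have he : ∀ p, Epi (π p) := fun p => (hπ p).epi
  have hd : ∀ (p q : Ar n) (h : p ≤ q), ∃ g : Q p ⟶ Q q, π p ≫ g = (f _ _ h.2).left ≫ π q :=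
    fun p q h => (hπ p).exists_map (hπ q) (f _ _ h.1).left _ (by
      rw [← Over.comp_left, ← Over.comp_left]
      exact congrArg _ (hs _ _))
  choose g hg using hd
  have hg' : ∀ (p q : Ar n) (h : p ≤ q) (a : c p.1.2 ⟶ c q.1.2),
      π p ≫ g p q h = a.left ≫ π q := fun p q h a => by rw [hg, hs a]
  let D : Ar n ⥤ C :=
    { obj := Q
      map := fun {p q} a => g p q (leOfHom a)
      map_id := fun p => by
        rw [← cancel_epi (π p), hg' _ _ _ (𝟙 _)]
        simp
      map_comp := fun {p q r} a b => by
        rw [← cancel_epi (π p), hg, ← Category.assoc, hg, Category.assoc, hg, ← Category.assoc,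
          ← Over.comp_left]
        exact congrArg (fun t => Over.Hom.left t ≫ π r) (hs _ _) }
  have hex : ∀ (p : Ar n) (a : c p.1.1 ⟶ c p.1.2), IsExactPair a.left (π p) := fun p a => by
    rw [hs a (f _ _ p.2)]; exact hπ p
  have hpo : ∀ (i j l) (hij : i ≤ j) (hjl : j ≤ l),
      IsPushout (f j l hjl).left (π (Ar.mk i j hij)) (π (Ar.mk i l (hij.trans hjl)))
        (D.map (Ar.hor i j l hij hjl)) := fun i j l hij hjl => by
    refine (hπ (Ar.mk i j hij)).isPushout (j := (f j l hjl).left) ?_ (hg' _ _ _ _)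
    rw [← Over.comp_left]
    exact hex (Ar.mk i l (hij.trans hjl)) (f _ _ _ ≫ f _ _ _)
  -- Noether's theorem for `c i ⊆ c j ⊆ c l`; it yields the admissibility of horizontal and of
  -- vertical maps at once.
  have hquo : ∀ (i j l) (hij : i ≤ j) (hjl : j ≤ l),
      IsExactPair (D.map (Ar.hor i j l hij hjl)) (D.map (Ar.ver i j l hij hjl)) :=
    fun i j l hij hjl => by
    refine (hπ (Ar.mk i j hij)).quotient (j := (f j l hjl).left) (q := π (Ar.mk i l (hij.trans hjl)))
      ?_ (hπ (Ar.mk j l hjl)) (hg' _ _ _ _) ?_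
    · rw [← Over.comp_left]
      exact hex (Ar.mk i l (hij.trans hjl)) (f _ _ _ ≫ f _ _ _)
    · exact (hg' (Ar.mk i l (hij.trans hjl)) (Ar.mk j l hjl) ⟨hij, le_rfl⟩ (𝟙 _)).trans
        (Category.id_comp _)
  refine ⟨D, ⟨fun i => ?_, fun i j l hij hjl => (hquo i j l hij hjl).adMono,
    fun i k j hik hkj => (hquo i k j hik hkj).adEpi, fun i k j l hik hkj hjl => ?_⟩, π,
    fun p q a b => hg' p q _ b, hex⟩
  · have h := hex (Ar.mk i i le_rfl) (𝟙 _)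
    have : IsIso (Over.Hom.left (𝟙 (c i))) := by
      rw [Over.id_left]; infer_instance
    exact h.isZero_of_isIso
  · obtain ⟨k₁⟩ := ExactCategory.isKernel _ (hquo i j l (hik.trans hkj) hjl).2
    obtain ⟨k₂⟩ := ExactCategory.isKernel _ (hquo k j l hkj hjl).2
    have e : D.map (Ar.hor i j l (hik.trans hkj) hjl) ≫ D.map (Ar.ver i k l hik (hkj.trans hjl)) =
        D.map (Ar.ver i k j hik hkj) ≫ D.map (Ar.hor k j l hkj hjl) := by
      rw [← D.map_comp, ← D.map_comp]
    -- It is a pullback because both rows are kernels of maps to `D (j, l)`. It is a pushout by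
    -- cancellation: stacked below the pushout over `c j ⟶ c l` with quotients by `c i`, it gives
    -- the pushout with quotients by `c k`.
    refine BicartesianSq.of_isPullback_isPushout
      (isPullback_of_rows e (D.map_comp _ (Ar.ver k j l hkj hjl)).symm _ _ k₁ k₂) ?_
    refine IsPushout.of_top (h₁₁ := (f j l hjl).left) (v₁₁ := π (Ar.mk i j _))
      (v₁₂ := π (Ar.mk i l _)) ?_ e (hpo i j l (hik.trans hkj) hjl)
    have e₁ := (hg' (Ar.mk i j (hik.trans hkj)) (Ar.mk k j hkj) ⟨hik, le_rfl⟩ (𝟙 _)).trans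
      (Category.id_comp _)
    have e₂ := (hg' (Ar.mk i l (hik.trans (hkj.trans hjl))) (Ar.mk k l (hkj.trans hjl))
      ⟨hik, le_rfl⟩ (𝟙 _)).trans (Category.id_comp _)
    have h := hpo k j l hkj hjl
    rw [← e₁, ← e₂] at h
    exact h

end Quotients

/-! ### Diagrams in `S_n` and their morphisms are controlled by the top row. -/

section SdotDiagrams

variable {A : Type u} [Category.{v} A] [Preadditive A] [HasFiniteBiproducts A] [ExactCategory A]
  {n : SimplexCategory} {D D' : Ar n ⥤ A}

namespace IsSdot

lemma adMono_map (h : IsSdot A D) {p q : Ar n} (a : p ⟶ q) (e : p.1.1 = q.1.1) :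
    adMono A (D.map a) := by
  obtain ⟨⟨i, j⟩, hij⟩ := p
  obtain ⟨⟨i', l⟩, hil⟩ := q
  obtain rfl : i = i' := e
  exact h.mono i j l hij (leOfHom a).2

lemma adEpi_map (h : IsSdot A D) {p q : Ar n} (a : p ⟶ q) (e : p.1.2 = q.1.2) :
    adEpi A (D.map a) := by
  obtain ⟨⟨i, j⟩, hij⟩ := p
  obtain ⟨⟨k, j'⟩, hkj⟩ := q
  obtain rfl : j = j' := e
  exact h.epi i k j (leOfHom a).1 hkj

lemma bicartesianSq_map (h : IsSdot A D) {p q r s : Ar n} (a : p ⟶ q) (b : p ⟶ r) (c : q ⟶ s)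
    (d : r ⟶ s) (h₁ : p.1.1 = q.1.1) (h₂ : p.1.2 = r.1.2) (h₃ : q.1.2 = s.1.2)
    (h₄ : r.1.1 = s.1.1) : BicartesianSq (D.map a) (D.map b) (D.map c) (D.map d) := by
  obtain ⟨⟨i, j⟩, hij⟩ := p
  obtain ⟨⟨i', l⟩, hil⟩ := q
  obtain ⟨⟨k, j'⟩, hkj⟩ := r
  obtain ⟨⟨k', l'⟩, hkl⟩ := s
  obtain rfl : i = i' := h₁
  obtain rfl : j = j' := h₂
  obtain rfl : l = l' := h₃
  obtain rfl : k = k' := h₄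
  exact h.square i k j l (leOfHom b).1 hkj (leOfHom a).2

lemma isZero_obj (h : IsSdot A D) (p : Ar n) (e : p.1.1 = p.1.2) : IsZero (D.obj p) := by
  obtain ⟨⟨i, j⟩, hij⟩ := p
  obtain rfl : i = j := e
  exact h.zero i

/-- This is the bicartesian square on `a_ij`, `a_il`, `a_jl` whose remaining corner `a_jj` is zero.
-/
lemma isExactPair (h : IsSdot A D) {p q s : Ar n} (a : p ⟶ q) (c : q ⟶ s)
    (h₁ : p.1.1 = q.1.1) (h₂ : p.1.2 = s.1.1) (h₃ : q.1.2 = s.1.2) :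
    IsExactPair (D.map a) (D.map c) := by
  refine isExactPair_of_isPushout (h.bicartesianSq_map a (r := Ar.mk p.1.2 p.1.2 le_rfl)
    (homOfLE ⟨p.2, le_rfl⟩) c (homOfLE ⟨h₂.le, h₂.le.trans s.2⟩) h₁ rfl h₃ h₂).toIsPushout
    (h.adMono_map a h₁) (h.isZero_obj _ rfl)

/-- The object `(0, k)` of `Ar[n]`. -/
abbrev row (n : SimplexCategory) (k : Fin (n.len + 1)) : Ar n := Ar.mk 0 k (Fin.zero_le k)

/-- The object `(0, n)` of `Ar[n]`. -/
abbrev top (n : SimplexCategory) : Ar n := row n (Fin.last _)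

/-- The morphism `(0, k) ⟶ (0, n)` of `Ar[n]`. -/
abbrev rowToTop (k : Fin (n.len + 1)) : row n k ⟶ top n := homOfLE ⟨le_rfl, Fin.le_last k⟩

/-- The morphism `(0, j) ⟶ (i, j)` of `Ar[n]`. -/
abbrev rowTo (p : Ar n) : row n p.1.2 ⟶ p := homOfLE ⟨Fin.zero_le _, le_rfl⟩

/-- Each entry is a quotient of a row entry `(0, j)`, and each row entry is a subobject of the entry
`(0, n)`. -/
lemma hom_ext (h : IsSdot A D) (h' : IsSdot A D') {f g : D ⟶ D'}
    (e : f.app (top n) = g.app (top n)) : f = g := by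
  ext p
  have := epi_of_adEpi (h.adEpi_map (rowTo p) rfl)
  have := mono_of_adMono (h'.adMono_map (rowToTop p.1.2) rfl)
  rw [← cancel_epi (D.map (rowTo p)), f.naturality, g.naturality]
  congr 1
  rw [← cancel_mono (D'.map (rowToTop p.1.2)), ← f.naturality, ← g.naturality, e]

/-- A map of total objects that preserves the filtration induces maps on all subquotients.
Compatibility along the row is automatic, since the row of `D'` consists of subobjects of its last
term. -/
lemma exists_hom (h : IsSdot A D) (h' : IsSdot A D') (t : D.obj (top n) ⟶ D'.obj (top n))
    (ht : ∀ k, ∃ f : D.obj (row n k) ⟶ D'.obj (row n k),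
      f ≫ D'.map (rowToTop k) = D.map (rowToTop k) ≫ t) :
    ∃ f : D ⟶ D', f.app (top n) = t := by
  choose f hf using ht
  have hm := fun k => mono_of_adMono (h'.adMono_map (rowToTop k) rfl)
  have hf' : ∀ k l (a : row n k ⟶ row n l), f k ≫ D'.map a = D.map a ≫ f l := fun k l a => by
    rw [← cancel_mono (D'.map (rowToTop l)), Category.assoc, Category.assoc, hf,
      ← D'.map_comp, ← D.map_comp_assoc]
    exact hf k
  have hE : ∀ p : Ar n, IsExactPair (D.map (homOfLE ⟨le_rfl, p.2⟩ : row n p.1.1 ⟶ row n p.1.2))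
    (D.map (rowTo p)) := fun p => h.isExactPair _ _ rfl rfl rfl
  have hE' : ∀ p : Ar n, IsExactPair (D'.map (homOfLE ⟨le_rfl, p.2⟩ : row n p.1.1 ⟶ row n p.1.2))
    (D'.map (rowTo p)) := fun p => h'.isExactPair _ _ rfl rfl rfl
  have hg := fun p => (hE p).exists_map (hE' p) (f _) (f _) (hf' _ _ _).symm
  choose g hg using hg
  refine ⟨{ app := g, naturality := fun p q a => ?_ }, ?_⟩
  · have := (hE p).epi
    rw [← cancel_epi (D.map (rowTo p)), reassoc_of% hg]
    have e : rowTo p ≫ a = (homOfLE ⟨le_rfl, (leOfHom a).2⟩ : row n p.1.2 ⟶ row n q.1.2) ≫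
      rowTo q := rfl
    rw [← D'.map_comp, e, ← D.map_comp_assoc, e, D.map_comp, D'.map_comp, Category.assoc, hg,
      reassoc_of% hf']
  · have h1 := hg (top n)
    have h2 := hf (Fin.last _)
    have e1 : rowTo (top n) = 𝟙 _ := rfl
    have e2 : rowToTop (Fin.last n.len) = 𝟙 (top n) := rfl
    rw [e1, D.map_id, D'.map_id] at h1
    rw [e2, D.map_id, D'.map_id] at h2
    dsimp
    simpa using h1.trans (by simpa using h2)

lemma exists_iso (h : IsSdot A D) (h' : IsSdot A D') (t : D.obj (top n) ≅ D'.obj (top n))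
    (ht : ∀ k, ∃ f : D.obj (row n k) ≅ D'.obj (row n k),
      f.hom ≫ D'.map (rowToTop k) = D.map (rowToTop k) ≫ t.hom) :
    ∃ f : D ≅ D', f.hom.app (top n) = t.hom := by
  choose e he using ht
  obtain ⟨f, hf⟩ := h.exists_hom h' t.hom fun k => ⟨_, he k⟩
  obtain ⟨g, hg⟩ := h'.exists_hom h t.inv fun k => ⟨(e k).inv, by
    rw [Iso.inv_comp_eq, ← Category.assoc, he k, Category.assoc, t.hom_inv_id,
      Category.comp_id]⟩
  exact ⟨⟨f, g, h.hom_ext h (by simp [hf, hg]), h'.hom_ext h' (by simp [hf, hg])⟩, hf⟩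

end IsSdot

end SdotDiagrams

end RelSdot

namespace RelSdot

/-! ### Homotopy pullback squares of categories and groupoids. -/

section HomotopyPullback

universe v₁ v₂ v₃ v₄ v₅ v₆ u₁ u₂ u₃ u₄ u₅ u₆

/-- A strictly commutative square of functors is a homotopy pullback: `X` is equivalent to the
category of triples of an object of `Y`, an object of `Z` and an isomorphism between their images
in `W`. -/
structure IsHPull {X : Type u₁} [Category.{v₁} X] {Y : Type u₂} [Category.{v₂} Y]
    {Z : Type u₃} [Category.{v₃} Z] {W : Type u₄} [Category.{v₄} W]
    (P : X ⥤ Y) (Q : X ⥤ Z) (f : Y ⥤ W) (g : Z ⥤ W) (h : P ⋙ f = Q ⋙ g) : Prop where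
  hom : ∀ {x y : X} (a : P.obj x ⟶ P.obj y) (b : Q.obj x ⟶ Q.obj y),
    f.map a ≫ eqToHom (Functor.congr_obj h y) = eqToHom (Functor.congr_obj h x) ≫ g.map b →
    ∃ c : x ⟶ y, P.map c = a ∧ Q.map c = b
  hom_ext : ∀ {x y : X} {c c' : x ⟶ y}, P.map c = P.map c' → Q.map c = Q.map c' → c = c'
  obj : ∀ (y : Y) (z : Z) (e : f.obj y ≅ g.obj z), ∃ (x : X) (a : P.obj x ≅ y) (b : Q.obj x ≅ z),
    f.map a.hom ≫ e.hom = eqToHom (Functor.congr_obj h x) ≫ g.map b.hom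

lemma coreHom_iso_eqToHom {X : Type u₁} [Category.{v₁} X] {x y : Core X} (h : x = y) :
    (eqToHom h).iso.hom = eqToHom (congrArg Core.of h) := by
  subst h; rfl

/-- This lets ear squares be checked with all natural transformations, not only the invertible ones.
A morphism glued from isomorphisms is invertible because the inverses glue too. -/
lemma IsHPull.core {X : Type u₁} [Category.{v₁} X] {Y : Type u₂} [Category.{v₂} Y]
    {Z : Type u₃} [Category.{v₃} Z] {W : Type u₄} [Category.{v₄} W]
    {P : X ⥤ Y} {Q : X ⥤ Z} {f : Y ⥤ W} {g : Z ⥤ W} {h : P ⋙ f = Q ⋙ g}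
    (H : IsHPull P Q f g h) (h' : P.core ⋙ f.core = Q.core ⋙ g.core) :
    IsHPull P.core Q.core f.core g.core h' where
  hom {x y} a b e := by
    have key : ∀ {x y : Core X} (a : P.core.obj x ⟶ P.core.obj y) (b : Q.core.obj x ⟶ Q.core.obj y),
      f.core.map a ≫ eqToHom (Functor.congr_obj h' y) =
        eqToHom (Functor.congr_obj h' x) ≫ g.core.map b →
      ∃ c : x.of ⟶ y.of, P.map c = a.iso.hom ∧ Q.map c = b.iso.hom := fun {x y} a b e => by
        refine H.hom _ _ ?_
        have e := congrArg (fun t => t.iso.hom) e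
        simp only [coreCategory_comp_iso, Iso.trans_hom, coreHom_iso_eqToHom] at e
        exact e
    obtain ⟨c, hc₁, hc₂⟩ := key a b e
    obtain ⟨d, hd₁, hd₂⟩ := key (inv a) (inv b) (by
      rw [Functor.map_inv, Functor.map_inv, IsIso.inv_comp_eq, ← Category.assoc, e,
        Category.assoc, IsIso.hom_inv_id, Category.comp_id])
    have ha : (inv a).iso.hom = a.iso.inv := by rw [← Groupoid.inv_eq_inv]; rfl
    have hb : (inv b).iso.hom = b.iso.inv := by rw [← Groupoid.inv_eq_inv]; rfl
    rw [ha] at hd₁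
    rw [hb] at hd₂
    refine ⟨⟨⟨c, d, H.hom_ext ?_ ?_, H.hom_ext ?_ ?_⟩⟩, ?_, ?_⟩
    · exact (P.map_comp c d).trans ((congrArg₂ (· ≫ ·) hc₁ hd₁).trans
        (a.iso.hom_inv_id.trans (P.map_id _).symm))
    · exact (Q.map_comp c d).trans ((congrArg₂ (· ≫ ·) hc₂ hd₂).trans
        (b.iso.hom_inv_id.trans (Q.map_id _).symm))
    · exact (P.map_comp d c).trans ((congrArg₂ (· ≫ ·) hd₁ hc₁).trans
        (a.iso.inv_hom_id.trans (P.map_id _).symm))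
    · exact (Q.map_comp d c).trans ((congrArg₂ (· ≫ ·) hd₂ hc₂).trans
        (b.iso.inv_hom_id.trans (Q.map_id _).symm))
    · ext; exact hc₁
    · ext; exact hc₂
  hom_ext e₁ e₂ := by
    ext
    exact H.hom_ext (congrArg (fun t => t.iso.hom) e₁) (congrArg (fun t => t.iso.hom) e₂)
  obj y z e := by
    obtain ⟨x, a, b, hab⟩ := H.obj y.of z.of e.hom.iso
    refine ⟨⟨x⟩, Core.isoMk a, Core.isoMk b, ?_⟩
    ext
    simp only [coreCategory_comp_iso, Iso.trans_hom, coreHom_iso_eqToHom]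
    exact hab

/-- Squares that commute up to equality of objects become heterogeneous equalities, which can be
chained and pushed through functors by `map_heq`. -/
lemma comp_eqToHom_eq_iff_heq {X : Type u₁} [Category.{v₁} X] {x y x' y' : X} (f : x ⟶ y)
    (g : x' ⟶ y') (hx : x = x') (hy : y = y') :
    f ≫ eqToHom hy = eqToHom hx ≫ g ↔ HEq f g := by
  subst hx hy
  simp

lemma map_heq {X : Type u₁} [Category.{v₁} X] {Y : Type u₂} [Category.{v₂} Y] (F : X ⥤ Y)
    {x y x' y' : X} {f : x ⟶ y} {g : x' ⟶ y'} (hx : x = x') (hy : y = y') (h : HEq f g) :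
    HEq (F.map f) (F.map g) := by
  subst hx hy
  rw [eq_of_heq h]

namespace IsHPull

/-- Cancellation of homotopy pullbacks: if the right square and the outer rectangle are homotopy
pullbacks, then so is the left square. -/
lemma of_right {X : Type u₁} [Groupoid.{v₁} X] {Y : Type u₂} [Groupoid.{v₂} Y]
    {Z : Type u₃} [Groupoid.{v₃} Z] {W : Type u₄} [Groupoid.{v₄} W] {Z' : Type u₅}
    [Groupoid.{v₅} Z'] {W' : Type u₆} [Groupoid.{v₆} W'] {P : X ⥤ Y} {Q : X ⥤ Z} {f : Y ⥤ W}
    {g : Z ⥤ W} {R : Z ⥤ Z'} {k : W ⥤ W'} {g' : Z' ⥤ W'} {h' : g ⋙ k = R ⋙ g'}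
    {h'' : P ⋙ (f ⋙ k) = (Q ⋙ R) ⋙ g'}
    (H' : IsHPull g R k g' h') (H'' : IsHPull P (Q ⋙ R) (f ⋙ k) g' h'') (h : P ⋙ f = Q ⋙ g) :
    IsHPull P Q f g h where
  hom {x y} a b e := by
    rw [comp_eqToHom_eq_iff_heq] at e
    obtain ⟨c, hc, hc'⟩ := H''.hom a (R.map b) (by
      rw [comp_eqToHom_eq_iff_heq]
      exact (map_heq k (Functor.congr_obj h x) (Functor.congr_obj h y) e).trans
        (Functor.hcongr_hom h' b))
    refine ⟨c, hc, H'.hom_ext ?_ hc'⟩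
    refine eq_of_heq ((Functor.hcongr_hom h c).symm.trans (HEq.trans ?_ e))
    exact heq_of_eq (congrArg f.map hc)
  hom_ext {x y c c'} e₁ e₂ := H''.hom_ext e₁ (congrArg R.map e₂)
  obj y z e := by
    obtain ⟨x, a, b, hab⟩ := H''.obj y (R.obj z)
      (k.mapIso e ≪≫ eqToIso (Functor.congr_obj h' z))
    -- The outer rectangle only compares `Q.obj x` with `z` after applying `R`; the right square
    -- lifts this to a comparison in `Z`.
    obtain ⟨c, hc, hc'⟩ := H'.hom (x := Q.obj x) (y := z)
      (eqToHom (Functor.congr_obj h x).symm ≫ f.map a.hom ≫ e.hom) b.hom (by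
        have hab : k.map (f.map a.hom) ≫ k.map e.hom ≫ eqToHom (Functor.congr_obj h' z) =
          eqToHom (Functor.congr_obj h'' x) ≫ g'.map b.hom := hab
        rw [k.map_comp, k.map_comp, Category.assoc, Category.assoc, hab, eqToHom_map,
          eqToHom_trans_assoc])
    refine ⟨x, a, asIso c, ?_⟩
    simp [hc]

end IsHPull

end HomotopyPullback

section StrictPullbackCube

end StrictPullbackCube

end RelSdot

namespace RelSdot

/-! ### Strict pullbacks of homotopy pullback squares along an isofibration. -/

section Cube

universe v₁ u₁

/-- Essential surjectivity for the fibre product of the squares `X` and `Y` over the square `Z`.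
Lifts to `Xn` and `Yn` exist separately, but their images in `Zn` are only isomorphic; the lifting
property `hf` of `fn` makes them equal. It is needed only at this initial corner of the cube. -/
lemma exists_obj_of_cube
  {Xn : Type u₁} [Groupoid.{v₁} Xn]  {Xl : Type u₁} [Groupoid.{v₁} Xl]  {Xm : Type u₁} [Groupoid.{v₁} Xm]  {Xk : Type u₁} [Groupoid.{v₁} Xk]
  {Yn : Type u₁} [Groupoid.{v₁} Yn]  {Yl : Type u₁} [Groupoid.{v₁} Yl]  {Ym : Type u₁} [Groupoid.{v₁} Ym]  {Yk : Type u₁} [Groupoid.{v₁} Yk]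
  {Zn : Type u₁} [Groupoid.{v₁} Zn]  {Zl : Type u₁} [Groupoid.{v₁} Zl]  {Zm : Type u₁} [Groupoid.{v₁} Zm]  {Zk : Type u₁} [Groupoid.{v₁} Zk]
  {Xd : Xn ⥤ Xl} {Xτ : Xn ⥤ Xm} {Xe : Xl ⥤ Xk} {Xδ : Xm ⥤ Xk} {hX : Xd ⋙ Xe = Xτ ⋙ Xδ}
  {Yd : Yn ⥤ Yl} {Yτ : Yn ⥤ Ym} {Ye : Yl ⥤ Yk} {Yδ : Ym ⥤ Yk} {hY : Yd ⋙ Ye = Yτ ⋙ Yδ}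
  {Zd : Zn ⥤ Zl} {Zτ : Zn ⥤ Zm} {Ze : Zl ⥤ Zk} {Zδ : Zm ⥤ Zk} {hZ : Zd ⋙ Ze = Zτ ⋙ Zδ}
  {fn : Xn ⥤ Zn} {fl : Xl ⥤ Zl} {fm : Xm ⥤ Zm} {fk : Xk ⥤ Zk}
  (f_d : Xd ⋙ fl = fn ⋙ Zd)  (f_τ : Xτ ⋙ fm = fn ⋙ Zτ)  (f_e : Xe ⋙ fk = fl ⋙ Ze)  (f_δ : Xδ ⋙ fk = fm ⋙ Zδ)
  {gn : Yn ⥤ Zn} {gl : Yl ⥤ Zl} {gm : Ym ⥤ Zm} {gk : Yk ⥤ Zk}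
  (g_d : Yd ⋙ gl = gn ⋙ Zd)  (g_τ : Yτ ⋙ gm = gn ⋙ Zτ)  (g_e : Ye ⋙ gk = gl ⋙ Ze)  (g_δ : Yδ ⋙ gk = gm ⋙ Zδ)
  (HX : IsHPull Xd Xτ Xe Xδ hX) (HY : IsHPull Yd Yτ Ye Yδ hY) (HZ : IsHPull Zd Zτ Ze Zδ hZ)
  (hf : ∀ (x : Xn) (z : Zn) (θ : fn.obj x ⟶ z),
    ∃ (x' : Xn) (a : x ⟶ x') (e : fn.obj x' = z), fn.map a ≫ eqToHom e = θ)
  {y₁ : Xl} {y₂ : Yl} (ey : fl.obj y₁ = gl.obj y₂) {z₁ : Xm} {z₂ : Ym} (ez : fm.obj z₁ = gm.obj z₂)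
  (ε₁ : Xe.obj y₁ ≅ Xδ.obj z₁) (ε₂ : Ye.obj y₂ ≅ Yδ.obj z₂)
  (hy : fk.obj (Xe.obj y₁) = gk.obj (Ye.obj y₂)) (hz : fk.obj (Xδ.obj z₁) = gk.obj (Yδ.obj z₂))
  (hε : fk.map ε₁.hom ≫ eqToHom hz = eqToHom hy ≫ gk.map ε₂.hom) :
  ∃ (x₁ : Xn) (x₂ : Yn) (hx : fn.obj x₁ = gn.obj x₂) (a₁ : Xd.obj x₁ ≅ y₁) (b₁ : Xτ.obj x₁ ≅ z₁)
    (a₂ : Yd.obj x₂ ≅ y₂) (b₂ : Yτ.obj x₂ ≅ z₂),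
    Xe.map a₁.hom ≫ ε₁.hom = eqToHom (Functor.congr_obj hX x₁) ≫ Xδ.map b₁.hom ∧
    Ye.map a₂.hom ≫ ε₂.hom = eqToHom (Functor.congr_obj hY x₂) ≫ Yδ.map b₂.hom ∧
    fl.map a₁.hom ≫ eqToHom ey = eqToHom (by
      rw [← Functor.comp_obj, f_d, ← Functor.comp_obj, g_d, Functor.comp_obj, hx]; rfl) ≫
      gl.map a₂.hom ∧
    fm.map b₁.hom ≫ eqToHom ez = eqToHom (by
      rw [← Functor.comp_obj, f_τ, ← Functor.comp_obj, g_τ, Functor.comp_obj, hx]; rfl) ≫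
      gm.map b₂.hom := by
  obtain ⟨x₁, a₁, b₁, h₁⟩ := HX.obj y₁ z₁ ε₁
  obtain ⟨x₂, a₂, b₂, h₂⟩ := HY.obj y₂ z₂ ε₂
  have h₁' : Xe.map a₁.hom =
      eqToHom (Functor.congr_obj hX x₁) ≫ Xδ.map b₁.hom ≫ ε₁.inv := by
    rw [← reassoc_of% h₁, Iso.hom_inv_id, Category.comp_id]
  have h₂' : Ye.map a₂.inv =
      ε₂.hom ≫ Yδ.map b₂.inv ≫ eqToHom (Functor.congr_obj hY x₂).symm := by
    rw [← cancel_epi (Ye.map a₂.hom), ← Functor.map_comp, a₂.hom_inv_id,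
      reassoc_of% h₂, ← Functor.map_comp_assoc, b₂.hom_inv_id]
    simp
  have nf_d : ∀ {p q : Xn} (t : p ⟶ q), Zd.map (fn.map t) =
      eqToHom (Functor.congr_obj f_d p).symm ≫ fl.map (Xd.map t) ≫
        eqToHom (Functor.congr_obj f_d q) := fun t => Functor.congr_hom f_d.symm t
  have nf_τ : ∀ {p q : Xn} (t : p ⟶ q), Zτ.map (fn.map t) =
      eqToHom (Functor.congr_obj f_τ p).symm ≫ fm.map (Xτ.map t) ≫
        eqToHom (Functor.congr_obj f_τ q) := fun t => Functor.congr_hom f_τ.symm t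
  have nf_e : ∀ {p q : Xl} (t : p ⟶ q), Ze.map (fl.map t) =
      eqToHom (Functor.congr_obj f_e p).symm ≫ fk.map (Xe.map t) ≫
        eqToHom (Functor.congr_obj f_e q) := fun t => Functor.congr_hom f_e.symm t
  have nf_δ : ∀ {p q : Xm} (t : p ⟶ q), Zδ.map (fm.map t) =
      eqToHom (Functor.congr_obj f_δ p).symm ≫ fk.map (Xδ.map t) ≫
        eqToHom (Functor.congr_obj f_δ q) := fun t => Functor.congr_hom f_δ.symm t
  have ng_d : ∀ {p q : Yn} (t : p ⟶ q), Zd.map (gn.map t) =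
      eqToHom (Functor.congr_obj g_d p).symm ≫ gl.map (Yd.map t) ≫
        eqToHom (Functor.congr_obj g_d q) := fun t => Functor.congr_hom g_d.symm t
  have ng_τ : ∀ {p q : Yn} (t : p ⟶ q), Zτ.map (gn.map t) =
      eqToHom (Functor.congr_obj g_τ p).symm ≫ gm.map (Yτ.map t) ≫
        eqToHom (Functor.congr_obj g_τ q) := fun t => Functor.congr_hom g_τ.symm t
  have ng_e : ∀ {p q : Yl} (t : p ⟶ q), Ze.map (gl.map t) =
      eqToHom (Functor.congr_obj g_e p).symm ≫ gk.map (Ye.map t) ≫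
        eqToHom (Functor.congr_obj g_e q) := fun t => Functor.congr_hom g_e.symm t
  have ng_δ : ∀ {p q : Ym} (t : p ⟶ q), Zδ.map (gm.map t) =
      eqToHom (Functor.congr_obj g_δ p).symm ≫ gk.map (Yδ.map t) ≫
        eqToHom (Functor.congr_obj g_δ q) := fun t => Functor.congr_hom g_δ.symm t
  have hε' : fk.map ε₁.inv ≫ eqToHom hy ≫ gk.map ε₂.hom = eqToHom hz := by
    rw [← hε, ← Functor.map_comp_assoc, ε₁.inv_hom_id]
    simp
  -- The two images are identified over `Zl` through `ey` and over `Zm` through `ez`; `hε'` says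
  -- that these identifications agree over `Zk`.
  obtain ⟨θ, hθ₁, hθ₂⟩ := HZ.hom (x := fn.obj x₁) (y := gn.obj x₂)
    (eqToHom (Functor.congr_obj f_d x₁).symm ≫ fl.map a₁.hom ≫ eqToHom ey ≫ gl.map a₂.inv ≫
      eqToHom (Functor.congr_obj g_d x₂))
    (eqToHom (Functor.congr_obj f_τ x₁).symm ≫ fm.map b₁.hom ≫ eqToHom ez ≫ gm.map b₂.inv ≫
      eqToHom (Functor.congr_obj g_τ x₂)) (by
    simp only [Functor.map_comp, eqToHom_map, nf_e, ng_e, nf_δ, ng_δ, h₁', h₂', Category.assoc,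
      eqToHom_trans, eqToHom_trans_assoc]
    rw [reassoc_of% hε'])
  -- Moving `x₁` along a lift of `θ` turns the isomorphism into an equality, at the cost of
  -- correcting `a₁` and `b₁` by the inverse of `κ`.
  obtain ⟨x', κ, hx', hκ⟩ := hf x₁ _ θ
  have hκ' : fn.map κ = θ ≫ eqToHom hx'.symm := by simp [← hκ]
  refine ⟨x', x₂, hx', (Xd.mapIso (asIso κ)).symm ≪≫ a₁, (Xτ.mapIso (asIso κ)).symm ≪≫ b₁, a₂, b₂,
    ?_, h₂, ?_, ?_⟩
  · have e := Functor.congr_hom hX κ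
    simp only [Functor.comp_map] at e
    simp only [Iso.trans_hom, Iso.symm_hom, Functor.mapIso_inv, Functor.map_comp, Category.assoc,
      asIso_inv, Functor.map_inv, IsIso.inv_comp_eq, h₁, e]
    simp
  · have e := Functor.congr_hom f_d κ
    simp only [Functor.comp_map, hκ', Functor.map_comp, hθ₁] at e
    simp only [Iso.trans_hom, Iso.symm_hom, Functor.mapIso_inv, Functor.map_comp, Category.assoc,
      asIso_inv, Functor.map_inv, IsIso.inv_comp_eq, e]
    simp only [eqToHom_map, eqToHom_trans_assoc, eqToHom_refl, Category.id_comp,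
      ← Functor.map_comp, a₂.inv_hom_id]
    simp
  · have e := Functor.congr_hom f_τ κ
    simp only [Functor.comp_map, hκ', Functor.map_comp, hθ₂] at e
    simp only [Iso.trans_hom, Iso.symm_hom, Functor.mapIso_inv, Functor.map_comp, Category.assoc,
      asIso_inv, Functor.map_inv, IsIso.inv_comp_eq, e]
    simp only [eqToHom_map, eqToHom_trans_assoc, eqToHom_refl, Category.id_comp,
      ← Functor.map_comp, b₂.inv_hom_id]
    simp

end Cube

/-! ### Homotopy pullback squares of a simplicial groupoid, and their behaviour under strict
pullback. -/

section LocalSquares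

variable {k l m n : SimplexCategory}

lemma map_comp_map_eq (X : SimplicialObject Grpd.{v, u}) {e : k ⟶ l} {δ : k ⟶ m} {d : l ⟶ n}
    {τ : m ⟶ n} (h : e ≫ d = δ ≫ τ) : X.map d.op ≫ X.map e.op = X.map τ.op ≫ X.map δ.op :=
  (X.map_comp d.op e.op).symm.trans ((congrArg (fun t => X.map (Quiver.Hom.op t)) h).trans
    (X.map_comp τ.op δ.op))

/-- A simplicial groupoid sends a commutative square in the simplex category to a homotopy
pullback. -/
def IsLocalSq (X : SimplicialObject Grpd.{v, u}) {e : k ⟶ l} {δ : k ⟶ m} {d : l ⟶ n} {τ : m ⟶ n}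
    (h : e ≫ d = δ ≫ τ) : Prop :=
  IsHPull (X.map d.op) (X.map τ.op) (X.map e.op) (X.map δ.op)
    (map_comp_map_eq X h)

lemma GrpdPullback.fst_eqToHom {X Y Z : Grpd.{v, u}} {f : X ⟶ Z} {g : Y ⟶ Z}
    {p q : GrpdPullback f g} (h : p = q) :
    Hom.fst (eqToHom h) = eqToHom (congrArg GrpdPullback.fst h) := by
  subst h; rfl

lemma GrpdPullback.snd_eqToHom {X Y Z : Grpd.{v, u}} {f : X ⟶ Z} {g : Y ⟶ Z}
    {p q : GrpdPullback f g} (h : p = q) :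
    Hom.snd (eqToHom h) = eqToHom (congrArg GrpdPullback.snd h) := by
  subst h; rfl

variable {X Y Z : SimplicialObject Grpd.{v, u}} {f : X ⟶ Z} {g : Y ⟶ Z}
  {e : k ⟶ l} {δ : k ⟶ m} {d : l ⟶ n} {τ : m ⟶ n} {h : e ≫ d = δ ≫ τ}

lemma isLocalSq_simplicialPullback (hX : IsLocalSq X h) (hY : IsLocalSq Y h) (hZ : IsLocalSq Z h)
    (hf : ∀ (x : X.obj (op n)) (z : Z.obj (op n)) (θ : (f.app (op n)).obj x ⟶ z),
      ∃ (x' : X.obj (op n)) (a : x ⟶ x') (e : (f.app (op n)).obj x' = z),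
        (f.app (op n)).map a ≫ eqToHom e = θ) :
    IsLocalSq (simplicialPullback f g) h where
  hom {x y} a b w := by
    rw [comp_eqToHom_eq_iff_heq] at w
    have hS := map_comp_map_eq (simplicialPullback f g) h
    have w₁ := map_heq (X := (simplicialPullback f g).obj (op k)) (Y := X.obj (op k))
      (GrpdPullback.π₁ (f.app (op k)) (g.app (op k))) (Functor.congr_obj hS x)
      (Functor.congr_obj hS y) w
    have w₂ := map_heq (X := (simplicialPullback f g).obj (op k)) (Y := Y.obj (op k))
      (GrpdPullback.π₂ (f.app (op k)) (g.app (op k))) (Functor.congr_obj hS x)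
      (Functor.congr_obj hS y) w
    obtain ⟨c₁, hc₁, hc₁'⟩ := hX.hom (x := x.fst) (y := y.fst) a.fst b.fst (by
      rw [comp_eqToHom_eq_iff_heq]
      exact w₁)
    obtain ⟨c₂, hc₂, hc₂'⟩ := hY.hom (x := x.snd) (y := y.snd) a.snd b.snd (by
      rw [comp_eqToHom_eq_iff_heq]
      exact w₂)
    have key : ∀ {i : SimplexCategory} (α : i ⟶ n)
        (t : GrpdPullback.Hom (((simplicialPullback f g).map α.op).obj x)
          (((simplicialPullback f g).map α.op).obj y)),
        (X.map α.op).map c₁ = t.fst → (Y.map α.op).map c₂ = t.snd →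
        HEq ((Z.map α.op).map ((f.app (op n)).map c₁))
          ((Z.map α.op).map ((g.app (op n)).map c₂)) := fun {i} α t h₁ h₂ => by
      refine (Functor.hcongr_hom (f.naturality α.op) c₁).symm.trans
        (HEq.trans ?_ (Functor.hcongr_hom (g.naturality α.op) c₂))
      have h₁' := congrArg (f.app (op i)).map h₁
      have h₂' := congrArg (g.app (op i)).map h₂
      refine (heq_of_eq h₁').trans (HEq.trans ?_ (heq_of_eq h₂').symm)
      exact (comp_eqToHom_eq_iff_heq _ _ _ _).1 t.w
    -- The separately glued morphisms match over `Z`, since there a morphism is determined by its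
    -- two restrictions.
    have hw : (f.app (op n)).map c₁ = eqToHom x.eq ≫ (g.app (op n)).map c₂ ≫ eqToHom y.eq.symm := by
      have hZ' := @hZ.hom_ext
      refine hZ' ?_ ?_
      · refine eq_of_heq ((key d a hc₁ hc₂).trans ?_)
        exact map_heq _ x.eq.symm y.eq.symm (by simp)
      · refine eq_of_heq ((key τ b hc₁' hc₂').trans ?_)
        exact map_heq _ x.eq.symm y.eq.symm (by simp)
    refine ⟨⟨c₁, c₂, by rw [hw]; simp⟩, GrpdPullback.Hom.ext hc₁ hc₂,
      GrpdPullback.Hom.ext hc₁' hc₂'⟩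
  hom_ext {x y c c'} w w' := GrpdPullback.Hom.ext
    (hX.hom_ext (congrArg GrpdPullback.Hom.fst w) (congrArg GrpdPullback.Hom.fst w'))
    (hY.hom_ext (congrArg GrpdPullback.Hom.snd w) (congrArg GrpdPullback.Hom.snd w'))
  obj y z ε := by
    obtain ⟨x₁, x₂, hx, a₁, b₁, a₂, b₂, h₁, h₂, ha, hb⟩ := exists_obj_of_cube
      (f.naturality d.op) (f.naturality τ.op) (f.naturality e.op) (f.naturality δ.op)
      (g.naturality d.op) (g.naturality τ.op) (g.naturality e.op) (g.naturality δ.op)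
      hX hY hZ hf y.eq z.eq
      ((GrpdPullback.π₁ (f.app (op k)) (g.app (op k))).mapIso ε)
      ((GrpdPullback.π₂ (f.app (op k)) (g.app (op k))).mapIso ε)
      (GrpdPullback.eq (((simplicialPullback f g).map e.op).obj y))
      (GrpdPullback.eq (((simplicialPullback f g).map δ.op).obj z)) (GrpdPullback.Hom.w ε.hom)
    let x : GrpdPullback (f.app (op n)) (g.app (op n)) := ⟨x₁, x₂, hx⟩
    let a : ((simplicialPullback f g).map d.op).obj x ⟶ y := ⟨a₁.hom, a₂.hom, ha⟩
    let b : ((simplicialPullback f g).map τ.op).obj x ⟶ z := ⟨b₁.hom, b₂.hom, hb⟩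
    refine ⟨x, asIso a, asIso b, GrpdPullback.Hom.ext ?_ ?_⟩
    · refine h₁.trans ?_
      refine congrArg (· ≫ (X.map δ.op).map b₁.hom) ?_
      exact (GrpdPullback.fst_eqToHom (f := f.app (op k)) (g := g.app (op k))
        (Functor.congr_obj (map_comp_map_eq (simplicialPullback f g) h) x)).symm
    · refine h₂.trans ?_
      refine congrArg (· ≫ (Y.map δ.op).map b₂.hom) ?_
      exact (GrpdPullback.snd_eqToHom (f := f.app (op k)) (g := g.app (op k))
        (Functor.congr_obj (map_comp_map_eq (simplicialPullback f g) h) x)).symm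

end LocalSquares

end RelSdot

namespace RelSdot

/-! ### The combinatorics of a single ear. -/

section Ears

/-- The maps exhibiting the standard simplex `[N + 1]` as the face omitting the vertex `i + 1` and
the triangle on the vertices `i`, `i + 1`, `i + 2`, glued along the edge from `i` to `i + 2`. -/
structure IsEar (N i : ℕ) (e : SimplexCategory.mk 1 ⟶ SimplexCategory.mk N)
    (δ : SimplexCategory.mk 1 ⟶ SimplexCategory.mk 2)
    (d : SimplexCategory.mk N ⟶ SimplexCategory.mk (N + 1))
    (τ : SimplexCategory.mk 2 ⟶ SimplexCategory.mk (N + 1)) : Prop where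
  lt : i < N
  e_val : ∀ j, (e.toOrderHom j).val = i + j.val
  δ_val : ∀ j, (δ.toOrderHom j).val = 2 * j.val
  d_val : ∀ k, (d.toOrderHom k).val = if k.val ≤ i then k.val else k.val + 1
  τ_val : ∀ j, (τ.toOrderHom j).val = i + j.val

namespace IsEar

variable {N i : ℕ} {e : SimplexCategory.mk 1 ⟶ SimplexCategory.mk N}
    {δ : SimplexCategory.mk 1 ⟶ SimplexCategory.mk 2}
    {d : SimplexCategory.mk N ⟶ SimplexCategory.mk (N + 1)}
    {τ : SimplexCategory.mk 2 ⟶ SimplexCategory.mk (N + 1)}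

lemma comm (h : IsEar N i e δ d τ) : e ≫ d = δ ≫ τ := by
  ext j : 3
  apply Fin.ext
  change (d.toOrderHom (e.toOrderHom j)).val = (τ.toOrderHom (δ.toOrderHom j)).val
  rw [h.d_val, h.τ_val, h.e_val, h.δ_val]
  have : j.val < 2 := j.2
  split_ifs <;> omega

lemma d_zero (h : IsEar N i e δ d τ) : d.toOrderHom 0 = 0 := by
  apply Fin.ext
  rw [h.d_val]
  simp

lemma d_last (h : IsEar N i e δ d τ) : d.toOrderHom (Fin.last _) = Fin.last _ := by
  apply Fin.ext
  rw [h.d_val]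
  have := h.lt
  simp
  omega

lemma d_e_zero (h : IsEar N i e δ d τ) : d.toOrderHom (e.toOrderHom 0) = τ.toOrderHom 0 := by
  apply Fin.ext
  rw [h.d_val, h.τ_val, h.e_val]
  simp

lemma d_e_one (h : IsEar N i e δ d τ) : d.toOrderHom (e.toOrderHom 1) = τ.toOrderHom 2 := by
  apply Fin.ext
  rw [h.d_val, h.τ_val, h.e_val]
  simp

lemma d_eq_succAbove (h : IsEar N i e δ d τ) (k : Fin (N + 1)) :
    d.toOrderHom k = (τ.toOrderHom 1).succAbove k := by
  apply Fin.ext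
  rw [h.d_val, Fin.succAbove]
  have : (τ.toOrderHom 1).val = i + 1 := h.τ_val 1
  simp only [Fin.lt_def, Fin.val_castSucc]
  split_ifs <;> simp <;> omega

lemma eq_τ_or (h : IsEar N i e δ d τ) (k : Fin (N + 2)) :
    k = τ.toOrderHom 1 ∨ ∃ k', k = d.toOrderHom k' := by
  rcases Fin.eq_self_or_eq_succAbove (τ.toOrderHom 1) k with h' | ⟨k', h'⟩
  · exact Or.inl h'
  · exact Or.inr ⟨k', by rw [h.d_eq_succAbove]; exact h'⟩

end IsEar

end Ears

/-! ### Ear squares of `S_•`: gluing of morphisms. -/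

section SdotEars

variable {A : Type u} [Category.{v} A] [Preadditive A] [HasFiniteBiproducts A] [ExactCategory A]

variable (A) in
/-- Restriction of diagrams along a map in the simplex category. -/
def sdotRes {m n : SimplexCategory} (α : m ⟶ n) :
    (sdotProp A n).FullSubcategory ⥤ (sdotProp A m).FullSubcategory :=
  (sdotProp A m).lift ((sdotProp A n).ι ⋙ (Functor.whiskeringLeft _ _ A).obj (Ar.map α))
    (fun D => D.property.comp_map α)

lemma sdotRes_comp {l m n : SimplexCategory} (α : l ⟶ m) (β : m ⟶ n) :
    sdotRes A β ⋙ sdotRes A α = sdotRes A (α ≫ β) := rfl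

/-- Coherence isomorphisms become values of the diagram on arrows of a poset, where any two parallel
arrows are equal. -/
lemma sdotRes_eqToHom {m n : SimplexCategory} {α β : m ⟶ n} (h : α = β)
    (x : (sdotProp A n).FullSubcategory) (hx : (sdotRes A α).obj x = (sdotRes A β).obj x)
    (p : Ar m) : (eqToHom hx).hom.app p = x.obj.map (homOfLE (by subst h; rfl) :
      (Ar.map α).obj p ⟶ (Ar.map β).obj p) := by
  subst h
  exact (x.obj.map_id _).symm

variable {N i : ℕ} {e : SimplexCategory.mk 1 ⟶ SimplexCategory.mk N}
    {δ : SimplexCategory.mk 1 ⟶ SimplexCategory.mk 2}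
    {d : SimplexCategory.mk N ⟶ SimplexCategory.mk (N + 1)}
    {τ : SimplexCategory.mk 2 ⟶ SimplexCategory.mk (N + 1)}

lemma sdotRes_comm (h : IsEar N i e δ d τ) :
    sdotRes A d ⋙ sdotRes A e = sdotRes A τ ⋙ sdotRes A δ :=
  (sdotRes_comp e d).trans ((congrArg _ h.comm).trans (sdotRes_comp δ τ).symm)

open IsSdot

/-- By `IsSdot.exists_hom` only the top row matters, and `a` supplies all of it except the term at
the tip. That term is the pullback of `a_{0,i+2}` and `a_{i,i+1}` over `a_{i,i+2}`, where `a` and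
`b` provide compatible maps. -/
lemma IsSdot.exists_hom_of_isEar (h : IsEar N i e δ d τ) {D D' : Ar (SimplexCategory.mk (N + 1)) ⥤ A}
    (hD : IsSdot A D) (hD' : IsSdot A D') (a : Ar.map d ⋙ D ⟶ Ar.map d ⋙ D')
    (b : Ar.map τ ⋙ D ⟶ Ar.map τ ⋙ D') 
    (w : ∀ (t : (Ar.map d).obj ((Ar.map e).obj (top _)) ⟶ (Ar.map τ).obj ((Ar.map δ).obj (top _))),
      a.app ((Ar.map e).obj (top _)) ≫ D'.map t = D.map t ≫ b.app ((Ar.map δ).obj (top _))) :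
    ∃ c : D ⟶ D', Functor.whiskerLeft (Ar.map d) c = a ∧ Functor.whiskerLeft (Ar.map τ) c = b := by
  have hd0 := h.d_zero
  have hdl := h.d_last
  have hde := h.d_e_one
  have hδ0 : δ.toOrderHom 0 = 0 := by apply Fin.ext; rw [h.δ_val]; rfl
  have hδ1 : δ.toOrderHom 1 = 2 := by apply Fin.ext; rw [h.δ_val]; rfl
  -- The tip is neither `0` nor `N + 1`, so `d` preserves both end points. As `d 0 = 0` holds only
  -- propositionally, `r` and `r'` stand in for the identity.
  let r : top (SimplexCategory.mk (N + 1)) ⟶ (Ar.map d).obj (top _) :=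
    homOfLE ⟨hd0.ge, hdl.ge⟩
  let r' : (Ar.map d).obj (top _) ⟶ top (SimplexCategory.mk (N + 1)) :=
    homOfLE ⟨hd0.le, hdl.le⟩
  have na : ∀ {p q : Ar (SimplexCategory.mk N)} (t : p ⟶ q),
    D.map ((Ar.map d).map t) ≫ a.app q = a.app p ≫ D'.map ((Ar.map d).map t) := fun t => a.naturality t
  have nb : ∀ {p q : Ar (SimplexCategory.mk 2)} (t : p ⟶ q),
    D.map ((Ar.map τ).map t) ≫ b.app q = b.app p ≫ D'.map ((Ar.map τ).map t) := fun t => b.naturality t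
  let W : D.obj (top _) ⟶ D'.obj (top _) := D.map r ≫ a.app (top _) ≫ D'.map r'
  have hW : ∀ k (t : (Ar.map d).obj (row _ k) ⟶ top _),
      a.app (row _ k) ≫ D'.map t = D.map t ≫ W := fun k t => by
    have e₁ : t = (Ar.map d).map (rowToTop k) ≫ r' := rfl
    have e₂ : t ≫ r = (Ar.map d).map (rowToTop k) := rfl
    dsimp only [W]
    rw [← D.map_comp_assoc, e₂, e₁, D'.map_comp, ← reassoc_of% (na (rowToTop k))]
  have w' : ∀ (t : (Ar.map d).obj ((Ar.map e).obj (top _)) ⟶ (Ar.map τ).obj (top _)),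
      a.app ((Ar.map e).obj (top _)) ≫ D'.map t = D.map t ≫ b.app (top _) := fun t => by
    let t₁ : (Ar.map d).obj ((Ar.map e).obj (top _)) ⟶ (Ar.map τ).obj ((Ar.map δ).obj (top _)) :=
      homOfLE ⟨(congrArg (fun f => f.toOrderHom 0) h.comm).le,
        (congrArg (fun f => f.toOrderHom (Fin.last _)) h.comm).le⟩
    let t₂ : (Ar.map δ).obj (top (SimplexCategory.mk 1)) ⟶ top _ :=
      homOfLE ⟨hδ0.le, hδ1.le⟩
    have e₁ : t = t₁ ≫ (Ar.map τ).map t₂ := rfl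
    rw [e₁, D'.map_comp, D.map_comp, reassoc_of% (w t₁), Category.assoc, nb]
  obtain ⟨c, hc⟩ := hD.exists_hom hD' W (fun k => by
    rcases h.eq_τ_or k with rfl | ⟨k', rfl⟩
    -- The corners are `p = (0, i+1)`, `q = (0, i+2)`, `s = (i, i+1)` and `t = (i, i+2)`.
    · let p := row (SimplexCategory.mk (N + 1)) (τ.toOrderHom 1)
      let q := (Ar.map d).obj (row _ (e.toOrderHom 1))
      let s := (Ar.map τ).obj (row (SimplexCategory.mk 2) 1)
      let t := (Ar.map τ).obj (top (SimplexCategory.mk 2))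
      have h12 : τ.toOrderHom 1 ≤ τ.toOrderHom 2 := τ.toOrderHom.monotone (by decide)
      let pq : p ⟶ q := homOfLE ⟨hd0.ge, h12.trans hde.ge⟩
      let ps : p ⟶ s := homOfLE ⟨Fin.zero_le _, le_rfl⟩
      let qt : q ⟶ t := homOfLE ⟨hd0.le.trans (Fin.zero_le _), hde.le⟩
      let st : s ⟶ t := (Ar.map τ).map (rowToTop _)
      have sq := (hD'.bicartesianSq_map pq ps qt st hd0.symm rfl hde rfl).toIsPullback
      refine ⟨sq.lift (D.map pq ≫ a.app _) (D.map ps ≫ b.app _) ?_, ?_⟩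
      · let x₁ : row _ (e.toOrderHom 1) ⟶ (Ar.map e).obj (top (SimplexCategory.mk 1)) :=
          homOfLE ⟨Fin.zero_le _, le_rfl⟩
        let x₂ : (Ar.map d).obj ((Ar.map e).obj (top (SimplexCategory.mk 1))) ⟶ t :=
          homOfLE ⟨h.d_e_zero.le, hde.le⟩
        have e₁ : qt = (Ar.map d).map x₁ ≫ x₂ := rfl
        rw [Category.assoc, Category.assoc, e₁, D'.map_comp, ← reassoc_of% (na x₁), w', ← nb,
          ← D.map_comp_assoc, ← D.map_comp_assoc, ← D.map_comp_assoc]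
        rfl
      · let x : q ⟶ top _ := homOfLE ⟨hd0.le, Fin.le_last _⟩
        have e₁ : rowToTop (τ.toOrderHom 1) = pq ≫ x := rfl
        rw [e₁, D'.map_comp, sq.lift_fst_assoc, Category.assoc, hW, D.map_comp, Category.assoc]
    · let x : row (SimplexCategory.mk (N + 1)) (d.toOrderHom k') ⟶ (Ar.map d).obj (row _ k') :=
        homOfLE ⟨hd0.ge, le_rfl⟩
      let y : (Ar.map d).obj (row _ k') ⟶ row (SimplexCategory.mk (N + 1)) (d.toOrderHom k') :=
        homOfLE ⟨hd0.le, le_rfl⟩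
      refine ⟨D.map x ≫ a.app _ ≫ D'.map y, ?_⟩
      rw [Category.assoc, Category.assoc, ← D'.map_comp, hW, ← D.map_comp_assoc]
      rfl)
  have hca : Functor.whiskerLeft (Ar.map d) c = a := by
    refine (hD.comp_map d).hom_ext (hD'.comp_map d) ?_
    change c.app ((Ar.map d).obj (top _)) = _
    have := epi_of_adEpi (hD.adEpi_map r hdl.symm)
    rw [← cancel_epi (D.map r), c.naturality, hc, Category.assoc, Category.assoc, ← D'.map_comp]
    exact congrArg (D.map r ≫ ·) ((congrArg (a.app _ ≫ ·) (D'.map_id _)).trans (Category.comp_id _))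
  refine ⟨c, hca, ?_⟩
  refine (hD.comp_map τ).hom_ext (hD'.comp_map τ) ?_
  change c.app ((Ar.map τ).obj (top _)) = _
  let t : (Ar.map d).obj ((Ar.map e).obj (top _)) ⟶ (Ar.map τ).obj (top _) :=
    homOfLE ⟨h.d_e_zero.le, hde.le⟩
  have := epi_of_adEpi (hD.adEpi_map t hde)
  rw [← cancel_epi (D.map t), c.naturality, ← w']
  exact congrArg (fun s => s.app ((Ar.map e).obj (top _)) ≫ D'.map t) hca

/-- The object `(0, N + 1)`, which determines a morphism, survives the removal of the tip. -/
lemma IsSdot.hom_ext_of_isEar (h : IsEar N i e δ d τ) {D D' : Ar (SimplexCategory.mk (N + 1)) ⥤ A}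
    (hD : IsSdot A D) (hD' : IsSdot A D') {c c' : D ⟶ D'}
    (w : Functor.whiskerLeft (Ar.map d) c = Functor.whiskerLeft (Ar.map d) c') : c = c' := by
  let r : top (SimplexCategory.mk (N + 1)) ⟶ (Ar.map d).obj (top _) :=
    homOfLE ⟨h.d_zero.ge, h.d_last.ge⟩
  refine hD.hom_ext hD' ?_
  have := mono_of_adMono (hD'.adMono_map r h.d_zero.symm)
  rw [← cancel_mono (D'.map r), ← c.naturality, ← c'.naturality]
  exact congrArg (fun s => D.map r ≫ s.app (top _)) w

end SdotEars

end RelSdot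

namespace RelSdot

/-! ### Ear squares of `S_•`: gluing of objects. -/

section SdotEarsObj

variable {A : Type u} [Category.{v} A] [Preadditive A] [HasFiniteBiproducts A] [ExactCategory A]

variable {N i : ℕ} {e : SimplexCategory.mk 1 ⟶ SimplexCategory.mk N}
    {δ : SimplexCategory.mk 1 ⟶ SimplexCategory.mk 2}
    {d : SimplexCategory.mk N ⟶ SimplexCategory.mk (N + 1)}
    {τ : SimplexCategory.mk 2 ⟶ SimplexCategory.mk (N + 1)}

open IsSdot

/-- The middle term inserted between the vertices `i` and `i + 2` of a diagram. -/
lemma IsSdot.exists_middle {n : SimplexCategory} {D : Ar n ⥤ A} (hD : IsSdot A D)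
    {D' : Ar (SimplexCategory.mk 2) ⥤ A} (hD' : IsSdot A D') (p : Ar n)
    (ε : D.obj p ≅ D'.obj (top _)) :
    ∃ (M : A) (s : M ⟶ D.obj (row n p.1.2)) (t : M ⟶ D'.obj (row _ 1))
      (l : D.obj (row n p.1.1) ⟶ M), adMono A s ∧ IsExactPair l t ∧
      l ≫ s = D.map (homOfLE ⟨le_rfl, p.2⟩ : row n p.1.1 ⟶ row n p.1.2) ∧
      s ≫ D.map (rowTo p) ≫ ε.hom = t ≫ D'.map (rowToTop 1) := by
  have hx : IsExactPair (D.map (homOfLE ⟨le_rfl, p.2⟩ : row n p.1.1 ⟶ row n p.1.2))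
      (D.map (rowTo p) ≫ ε.hom) :=
    (hD.isExactPair (homOfLE ⟨le_rfl, p.2⟩ : row n p.1.1 ⟶ row n p.1.2) (rowTo p)
      rfl rfl rfl).of_iso (Iso.refl _) (Iso.refl _) ε (by simp) (by simp)
  obtain ⟨M, s, t, sq, ht⟩ := ExactCategory.pullback_epi (D'.map (rowToTop 1)) _ hx.adEpi
  let l : D.obj (row n p.1.1) ⟶ M := sq.lift (D.map (homOfLE ⟨le_rfl, p.2⟩ : row n p.1.1 ⟶ row n p.1.2)) 0 (by
    rw [hx.zero, zero_comp])
  exact ⟨M, s, t, l, adMono_of_isPullback sq hx.adEpi (hD'.adMono_map _ rfl),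
    hx.of_isPullback sq (sq.lift_fst _ _ _) (sq.lift_snd _ _ _), sq.lift_fst _ _ _, sq.w⟩

/-- The term `M` from `IsSdot.exists_middle` is inserted at position `i+1` into the row of `D₀`,
viewed as a chain of subobjects of its last term, and `D` is the resulting diagram of quotients. The
comparisons with `D₀` and `D₁` need only be given on rows, by `IsSdot.exists_iso`. -/
lemma IsSdot.exists_obj_of_isEar (h : IsEar N i e δ d τ)
    {D₀ : Ar (SimplexCategory.mk N) ⥤ A} {D₁ : Ar (SimplexCategory.mk 2) ⥤ A}
    (h₀ : IsSdot A D₀) (h₁ : IsSdot A D₁) (ε : D₀.obj ((Ar.map e).obj (top _)) ≅ D₁.obj (top _)) :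
    ∃ (D : Ar (SimplexCategory.mk (N + 1)) ⥤ A) (_ : IsSdot A D) (a : Ar.map d ⋙ D ≅ D₀)
      (b : Ar.map τ ⋙ D ≅ D₁),
      ∀ t : (Ar.map d).obj ((Ar.map e).obj (top _)) ⟶ (Ar.map τ).obj (top _),
        a.hom.app ((Ar.map e).obj (top _)) ≫ ε.hom = D.map t ≫ b.hom.app (top _) := by
  obtain ⟨M, s, t, l, hs, hlt, hls, hst⟩ := h₀.exists_middle h₁ _ ε
  let O : Fin (N + 1) → Over (D₀.obj (top _)) := fun k => Over.mk (D₀.map (rowToTop k))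
  let OM : Over (D₀.obj (top _)) := Over.mk (s ≫ D₀.map (rowToTop (e.toOrderHom (Fin.last _))))
  let c : Fin (N + 2) → Over (D₀.obj (top _)) := 
    (τ.toOrderHom 1).insertNth (α := fun _ => Over (D₀.obj (top _))) OM O
  have cd : ∀ {x k}, x = d.toOrderHom k → c x = O k := fun {x k} hx => by
    subst hx
    dsimp only [c]
    rw [h.d_eq_succAbove, Fin.insertNth_apply_succAbove]
  have cM : c (τ.toOrderHom 1) = OM := Fin.insertNth_apply_same _ _ _
  have mO : ∀ k, Mono (O k).hom := fun k => mono_of_adMono (h₀.adMono_map _ rfl)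
  have mOM : Mono OM.hom := mono_of_adMono (adMono_comp hs (h₀.adMono_map _ rfl))
  have hc : ∀ k, Mono (c k).hom := fun k => by
    rcases h.eq_τ_or k with rfl | ⟨k', hk⟩
    · rw [cM]; exact mOM
    · rw [cd hk]; exact mO k'
  let OO : ∀ {k k'}, k ≤ k' → (O k ⟶ O k') := fun {k k'} hk =>
    Over.homMk (D₀.map (homOfLE ⟨le_rfl, hk⟩)) (D₀.map_comp _ _).symm
  have hOO : ∀ {k k'} (hk : k ≤ k'), adMono A (OO hk).left := fun hk => h₀.adMono_map _ rfl
  let OOM : O (e.toOrderHom 0) ⟶ OM := Over.homMk l (by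
    refine (Category.assoc _ _ _).symm.trans ((congrArg (· ≫ _) hls).trans ?_)
    exact (D₀.map_comp _ _).symm)
  let OMO : OM ⟶ O (e.toOrderHom 1) := Over.homMk s rfl
  have hcc : ∀ k k', k ≤ k' → ∃ f : c k ⟶ c k', adMono A f.left := by
    have e0 : ∀ k, (e.toOrderHom k).val = i + k.val := h.e_val
    have hτ : (τ.toOrderHom 1).val = i + 1 := h.τ_val 1
    intro k k' hk
    rcases h.eq_τ_or k with rfl | ⟨j, hj⟩
    · rcases h.eq_τ_or k' with rfl | ⟨j', hj'⟩
      · exact ⟨𝟙 _, adMono_of_isIso (𝟙 _)⟩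
      · rw [cM, cd hj']
        have hle : e.toOrderHom 1 ≤ j' := by
          rw [hj', Fin.le_def, hτ, h.d_val] at hk
          rw [Fin.le_def, e0]
          simp
          split_ifs at hk <;> omega
        exact ⟨OMO ≫ OO hle, adMono_comp hs (hOO hle)⟩
    · rcases h.eq_τ_or k' with rfl | ⟨j', hj'⟩
      · rw [cM, cd hj]
        have hle : j ≤ e.toOrderHom 0 := by
          rw [hj, Fin.le_def, hτ, h.d_val] at hk
          rw [Fin.le_def, e0]
          simp
          split_ifs at hk <;> omega
        exact ⟨OO hle ≫ OOM, adMono_comp (hOO hle) hlt.adMono⟩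
      · rw [cd hj, cd hj']
        have hle : j ≤ j' := by
          rw [hj, hj', Fin.le_def, h.d_val, h.d_val] at hk
          rw [Fin.le_def]
          split_ifs at hk <;> omega
        exact ⟨OO hle, hOO hle⟩
  obtain ⟨D, hD, π, nπ, hπ⟩ := exists_quotientDiagram (SimplexCategory.mk (N + 1)) c hc hcc
  let φ : ∀ {x k}, x = d.toOrderHom k → (c x ≅ O k) := fun hx => eqToIso (cd hx)
  let ψ : c (τ.toOrderHom 1) ≅ OM := eqToIso cM
  have eπ : ∀ p, Epi (π p) := fun p => by
    let f : c p.1.1 ⟶ c p.1.2 := (hcc _ _ p.2).choose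
    exact (hπ p f).epi
  -- The bottom of the chain is the zero object `D₀ (0, 0)`, so the quotient by it changes nothing.
  have ha : ∀ k, ∃ f : D.obj ((Ar.map d).obj (row _ k)) ≅ D₀.obj (row _ k),
      π ((Ar.map d).obj (row _ k)) ≫ f.hom = (φ rfl).hom.left := fun k => by
    let f : c (d.toOrderHom 0) ⟶ c (d.toOrderHom k) :=
      (φ rfl).hom ≫ OO (Fin.zero_le k) ≫ (φ rfl).inv
    have hf : f ≫ (φ rfl).hom = (φ rfl).hom ≫ OO (Fin.zero_le k) := by simp [f]
    obtain ⟨g, hg⟩ := (hπ ((Ar.map d).obj (row _ k)) f).exists_iso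
      (h₀.isExactPair (homOfLE ⟨le_rfl, Fin.zero_le k⟩ : row _ 0 ⟶ row _ k) (𝟙 (row _ k))
        rfl rfl rfl) ((Over.forget _).mapIso (φ rfl)) ((Over.forget _).mapIso (φ rfl))
      (congrArg Over.Hom.left hf)
    exact ⟨g, hg.trans (by rw [D₀.map_id]; exact Category.comp_id _)⟩
  choose a ha using ha
  have hac : ∀ k, (a k).hom ≫ D₀.map (rowToTop k) =
      D.map ((Ar.map d).map (rowToTop k)) ≫ (a (Fin.last _)).hom := fun k => by
    have := eπ ((Ar.map d).obj (row _ k))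
    let f : c (d.toOrderHom k) ⟶ c (d.toOrderHom (Fin.last _)) :=
      (φ rfl).hom ≫ OO (Fin.le_last k) ≫ (φ rfl).inv
    have hf : f ≫ (φ rfl).hom = (φ rfl).hom ≫ OO (Fin.le_last k) := by simp [f]
    rw [← cancel_epi (π ((Ar.map d).obj (row _ k))), reassoc_of% ha]
    have hn := nπ _ _ ((Ar.map d).map (rowToTop k)) f
    rw [reassoc_of% hn, ha]
    exact (congrArg Over.Hom.left hf).symm
  obtain ⟨α, hα⟩ := (hD.comp_map d).exists_iso h₀ (a (Fin.last _)) (fun k => ⟨a k, hac k⟩)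
  have hα' : ∀ k, α.hom.app (row _ k) = (a k).hom := fun k => by
    have := mono_of_adMono (h₀.adMono_map (rowToTop k) rfl)
    rw [← cancel_mono (D₀.map (rowToTop k)), ← α.hom.naturality, hα, hac]
    rfl
  obtain ⟨b, hb⟩ : ∃ f : D.obj ((Ar.map τ).obj (top _)) ≅ D₁.obj (top _),
      π ((Ar.map τ).obj (top _)) ≫ f.hom =
        (φ h.d_e_one.symm).hom.left ≫ D₀.map (rowTo _) ≫ ε.hom := by
    have hle : e.toOrderHom 0 ≤ e.toOrderHom 1 := e.toOrderHom.monotone (by decide)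
    let f : c (τ.toOrderHom 0) ⟶ c (τ.toOrderHom 2) :=
      (φ h.d_e_zero.symm).hom ≫ OO hle ≫ (φ h.d_e_one.symm).inv
    have hf : f ≫ (φ h.d_e_one.symm).hom = (φ h.d_e_zero.symm).hom ≫ OO hle := by simp [f]
    refine (hπ ((Ar.map τ).obj (top _)) f).exists_iso (IsExactPair.of_iso
      (h₀.isExactPair (homOfLE ⟨le_rfl, hle⟩ : row _ (e.toOrderHom 0) ⟶ row _ (e.toOrderHom 1))
        (rowTo ((Ar.map e).obj (top _))) rfl rfl rfl) (Iso.refl _) (Iso.refl _) ε ?_ ?_)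
      ((Over.forget _).mapIso (φ h.d_e_zero.symm)) ((Over.forget _).mapIso (φ h.d_e_one.symm))
      (congrArg Over.Hom.left hf)
    · exact (Category.id_comp _).trans (Category.comp_id _).symm
    · exact Category.id_comp _
  obtain ⟨b', hb'⟩ : ∃ f : D.obj ((Ar.map τ).obj (row _ 1)) ≅ D₁.obj (row _ 1),
      π ((Ar.map τ).obj (row _ 1)) ≫ f.hom = ψ.hom.left ≫ t := by
    let f : c (τ.toOrderHom 0) ⟶ c (τ.toOrderHom 1) :=
      (φ h.d_e_zero.symm).hom ≫ OOM ≫ ψ.inv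
    have hf : f ≫ ψ.hom = (φ h.d_e_zero.symm).hom ≫ OOM := by simp [f]
    exact (hπ ((Ar.map τ).obj (row _ 1)) f).exists_iso hlt
      ((Over.forget _).mapIso (φ h.d_e_zero.symm)) ((Over.forget _).mapIso ψ)
      (congrArg Over.Hom.left hf)
  -- The row of `D₁` has three terms: a zero object, the quotient of `M` by `D₀ (0, i)`, and the
  -- full quotient compared through `ε`.
  obtain ⟨β, hβ⟩ := (hD.comp_map τ).exists_iso h₁ b (fun k => by
    obtain rfl | rfl | rfl : k = 0 ∨ k = 1 ∨ k = Fin.last _ := by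
      have hk : k.val < 3 := k.2
      simp only [Fin.ext_iff]
      change k.val = 0 ∨ k.val = 1 ∨ k.val = 2
      omega
    · have hz := hD.isZero_obj ((Ar.map τ).obj (row _ 0)) rfl
      exact ⟨hz.iso (h₁.isZero_obj (row _ 0) rfl), hz.eq_of_src _ _⟩
    · refine ⟨b', ?_⟩
      have := eπ ((Ar.map τ).obj (row _ 1))
      let f : c (τ.toOrderHom 1) ⟶ c (τ.toOrderHom 2) := ψ.hom ≫ OMO ≫ (φ h.d_e_one.symm).inv
      have hf : f ≫ (φ h.d_e_one.symm).hom = ψ.hom ≫ OMO := by simp [f]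
      have hf' : f.left ≫ (φ h.d_e_one.symm).hom.left = ψ.hom.left ≫ s :=
        congrArg Over.Hom.left hf
      have hn := nπ _ _ ((Ar.map τ).map (rowToTop 1)) f
      rw [← cancel_epi (π ((Ar.map τ).obj (row _ 1))), reassoc_of% hb']
      refine ((Category.assoc _ _ _).trans (congrArg (ψ.hom.left ≫ ·) hst.symm)).trans ?_
      change _ = π _ ≫ D.map ((Ar.map τ).map (rowToTop 1)) ≫ _
      rw [reassoc_of% hn, hb]
      exact ((Category.assoc _ _ _).symm.trans ((congrArg (· ≫ (D₀.map _ ≫ ε.hom)) hf').trans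
        (Category.assoc _ _ _))).symm
    · exact ⟨b, (congrArg (b.hom ≫ ·) (D₁.map_id _)).trans ((Category.comp_id _).trans
        ((Category.id_comp _).symm.trans (congrArg (· ≫ b.hom) (D.map_id _).symm)))⟩)
  refine ⟨D, hD, α, β, fun x => ?_⟩
  let y : row _ (e.toOrderHom 1) ⟶ (Ar.map e).obj (top (SimplexCategory.mk 1)) :=
    homOfLE ⟨Fin.zero_le _, le_rfl⟩
  have := eπ ((Ar.map d).obj (row _ (e.toOrderHom 1)))
  have := epi_of_adEpi (hD.adEpi_map ((Ar.map d).map y) rfl)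
  have nα : D.map ((Ar.map d).map y) ≫ α.hom.app _ = α.hom.app _ ≫ D₀.map y := α.hom.naturality y
  let f : c (d.toOrderHom (e.toOrderHom 1)) ⟶ c (τ.toOrderHom 2) :=
    (φ rfl).hom ≫ (φ h.d_e_one.symm).inv
  have hf : f ≫ (φ h.d_e_one.symm).hom = (φ rfl).hom := by simp [f]
  have hf' : f.left ≫ (φ h.d_e_one.symm).hom.left = (φ rfl).hom.left := congrArg Over.Hom.left hf
  have hn := nπ _ _ ((Ar.map d).map y ≫ x) f
  rw [← cancel_epi (D.map ((Ar.map d).map y)), reassoc_of% nα, hα',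
    ← cancel_epi (π ((Ar.map d).obj (row _ (e.toOrderHom 1)))), reassoc_of% ha,
    ← D.map_comp_assoc, reassoc_of% hn, hβ, hb]
  exact ((Category.assoc _ _ _).symm.trans (congrArg (· ≫ (D₀.map _ ≫ ε.hom)) hf')).symm

end SdotEarsObj

end RelSdot

namespace RelSdot

/-! ### Ear squares of `S_•`, of its path object and of the relative construction. -/

section SdotLocal

variable {A : Type u} [Category.{v} A] [Preadditive A] [HasFiniteBiproducts A] [ExactCategory A]

section

variable {N i : ℕ} {e : SimplexCategory.mk 1 ⟶ SimplexCategory.mk N}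
    {δ : SimplexCategory.mk 1 ⟶ SimplexCategory.mk 2}
    {d : SimplexCategory.mk N ⟶ SimplexCategory.mk (N + 1)}
    {τ : SimplexCategory.mk 2 ⟶ SimplexCategory.mk (N + 1)}

open IsSdot

lemma isHPull_sdotRes (h : IsEar N i e δ d τ) : IsHPull (sdotRes A d) (sdotRes A τ) (sdotRes A e)
    (sdotRes A δ) (sdotRes_comm h) where
  hom {x y} a b w := by
    obtain ⟨c, hc, hc'⟩ := IsSdot.exists_hom_of_isEar h x.property y.property a.hom b.hom
      (fun t => by
        have w' := congrArg (fun s => s.hom.app (top _)) w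
        simp only [ObjectProperty.FullSubcategory.comp_hom, NatTrans.comp_app] at w'
        have ex := sdotRes_eqToHom h.comm x (Functor.congr_obj (sdotRes_comm h) x) (top _)
        have ey := sdotRes_eqToHom h.comm y (Functor.congr_obj (sdotRes_comm h) y) (top _)
        exact (congrArg (_ ≫ ·) ey).symm.trans (w'.trans (congrArg (· ≫ _) ex)))
    exact ⟨ObjectProperty.homMk c, ObjectProperty.hom_ext _ hc, ObjectProperty.hom_ext _ hc'⟩
  hom_ext {x y c c'} w _ := ObjectProperty.hom_ext _
    (IsSdot.hom_ext_of_isEar h x.property y.property (congrArg (fun s => s.hom) w))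
  obj y z ε := by
    have hδ0 : δ.toOrderHom 0 = 0 := by apply Fin.ext; rw [h.δ_val]; rfl
    have hδ1 : δ.toOrderHom 1 = 2 := by apply Fin.ext; rw [h.δ_val]; rfl
    let r : (Ar.map δ).obj (top (SimplexCategory.mk 1)) ⟶ top _ := homOfLE ⟨hδ0.le, hδ1.le⟩
    let r' : top _ ⟶ (Ar.map δ).obj (top (SimplexCategory.mk 1)) := homOfLE ⟨hδ0.ge, hδ1.ge⟩
    let R : (Ar.map δ).obj (top (SimplexCategory.mk 1)) ≅ top _ := ⟨r, r', rfl, rfl⟩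
    obtain ⟨D, hD, a, b, hab⟩ := IsSdot.exists_obj_of_isEar h y.property z.property
      (((sdotProp A _).ι.mapIso ε).app (top _) ≪≫ z.obj.mapIso R)
    refine ⟨⟨D, hD⟩, (sdotProp A _).isoMk a, (sdotProp A _).isoMk b, ObjectProperty.hom_ext _ ?_⟩
    -- An equality of morphisms in `S_1` need only be tested at the object `(0, 1)`.
    refine (hD.comp_map (e ≫ d)).hom_ext (z.property.comp_map δ) ?_
    let t : (Ar.map d).obj ((Ar.map e).obj (top (SimplexCategory.mk 1))) ⟶
        (Ar.map τ).obj ((Ar.map δ).obj (top (SimplexCategory.mk 1))) :=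
      homOfLE ⟨(congrArg (fun f => f.toOrderHom 0) h.comm).le,
        (congrArg (fun f => f.toOrderHom (Fin.last _)) h.comm).le⟩
    have ex := sdotRes_eqToHom h.comm ⟨D, hD⟩ (Functor.congr_obj (sdotRes_comm h) ⟨D, hD⟩) (top _)
    refine Eq.trans ?_ (congrArg (· ≫ b.hom.app ((Ar.map δ).obj (top _))) ex).symm
    have hab := hab (t ≫ (Ar.map τ).map R.hom)
    have nb : D.map ((Ar.map τ).map R.hom) ≫ b.hom.app _ = b.hom.app _ ≫ z.obj.map R.hom :=
      b.hom.naturality R.hom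
    rw [D.map_comp, Category.assoc, nb] at hab
    refine (cancel_mono (z.obj.mapIso R).hom).1 ?_
    exact (Category.assoc _ _ _).trans (hab.trans (Category.assoc _ _ _).symm)

lemma isLocalSq_sdot (h : IsEar N i e δ d τ) : IsLocalSq (sdot A) h.comm :=
  (isHPull_sdotRes h).core _

lemma IsHPull.congr {X Y Z W : Type*} [Category X] [Category Y] [Category Z] [Category W]
    {P P' : X ⥤ Y} {Q Q' : X ⥤ Z} {f f' : Y ⥤ W} {g g' : Z ⥤ W} {h : P ⋙ f = Q ⋙ g}
    (H : IsHPull P Q f g h) (hP : P = P') (hQ : Q = Q') (hf : f = f') (hg : g = g')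
    (h' : P' ⋙ f' = Q' ⋙ g') : IsHPull P' Q' f' g' h' := by
  subst hP hQ hf hg
  exact H

lemma coneIncl_val (n : SimplexCategory) (j : Fin (n.len + 1)) :
    ((coneIncl.app n).toOrderHom j).val = j.val + 1 := rfl

/-- Adding a new first vertex shifts the ear by one; the triangle of the shifted ear does not
contain the new vertex. -/
lemma IsEar.cone (h : IsEar N i e δ d τ) :
    IsEar (N + 1) (i + 1) (coneIncl.app _ ≫ coneFunctor.map e) δ (coneFunctor.map d)
      (coneIncl.app _ ≫ coneFunctor.map τ) where
  lt := by have := h.lt; omega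
  e_val j := by
    change (e.toOrderHom j).val + 1 = _
    rw [h.e_val]; omega
  δ_val := h.δ_val
  d_val k := by
    induction k using Fin.cases with
    | zero => exact (if_pos (Nat.zero_le _)).symm
    | succ k =>
      change (d.toOrderHom k).val + 1 = if k.val + 1 ≤ _ then k.val + 1 else k.val + 1 + 1
      rw [h.d_val]
      split_ifs <;> omega
  τ_val j := by
    change (τ.toOrderHom j).val + 1 = _
    rw [h.τ_val]; omega

/-- The quadrilateral `0, 1, 2, 3` with ear `1, 2, 3`: the cone on a triangle is glued from the
triangle itself and the cone on its long edge. -/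
lemma IsEar.coneIncl (h : IsEar N i e δ d τ) :
    IsEar 2 1 (coneIncl.app _) δ (coneFunctor.map δ) (coneIncl.app _) where
  lt := by omega
  e_val j := (coneIncl_val _ j).trans (add_comm _ _)
  δ_val := h.δ_val
  d_val k := by
    induction k using Fin.cases with
    | zero => rfl
    | succ k =>
      change (δ.toOrderHom k).val + 1 = if k.val + 1 ≤ 1 then k.val + 1 else k.val + 1 + 1
      have : k.val < 2 := k.2
      rw [h.δ_val]
      split_ifs <;> omega
  τ_val j := (coneIncl_val _ j).trans (add_comm _ _)

/-- Pasting the square of `initialPath X` with the square of the quadrilateral `h.coneIncl` gives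
the square of the shifted ear `h.cone`, so cancellation applies. -/
lemma isLocalSq_initialPath (h : IsEar N i e δ d τ) {X : SimplicialObject Grpd.{v, u}}
    (h₁ : IsLocalSq X h.coneIncl.comm) (h₂ : IsLocalSq X h.cone.comm) :
    IsLocalSq (initialPath X) h.comm := by
  have e₁ : X.map (coneIncl.app _ ≫ coneFunctor.map e).op =
    X.map (coneFunctor.map e).op ≫ X.map (coneIncl.app _).op := X.map_comp _ _
  have e₂ : X.map (coneIncl.app _ ≫ coneFunctor.map τ).op =
    X.map (coneFunctor.map τ).op ≫ X.map (coneIncl.app _).op := X.map_comp _ _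
  have h₂' := IsHPull.congr h₂ (P' := X.map (coneFunctor.map d).op)
    (Q' := X.map (coneFunctor.map τ).op ≫ X.map (coneIncl.app _).op)
    (f' := X.map (coneFunctor.map e).op ≫ X.map (coneIncl.app _).op)
    (g' := X.map δ.op) rfl e₂ e₁ rfl
    ((congrArg (X.map (coneFunctor.map d).op ≫ ·) e₁).symm.trans
      ((map_comp_map_eq X h.cone.comm).trans (congrArg (· ≫ X.map δ.op) e₂)))
  exact IsHPull.of_right h₁ h₂' _

end

lemma IsSdot.of_iso {n : SimplexCategory} {D D' : Ar n ⥤ A} (hD : IsSdot A D) (φ : D ≅ D') :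
    IsSdot A D' where
  zero i := (hD.zero i).of_iso (φ.symm.app _)
  mono i j l hij hjl := adMono_of_iso (hD.mono i j l hij hjl) (φ.app _) (φ.app _)
    (φ.hom.naturality _).symm
  epi i k j hik hkj := adEpi_of_iso (hD.epi i k j hik hkj) (φ.app _) (φ.app _)
    (φ.hom.naturality _).symm
  square i k j l hik hkj hjl := BicartesianSq.of_isPullback_isPushout
    ((hD.square i k j l hik hkj hjl).toIsPullback.of_iso (φ.app _) (φ.app _) (φ.app _) (φ.app _)
      (φ.hom.naturality _) (φ.hom.naturality _) (φ.hom.naturality _) (φ.hom.naturality _))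
    ((hD.square i k j l hik hkj hjl).toIsPushout.of_iso (φ.app _) (φ.app _) (φ.app _) (φ.app _)
      (φ.hom.naturality _) (φ.hom.naturality _) (φ.hom.naturality _) (φ.hom.naturality _))

lemma Ar.map_obj_injective {m n : SimplexCategory} (α : m ⟶ n)
    (hα : Function.Injective α.toOrderHom) : Function.Injective (Ar.map α).obj := by
  rintro ⟨⟨i, j⟩, hij⟩ ⟨⟨k, l⟩, hkl⟩ h
  have h₁ : α.toOrderHom i = α.toOrderHom k := congrArg (fun p => p.1.1) h
  have h₂ : α.toOrderHom j = α.toOrderHom l := congrArg (fun p => p.1.2) h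
  obtain rfl := hα h₁
  obtain rfl := hα h₂
  rfl

/-- Precomposition with a functor that is injective on objects is an isofibration. -/
lemma exists_extension {I J : Type*} [Category I] [Category J] {C : Type*} [Category C]
    (G : I ⥤ J) (hG : Function.Injective G.obj) (D : J ⥤ C) (E : I ⥤ C) (θ : G ⋙ D ≅ E) :
    ∃ (D' : J ⥤ C) (φ : D ≅ D') (h : G ⋙ D' = E),
      Functor.whiskerLeft G φ.hom ≫ eqToHom h = θ.hom := by
  -- Objects in the image of `G` are replaced by those of `E`, unambiguously by injectivity; all
  -- other objects are kept.
  have key : ∀ j, ∃ (c : C) (f : D.obj j ≅ c), ∀ i (hi : G.obj i = j), ∃ hc : c = E.obj i,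
      f.hom ≫ eqToHom hc = D.map (eqToHom hi.symm) ≫ θ.hom.app i := by
    intro j
    by_cases hj : ∃ i, G.obj i = j
    · obtain ⟨i, rfl⟩ := hj
      refine ⟨_, θ.app i, fun i' hi' => ?_⟩
      obtain rfl := hG hi'
      exact ⟨rfl, by simp⟩
    · exact ⟨_, Iso.refl _, fun i hi => (hj ⟨i, hi⟩).elim⟩
  choose c f hc hf using key
  have hf' : ∀ i, (f (G.obj i)).hom = θ.hom.app i ≫ eqToHom (hc _ i rfl).symm := fun i => by
    have := hf _ i rfl
    rw [← cancel_mono (eqToHom (hc _ i rfl)), this]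
    simp
  have hf'' : ∀ i, (f (G.obj i)).inv = eqToHom (hc _ i rfl) ≫ θ.inv.app i := fun i => by
    rw [← cancel_epi (f _).hom, Iso.hom_inv_id, hf']
    simp
  have h : G ⋙ D.copyObj c f = E := CategoryTheory.Functor.ext (fun i => hc _ i rfl) (fun i j a => by
    change (f _).inv ≫ D.map (G.map a) ≫ (f _).hom = _
    have := θ.hom.naturality a
    dsimp at this
    rw [hf', hf'', Category.assoc, reassoc_of% this, Iso.inv_hom_id_app_assoc]
    rfl)
  refine ⟨D.copyObj c f, D.isoCopyObj c f, h, ?_⟩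
  ext i
  rw [NatTrans.comp_app, eqToHom_app]
  change (f _).hom ≫ _ = _
  rw [hf']
  exact (Category.assoc _ _ _).trans ((congrArg (θ.hom.app i ≫ ·) (eqToHom_trans _ _)).trans
    (Category.comp_id _))

lemma eqToHom_core_app {J C : Type*} [Category J] [Category C] {P : ObjectProperty (J ⥤ C)}
    {x y : Core P.FullSubcategory} (h : x = y) :
    (eqToHom h).iso.hom.hom = eqToHom (congrArg (fun t => t.of.obj) h) := by
  subst h; rfl

/-- `d₀` restricts diagrams along an inclusion of posets that is injective on objects, and `IsSdot`
is invariant under isomorphism; so `exists_extension` supplies the lift. -/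
lemma isofibration_initialPathD₀ (n : SimplexCategory) (x : (initialPath (sdot A)).obj (op n))
    (z : (sdot A).obj (op n)) (θ : ((initialPathD₀ (sdot A)).app (op n)).obj x ⟶ z) :
    ∃ (x' : (initialPath (sdot A)).obj (op n)) (a : x ⟶ x')
      (e : ((initialPathD₀ (sdot A)).app (op n)).obj x' = z),
        ((initialPathD₀ (sdot A)).app (op n)).map a ≫ eqToHom e = θ := by
  let x₀ : Core (sdotProp A (coneFunctor.obj n)).FullSubcategory := x
  let z₀ : Core (sdotProp A n).FullSubcategory := z
  have hi : Function.Injective (coneIncl.app n).toOrderHom := Fin.succ_injective _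
  obtain ⟨D', φ, h, hφ⟩ := exists_extension (Ar.map (coneIncl.app n))
    (Ar.map_obj_injective _ hi) x₀.of.obj z₀.of.obj
    ((sdotProp A n).ι.mapIso (CoreHom.iso (Y := z₀) θ))
  let x' : Core (sdotProp A (coneFunctor.obj n)).FullSubcategory :=
    ⟨⟨D', x₀.of.property.of_iso φ⟩⟩
  let a : x₀ ⟶ x' := ⟨(sdotProp A (coneFunctor.obj n)).isoMk φ⟩
  have e : ((sdotRes A (coneIncl.app n)).core).obj x' = z₀ :=
    congrArg Core.mk (ObjectProperty.FullSubcategory.ext h)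
  refine ⟨x', a, e, ?_⟩
  have key : ((sdotRes A (coneIncl.app n)).core).map a ≫ eqToHom e = θ := by
    refine Core.hom_ext (ObjectProperty.hom_ext _ ?_)
    refine Eq.trans ?_ hφ
    exact congrArg (Functor.whiskerLeft (Ar.map (coneIncl.app n)) φ.hom ≫ ·) (eqToHom_core_app e)
  exact key

variable {B : Type u} [Category.{v} B] [Preadditive B] [HasFiniteBiproducts B] [ExactCategory B]

lemma isLocalSq_relSdot (F : A ⥤ B) [ExactFunctor F] {N i : ℕ}
    {e : SimplexCategory.mk 1 ⟶ SimplexCategory.mk N}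
    {δ : SimplexCategory.mk 1 ⟶ SimplexCategory.mk 2}
    {d : SimplexCategory.mk N ⟶ SimplexCategory.mk (N + 1)}
    {τ : SimplexCategory.mk 2 ⟶ SimplexCategory.mk (N + 1)} (h : IsEar N i e δ d τ) :
    IsLocalSq (relSdot F) h.comm :=
  isLocalSq_simplicialPullback
    (isLocalSq_initialPath h (isLocalSq_sdot h.coneIncl) (isLocalSq_sdot h.cone))
    (isLocalSq_sdot h) (isLocalSq_sdot h) (isofibration_initialPathD₀ _)

end SdotLocal

end RelSdot

namespace RelSdot

/-! ### Edges and ears of triangulations. -/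

section Triangulations

variable {n : ℕ} {T : SimpleGraph (Fin (n + 1))}

/-- By maximality, a chord that crosses no edge of `T` already belongs to `T`. -/
lemma IsTriangulation.adj (hT : IsTriangulation T) {a b : Fin (n + 1)} (hab : a < b)
    (h : ∀ x y, T.Adj x y → ¬ (a < x ∧ x < b ∧ b < y) ∧ ¬ (x < a ∧ a < y ∧ y < b)) :
    T.Adj a b := by
  have hle : T ⊔ SimpleGraph.edge a b ≤ T := by
    refine hT.2 ?_ le_sup_left
    rintro i k j l hik hkj hjl ⟨h₁, h₂⟩
    rw [SimpleGraph.sup_adj, SimpleGraph.edge_adj] at h₁ h₂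
    rcases h₁ with h₁ | ⟨⟨rfl, rfl⟩ | ⟨rfl, rfl⟩, -⟩
    · rcases h₂ with h₂ | ⟨⟨rfl, rfl⟩ | ⟨rfl, rfl⟩, -⟩
      · exact hT.1 i k j l hik hkj hjl ⟨h₁, h₂⟩
      · exact (h _ _ h₁).2 ⟨hik, hkj, hjl⟩
      · exact absurd (hkj.trans hjl) hab.not_gt
    · rcases h₂ with h₂ | ⟨⟨rfl, rfl⟩ | ⟨rfl, rfl⟩, -⟩
      · exact (h _ _ h₂).1 ⟨hik, hkj, hjl⟩
      · exact hik.false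
      · exact absurd (hik.trans hkj) hjl.not_gt
    · exact absurd (hik.trans hkj) hab.not_gt
  exact hle (Or.inr ((SimpleGraph.edge_adj _ _ _ _).2 ⟨Or.inl ⟨rfl, rfl⟩, hab.ne⟩))

lemma IsTriangulation.adj_succ (hT : IsTriangulation T) {a b : Fin (n + 1)}
    (hab : b.val = a.val + 1) : T.Adj a b :=
  hT.adj (Fin.lt_def.2 (by omega)) fun x y _ => by
    simp only [Fin.lt_def]
    omega

/-- A triangulation of a polygon has an ear which does not involve the side from the first to the
last vertex. -/
lemma IsTriangulation.exists_ear (hT : IsTriangulation T) (hn : 2 ≤ n) :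
    ∃ a b : Fin (n + 1), T.Adj a b ∧ b.val = a.val + 2 := by
  classical
  -- An edge of least length `m ≥ 2` is sought; the side from `0` to `n` shows that there is one.
  have hex : ∃ m, 2 ≤ m ∧ ∃ a b : Fin (n + 1), T.Adj a b ∧ b.val = a.val + m := by
    refine ⟨n, hn, 0, Fin.last n, hT.adj (Fin.lt_def.2 ?_) fun x y _ => ?_, ?_⟩
    · simp; omega
    · have := y.2
      simp only [Fin.lt_def, Fin.val_last, Fin.val_zero]
      omega
    · simp
  obtain ⟨hm, a, b, hab, hb⟩ := Nat.find_spec hex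
  have hmin := fun k => Nat.find_min hex (m := k)
  generalize Nat.find hex = m at hm hb hmin
  obtain rfl | hm' := hm.eq_or_lt
  · exact ⟨a, b, hab, hb⟩
  · have hb' := b.2
    let c : Fin (n + 1) := ⟨a.val + 2, by omega⟩
    let p : Fin (n + 1) := ⟨a.val + 1, by omega⟩
    -- If `m > 2`, the chord from `a` to `a + 2` lies in `T`, against minimality: an edge crossing
    -- it ends at `a + 1`, so it either crosses the edge from `a` to `b` or is a shorter edge of
    -- length at least `2`.
    refine absurd ⟨le_rfl, a, c, ?_, rfl⟩ (hmin 2 hm')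
    refine hT.adj (Fin.lt_def.2 (by simp [c])) fun x y hxy => ⟨fun hx => ?_, fun hx => ?_⟩
    · simp only [Fin.lt_def, c] at hx
      obtain rfl : x = p := Fin.ext (by simp [p]; omega)
      rcases lt_or_ge b y with hy | hy
      · exact hT.1 a p b y (Fin.lt_def.2 (by simp [p])) (Fin.lt_def.2 (by simp [p]; omega)) hy
          ⟨hab, hxy⟩
      · rw [Fin.le_def] at hy
        exact hmin (y.val - (a.val + 1)) (by omega) ⟨by omega, p, y, hxy, by simp [p]; omega⟩
    · simp only [Fin.lt_def, c] at hx
      obtain rfl : y = p := Fin.ext (by simp [p]; omega)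
      exact hT.1 x a p b (Fin.lt_def.2 hx.1) (Fin.lt_def.2 (by simp [p]))
        (Fin.lt_def.2 (by simp [p]; omega)) ⟨hxy, hab⟩

end Triangulations

/-! ### Removing an ear from a triangulation. -/

section EarTriangulations

variable {N i : ℕ} {T : SimpleGraph (Fin (N + 1 + 1))}
    {e : SimplexCategory.mk 1 ⟶ SimplexCategory.mk N}
    {δ : SimplexCategory.mk 1 ⟶ SimplexCategory.mk 2}
    {d : SimplexCategory.mk N ⟶ SimplexCategory.mk (N + 1)}
    {τ : SimplexCategory.mk 2 ⟶ SimplexCategory.mk (N + 1)}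

lemma exists_isEar (h : i < N) : ∃ (e : SimplexCategory.mk 1 ⟶ SimplexCategory.mk N)
    (δ : SimplexCategory.mk 1 ⟶ SimplexCategory.mk 2)
    (d : SimplexCategory.mk N ⟶ SimplexCategory.mk (N + 1))
    (τ : SimplexCategory.mk 2 ⟶ SimplexCategory.mk (N + 1)), IsEar N i e δ d τ :=
  ⟨SimplexCategory.mkHom ⟨fun j => ⟨i + j.val, by have := j.2; omega⟩, fun a b hab => by
      rw [Fin.le_def] at hab ⊢; simp only; omega⟩,
    SimplexCategory.mkHom ⟨fun j => ⟨2 * j.val, by have := j.2; omega⟩, fun a b hab => by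
      rw [Fin.le_def] at hab ⊢; simp only; omega⟩,
    SimplexCategory.mkHom ⟨fun k => ⟨if k.val ≤ i then k.val else k.val + 1, by
      have := k.2; split_ifs <;> omega⟩, fun a b hab => by
      rw [Fin.le_def] at hab ⊢; simp only; split_ifs <;> omega⟩,
    SimplexCategory.mkHom ⟨fun j => ⟨i + j.val, by have := j.2; omega⟩, fun a b hab => by
      rw [Fin.le_def] at hab ⊢; simp only; omega⟩,
    ⟨h, fun _ => rfl, fun _ => rfl, fun _ => rfl, fun _ => rfl⟩⟩

namespace IsEar

lemma d_lt_iff (h : IsEar N i e δ d τ) (a b : Fin (N + 1)) :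
    d.toOrderHom a < d.toOrderHom b ↔ a < b := by
  rw [Fin.lt_def, Fin.lt_def, h.d_val, h.d_val]
  split_ifs <;> omega

lemma d_le_iff (h : IsEar N i e δ d τ) (a b : Fin (N + 1)) :
    d.toOrderHom a ≤ d.toOrderHom b ↔ a ≤ b := by
  rw [← not_lt, h.d_lt_iff, not_lt]

lemma τ_le_iff (h : IsEar N i e δ d τ) (a b : Fin 3) :
    τ.toOrderHom a ≤ τ.toOrderHom b ↔ a ≤ b := by
  rw [Fin.le_def, Fin.le_def, h.τ_val, h.τ_val]
  omega

/-- The neighbours of the tip of an ear. -/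
lemma eq_of_adj (h : IsEar N i e δ d τ) (hT : IsTriangulation T)
    (hear : T.Adj (τ.toOrderHom 0) (τ.toOrderHom 2)) {q : Fin (N + 2)}
    (hq : T.Adj (τ.toOrderHom 1) q) : q = τ.toOrderHom 0 ∨ q = τ.toOrderHom 2 := by
  have h0 : (τ.toOrderHom 0).val = i := h.τ_val 0
  have h1 : (τ.toOrderHom 1).val = i + 1 := h.τ_val 1
  have h2 : (τ.toOrderHom 2).val = i + 2 := h.τ_val 2
  have hne : q.val ≠ i + 1 := fun hq' => hq.ne (Fin.ext (h1.trans hq'.symm))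
  by_contra hcon
  rw [not_or, Fin.ext_iff, Fin.ext_iff, h0, h2] at hcon
  rcases lt_or_gt_of_ne hcon.1 with hlt | hgt
  · exact hT.1 q (τ.toOrderHom 0) (τ.toOrderHom 1) (τ.toOrderHom 2) (Fin.lt_def.2 (by omega))
      (Fin.lt_def.2 (by omega)) (Fin.lt_def.2 (by omega)) ⟨hq.symm, hear⟩
  · exact hT.1 (τ.toOrderHom 0) (τ.toOrderHom 1) (τ.toOrderHom 2) q (Fin.lt_def.2 (by omega))
      (Fin.lt_def.2 (by omega)) (Fin.lt_def.2 (by omega)) ⟨hear, hq⟩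

/-- Removing an ear from a triangulation leaves a triangulation. -/
lemma isTriangulation_comap (h : IsEar N i e δ d τ) (hT : IsTriangulation T)
    (hear : T.Adj (τ.toOrderHom 0) (τ.toOrderHom 2)) :
    IsTriangulation (T.comap d.toOrderHom : SimpleGraph (Fin (N + 1))) := by
  have h0 : (τ.toOrderHom 0).val = i := h.τ_val 0
  have h1 : (τ.toOrderHom 1).val = i + 1 := h.τ_val 1
  have h2 : (τ.toOrderHom 2).val = i + 2 := h.τ_val 2
  have hne : ∀ k, (d.toOrderHom k).val ≠ i + 1 := fun k => by
    rw [h.d_val]; split_ifs <;> omega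
  refine ⟨fun a b c f hab hbc hcf => hT.1 _ _ _ _ ((h.d_lt_iff _ _).2 hab)
    ((h.d_lt_iff _ _).2 hbc) ((h.d_lt_iff _ _).2 hcf), fun G hG hle => ?_⟩
  have key : ∀ a b, a < b → G.Adj a b → T.Adj (d.toOrderHom a) (d.toOrderHom b) := by
    intro a b hab hadj
    have ha := hne a
    have hb := hne b
    refine hT.adj ((h.d_lt_iff _ _).2 hab) fun x y hxy => ?_
    -- Edges of `T` at the tip join it to a neighbouring vertex and cross nothing; the remaining
    -- edges come from the smaller polygon, where `G` is non-crossing.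
    rcases h.eq_τ_or x with rfl | ⟨x, rfl⟩
    · rcases h.eq_of_adj hT hear hxy with rfl | rfl <;> simp only [Fin.lt_def] <;> omega
    · rcases h.eq_τ_or y with rfl | ⟨y, rfl⟩
      · rcases h.eq_of_adj hT hear hxy.symm with hx | hx <;> rw [hx] <;> simp only [Fin.lt_def] <;>
          omega
      · rw [h.d_lt_iff, h.d_lt_iff, h.d_lt_iff, h.d_lt_iff, h.d_lt_iff, h.d_lt_iff]
        exact ⟨fun ⟨k₁, k₂, k₃⟩ => hG a x b y k₁ k₂ k₃ ⟨hadj, hle hxy⟩,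
          fun ⟨k₁, k₂, k₃⟩ => hG x a y b k₁ k₂ k₃ ⟨hle hxy, hadj⟩⟩
  intro a b hab
  rcases lt_or_gt_of_ne hab.ne with hlt | hgt
  · exact key a b hlt hab
  · exact (key b a hgt hab.symm).symm

lemma isClique_τ (h : IsEar N i e δ d τ) (hT : IsTriangulation T)
    (hear : T.Adj (τ.toOrderHom 0) (τ.toOrderHom 2)) : T.IsClique (Set.range τ.toOrderHom) := by
  have h0 : (τ.toOrderHom 0).val = i := h.τ_val 0
  have h1 : (τ.toOrderHom 1).val = i + 1 := h.τ_val 1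
  have h2 : (τ.toOrderHom 2).val = i + 2 := h.τ_val 2
  have h01 : T.Adj (τ.toOrderHom 0) (τ.toOrderHom 1) := hT.adj_succ (by omega)
  have h12 : T.Adj (τ.toOrderHom 1) (τ.toOrderHom 2) := hT.adj_succ (by omega)
  have key : ∀ a b : Fin 3, a < b → T.Adj (τ.toOrderHom a) (τ.toOrderHom b) := by
    intro a b hab
    have hv : a.val < b.val := hab
    have hb := b.2
    rcases (by omega : (a.val = 0 ∧ b.val = 1) ∨ (a.val = 0 ∧ b.val = 2) ∨
      (a.val = 1 ∧ b.val = 2)) with ⟨ha, hb⟩ | ⟨ha, hb⟩ | ⟨ha, hb⟩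
    · obtain rfl : a = 0 := Fin.ext ha
      obtain rfl : b = 1 := Fin.ext hb
      exact h01
    · obtain rfl : a = 0 := Fin.ext ha
      obtain rfl : b = 2 := Fin.ext hb
      exact hear
    · obtain rfl : a = 1 := Fin.ext ha
      obtain rfl : b = 2 := Fin.ext hb
      exact h12
  rintro _ ⟨a, rfl⟩ _ ⟨b, rfl⟩ hab
  rcases lt_or_gt_of_ne (fun hab' : a = b => hab (congrArg _ hab')) with hlt | hgt
  · exact key a b hlt
  · exact (key b a hgt).symm

/-- A clique either avoids the tip of an ear or is contained in the ear. -/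
lemma range_subset_or (h : IsEar N i e δ d τ) (hT : IsTriangulation T)
    (hear : T.Adj (τ.toOrderHom 0) (τ.toOrderHom 2)) {S : Set (Fin (N + 2))} (hS : T.IsClique S) :
    S ⊆ Set.range d.toOrderHom ∨ S ⊆ Set.range τ.toOrderHom := by
  by_cases hp : τ.toOrderHom 1 ∈ S
  · right
    intro q hq
    by_cases hpq : τ.toOrderHom 1 = q
    · exact ⟨1, hpq⟩
    · rcases h.eq_of_adj hT hear (hS hp hq hpq) with rfl | rfl
      · exact ⟨0, rfl⟩
      · exact ⟨2, rfl⟩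
  · left
    intro q hq
    rcases h.eq_τ_or q with rfl | ⟨q', rfl⟩
    · exact absurd hq hp
    · exact ⟨q', rfl⟩

/-- The ear and the rest meet only along the edge from `i` to `i+2`; this is why gluing takes place
over `X_1`. -/
lemma range_d_inter_range_τ (h : IsEar N i e δ d τ) {q : Fin (N + 2)}
    (hd : q ∈ Set.range d.toOrderHom) (hτ : q ∈ Set.range τ.toOrderHom) :
    q ∈ Set.range (e ≫ d).toOrderHom := by
  obtain ⟨a, rfl⟩ := hd
  obtain ⟨b, hb⟩ := hτ
  have hv := congrArg Fin.val hb
  rw [h.τ_val, h.d_val] at hv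
  have hb3 : b.val < 3 := b.2
  rcases (by split_ifs at hv <;> omega : b.val = 0 ∨ b.val = 2) with h' | h'
  · obtain rfl : b = 0 := Fin.ext h'
    exact ⟨0, h.d_e_zero.trans hb⟩
  · obtain rfl : b = 2 := Fin.ext h'
    exact ⟨1, h.d_e_one.trans hb⟩

end IsEar

/-- Factorization through a monotone embedding. -/
lemma exists_factorization {k m n : SimplexCategory} (α : k ⟶ n) (β : m ⟶ n)
    (hβ : ∀ a b, β.toOrderHom a ≤ β.toOrderHom b ↔ a ≤ b)
    (hα : Set.range α.toOrderHom ⊆ Set.range β.toOrderHom) : ∃ γ : k ⟶ m, γ ≫ β = α := by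
  choose g hg using fun j => hα ⟨j, rfl⟩
  refine ⟨SimplexCategory.mkHom ⟨g, fun a b hab => (hβ _ _).1 ?_⟩, ?_⟩
  · rw [hg, hg]
    exact α.toOrderHom.monotone hab
  · ext j : 3
    exact hg j

lemma comp_injective {k m n : SimplexCategory} (β : m ⟶ n)
    (hβ : ∀ a b, β.toOrderHom a ≤ β.toOrderHom b ↔ a ≤ b) {γ γ' : k ⟶ m}
    (h : γ ≫ β = γ' ≫ β) : γ = γ' := by
  ext j : 3
  have hj : β.toOrderHom (γ.toOrderHom j) = β.toOrderHom (γ'.toOrderHom j) :=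
    congrArg (fun f => f.toOrderHom j) h
  exact le_antisymm ((hβ _ _).1 hj.le) ((hβ _ _).1 hj.ge)

end EarTriangulations

end RelSdot

namespace RelSdot

/-! ### Gluing morphisms in homotopy limits. -/

section Gluing

variable {J : Type w} [Category.{w} J] {K : Jᵒᵖ ⥤ Grpd.{v, u}}

namespace HoLim

/-- The naturality condition for a morphism of homotopy limits at a single arrow. -/
def Compat (x y : HoLim K) {i j : J} (a : i ⟶ j) (f : x.pt (op j) ⟶ y.pt (op j))
    (g : x.pt (op i) ⟶ y.pt (op i)) : Prop :=
  x.iso a.op ≫ g = (K.map a.op).map f ≫ y.iso a.op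

variable {x y : HoLim K}

lemma Compat.exists {i j : J} (a : i ⟶ j) (f : x.pt (op j) ⟶ y.pt (op j)) :
    ∃ g, Compat x y a f g :=
  ⟨inv (x.iso a.op) ≫ (K.map a.op).map f ≫ y.iso a.op, IsIso.hom_inv_id_assoc _ _⟩

lemma Compat.unique {i j : J} {a : i ⟶ j} {f : x.pt (op j) ⟶ y.pt (op j)}
    {g g' : x.pt (op i) ⟶ y.pt (op i)} (h : Compat x y a f g) (h' : Compat x y a f g') :
    g = g' :=
  (cancel_epi (x.iso a.op)).1 (Eq.trans h (Eq.symm h'))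

lemma Compat.comp {i j k : J} {a : i ⟶ j} {b : j ⟶ k} {f : x.pt (op k) ⟶ y.pt (op k)}
    {g : x.pt (op j) ⟶ y.pt (op j)} {h : x.pt (op i) ⟶ y.pt (op i)} (hb : Compat x y b f g)
    (ha : Compat x y a g h) : Compat x y (a ≫ b) f h := by
  have hx := x.iso_comp b.op a.op
  have hy := y.iso_comp b.op a.op
  have e := eqToHom_comp_map (K.map_comp b.op a.op) f
  have e' : (K.map a.op).map (x.iso b.op) ≫ (K.map a.op).map g =
      (K.map a.op).map ((K.map b.op).map f) ≫ (K.map a.op).map (y.iso b.op) := by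
    rw [← Functor.map_comp, ← Functor.map_comp]
    exact congrArg _ hb
  have ha : x.iso a.op ≫ h = (K.map a.op).map g ≫ y.iso a.op := ha
  change x.iso (b.op ≫ a.op) ≫ h = (K.map (b.op ≫ a.op)).map f ≫ y.iso (b.op ≫ a.op)
  rw [hx, hy, Category.assoc, Category.assoc, ha, ← Category.assoc ((K.map a.op).map _), e',
    Category.assoc, ← Category.assoc ((K.map (b.op ≫ a.op)).map f), ← e, Category.assoc]
  rfl

/-- The structure maps are invertible, so the component at the source of an arrow is determined by
the component at its target. -/
lemma Compat.of_comp {i j k : J} {a : i ⟶ j} {b : j ⟶ k} {f : x.pt (op k) ⟶ y.pt (op k)}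
    {g : x.pt (op j) ⟶ y.pt (op j)} {h : x.pt (op i) ⟶ y.pt (op i)} (hb : Compat x y b f g)
    (hab : Compat x y (a ≫ b) f h) : Compat x y a g h := by
  obtain ⟨h', hh'⟩ := Compat.exists a g
  rwa [hab.unique (hb.comp hh')]

instance (f : x ⟶ y) : IsIso f := by
  refine ⟨⟨⟨fun j => inv (f.app j), fun {i j} a => ?_⟩, ?_, ?_⟩⟩
  · have := f.w a
    rw [Functor.map_inv, IsIso.comp_inv_eq, Category.assoc, this, IsIso.inv_hom_id_assoc]
  · exact Hom.ext (funext fun j => IsIso.hom_inv_id (f.app j))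
  · exact Hom.ext (funext fun j => IsIso.inv_hom_id (f.app j))

section

variable {J' : Type w} [Category.{w} J'] {Φ : J' ⥤ J} {t : J}

lemma hom_ext_of_cover (hcov : ∀ i, (∃ k, Nonempty (i ⟶ Φ.obj k)) ∨ Nonempty (i ⟶ t))
    {f g : x ⟶ y} (hΦ : ∀ k, f.app (op (Φ.obj k)) = g.app (op (Φ.obj k)))
    (ht : f.app (op t) = g.app (op t)) : f = g := by
  refine Hom.ext (funext fun i => ?_)
  obtain ⟨i⟩ := i
  have key : ∀ {j : J} (a : i ⟶ j), f.app (op j) = g.app (op j) → f.app (op i) = g.app (op i) :=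
    fun {j} a e => by
      have hf : Compat x y a (f.app (op j)) (f.app (op i)) := f.w a.op
      rw [e] at hf
      exact hf.unique (g.w a.op)
  rcases hcov i with ⟨k, ⟨a⟩⟩ | ⟨⟨a⟩⟩
  · exact key a (hΦ k)
  · exact key a ht

/-- Gluing of morphisms of homotopy limits along a covering of the index category by the image of
`Φ` and an object `t`, which intersect in the image of `e`. -/
lemma exists_hom_of_cover (hcov : ∀ i, (∃ k, Nonempty (i ⟶ Φ.obj k)) ∨ Nonempty (i ⟶ t))
    (hΦ : ∀ {i : J} {k l : J'} (a : i ⟶ Φ.obj k) (b : i ⟶ Φ.obj l),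
      ∃ (m : J') (s : i ⟶ Φ.obj m) (a' : m ⟶ k) (b' : m ⟶ l), s ≫ Φ.map a' = a ∧ s ≫ Φ.map b' = b)
    (ht : ∀ {i : J} (a b : i ⟶ t), a = b) {e : J'} (δ : Φ.obj e ⟶ t)
    (hδ : ∀ {i : J} {k : J'} (_ : i ⟶ Φ.obj k) (_ : i ⟶ t), Nonempty (i ⟶ Φ.obj e))
    (f : ∀ k, x.pt (op (Φ.obj k)) ⟶ y.pt (op (Φ.obj k)))
    (hf : ∀ {k l : J'} (a : k ⟶ l), Compat x y (Φ.map a) (f l) (f k))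
    (g : x.pt (op t) ⟶ y.pt (op t)) (hg : Compat x y δ g (f e)) : Nonempty (x ⟶ y) := by
  -- The component induced at `i` does not depend on the chosen map into the image of `Φ`.
  have hΦ' : ∀ {i : J} {k l : J'} (a : i ⟶ Φ.obj k) (b : i ⟶ Φ.obj l)
      {p : x.pt (op i) ⟶ y.pt (op i)}, Compat x y a (f k) p → Compat x y b (f l) p := by
    intro i k l a b p ha
    obtain ⟨m, s, a', b', rfl, rfl⟩ := hΦ a b
    exact (hf b').comp ((hf a').of_comp ha)
  have key : ∀ i, ∃ p : x.pt (op i) ⟶ y.pt (op i),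
      (∀ (k : J') (a : i ⟶ Φ.obj k), Compat x y a (f k) p) ∧
      (∀ a : i ⟶ t, Compat x y a g p) := by
    intro i
    by_cases hi : ∃ k, Nonempty (i ⟶ Φ.obj k)
    · obtain ⟨k, ⟨a⟩⟩ := hi
      obtain ⟨p, hp⟩ := Compat.exists a (f k)
      refine ⟨p, fun l b => hΦ' a b hp, fun b => ?_⟩
      obtain ⟨s⟩ := hδ a b
      rw [ht b (s ≫ δ)]
      exact hg.comp (hΦ' a s hp)
    · obtain ⟨b⟩ := (hcov i).resolve_left hi
      obtain ⟨p, hp⟩ := Compat.exists b g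
      exact ⟨p, fun k a => absurd ⟨k, ⟨a⟩⟩ hi, fun b' => by rwa [ht b' b]⟩
  choose p hp₁ hp₂ using key
  refine ⟨⟨fun i => p i.unop, fun {i j} a => ?_⟩⟩
  change Compat x y a.unop (p i.unop) (p j.unop)
  rcases hcov i.unop with ⟨k, ⟨b⟩⟩ | ⟨⟨b⟩⟩
  · exact (hp₁ _ k b).of_comp (hp₁ _ k _)
  · exact (hp₂ _ b).of_comp (hp₂ _ _)

end

end HoLim

end Gluing

/-! ### Restriction of simplices and of homotopy limits to a subpolygon. -/

section EarStep

/-- The functor between categories of simplices induced by a map of simplices. -/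
def Simplices.push {m n : ℕ} (α : SimplexCategory.mk m ⟶ SimplexCategory.mk n)
    (T : SimpleGraph (Fin (n + 1))) :
    Simplices (T.comap α.toOrderHom : SimpleGraph (Fin (m + 1))) ⥤ Simplices T :=
  ObjectProperty.lift _ (ObjectProperty.ι _ ⋙ Over.map α) (by
    rintro ⟨σ, hσ⟩ _ ⟨a, rfl⟩ _ ⟨b, rfl⟩ hab
    exact hσ ⟨a, rfl⟩ ⟨b, rfl⟩ (fun h => hab (congrArg α.toOrderHom h)))

/-- A simplex of a graph. -/
abbrev Simplices.mk {m n : ℕ} {T : SimpleGraph (Fin (n + 1))}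
    (α : SimplexCategory.mk m ⟶ SimplexCategory.mk n) (h : T.IsClique (Set.range α.toOrderHom)) :
    Simplices T :=
  ⟨Over.mk α, h⟩

/-- A morphism of simplices of a graph. -/
abbrev Simplices.homMk {n : ℕ} {T : SimpleGraph (Fin (n + 1))} {σ ρ : Simplices T}
    (a : σ.obj.left ⟶ ρ.obj.left) (h : a ≫ ρ.obj.hom = σ.obj.hom) : σ ⟶ ρ :=
  ObjectProperty.homMk (Over.homMk a h)

variable {m n : ℕ} (X : SimplicialObject Grpd.{v, u})

/-- Restriction of points of homotopy limits. -/
def pullHoLim (α : SimplexCategory.mk m ⟶ SimplexCategory.mk n) {T : SimpleGraph (Fin (n + 1))}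
    (z : HoLim (simplexDiagram X T)) :
    HoLim (simplexDiagram X (T.comap α.toOrderHom : SimpleGraph (Fin (m + 1)))) where
  pt σ := z.pt (op ((Simplices.push α T).obj σ.unop))
  iso a := z.iso ((Simplices.push α T).op.map a)
  iso_id j := z.iso_id (op ((Simplices.push α T).obj j.unop))
  iso_comp a b := z.iso_comp ((Simplices.push α T).op.map a) ((Simplices.push α T).op.map b)

end EarStep

end RelSdot

namespace RelSdot

/-! ### The inductive step: attaching an ear preserves the 2-Segal equivalence. -/

section EarInduction

lemma exists_heq_hom {C : Type*} [Category C] {x y x' y' : C} (hx : x' = x) (hy : y' = y)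
    (f : x ⟶ y) : ∃ f' : x' ⟶ y', HEq f' f := by
  subst hx hy
  exact ⟨f, HEq.rfl⟩

lemma eqToHom_comp_comp_eq {C : Type*} [Category C] {p q r s : C} (h₁ : p = q) (h₂ : q = r)
    {h₃ : r = p} {f : r ⟶ s} {g : p ⟶ s} (h : f = eqToHom h₃ ≫ g) :
    eqToHom h₁ ≫ eqToHom h₂ ≫ f = g := by
  subst h₁ h₂
  simpa using h

lemma eqToHom_comp_eq_map_comp {C D E : Type*} [Category C] [Category D] [Category E] {L : C ⥤ D}
    {M : C ⥤ E} {G : D ⥤ E} (hL : L ⋙ G = M) {x y : C} (a : x ⟶ y) {p p' : D} {q r : E}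
    (hp : p = L.obj x) (hr : r = M.obj x) (h : G.obj p = r) {ψ : L.obj y ⟶ p'}
    {ψ' : M.obj y ⟶ q} {ζ : G.obj p' ⟶ q}
    (w : eqToHom (Functor.congr_obj hL y) ≫ ψ' = G.map ψ ≫ ζ) :
    eqToHom h ≫ eqToHom hr ≫ M.map a ≫ ψ' = G.map (eqToHom hp ≫ L.map a ≫ ψ) ≫ ζ := by
  subst hL hp hr
  have w : ψ' = G.map ψ ≫ ζ := by simpa using w
  simp [w]

variable {N i : ℕ} {T : SimpleGraph (Fin (N + 1 + 1))}
    {e : SimplexCategory.mk 1 ⟶ SimplexCategory.mk N}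
    {δ : SimplexCategory.mk 1 ⟶ SimplexCategory.mk 2}
    {d : SimplexCategory.mk N ⟶ SimplexCategory.mk (N + 1)}
    {τ : SimplexCategory.mk 2 ⟶ SimplexCategory.mk (N + 1)}
    {X : SimplicialObject Grpd.{v, u}}

namespace IsEar

lemma isClique_e (h : IsEar N i e δ d τ) (hT : IsTriangulation T)
    (hear : T.Adj (τ.toOrderHom 0) (τ.toOrderHom 2)) :
    (T.comap d.toOrderHom : SimpleGraph (Fin (N + 1))).IsClique (Set.range e.toOrderHom) := by
  rintro _ ⟨a, rfl⟩ _ ⟨b, rfl⟩ hab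
  have hc : ∀ j, d.toOrderHom (e.toOrderHom j) = τ.toOrderHom (δ.toOrderHom j) := fun j =>
    congrArg (fun f => f.toOrderHom j) h.comm
  change T.Adj (d.toOrderHom (e.toOrderHom a)) (d.toOrderHom (e.toOrderHom b))
  refine h.isClique_τ hT hear ⟨_, (hc a).symm⟩ ⟨_, (hc b).symm⟩ fun hab' => hab ?_
  exact le_antisymm ((h.d_le_iff _ _).1 hab'.le) ((h.d_le_iff _ _).1 hab'.ge)

/-- A polygon with an ear is covered by the ear and the polygon without the ear. -/
lemma cover (h : IsEar N i e δ d τ) (hT : IsTriangulation T)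
    (hear : T.Adj (τ.toOrderHom 0) (τ.toOrderHom 2)) (σ : Simplices T) :
    (∃ k, Nonempty (σ ⟶ (Simplices.push d T).obj k)) ∨
      Nonempty (σ ⟶ Simplices.mk τ (h.isClique_τ hT hear)) := by
  rcases h.range_subset_or hT hear σ.property with hσ | hσ
  · obtain ⟨γ, hγ⟩ := exists_factorization σ.obj.hom d h.d_le_iff hσ
    have hc : (T.comap d.toOrderHom : SimpleGraph (Fin (N + 1))).IsClique
        (Set.range γ.toOrderHom) := by
      rintro _ ⟨a, rfl⟩ _ ⟨b, rfl⟩ hab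
      have hc : ∀ j, d.toOrderHom (γ.toOrderHom j) = σ.obj.hom.toOrderHom j := fun j =>
        congrArg (fun f => f.toOrderHom j) hγ
      change T.Adj (d.toOrderHom (γ.toOrderHom a)) (d.toOrderHom (γ.toOrderHom b))
      refine σ.property ⟨_, (hc a).symm⟩ ⟨_, (hc b).symm⟩ fun hab' => hab ?_
      exact le_antisymm ((h.d_le_iff _ _).1 hab'.le) ((h.d_le_iff _ _).1 hab'.ge)
    exact Or.inl ⟨Simplices.mk γ hc, ⟨Simplices.homMk (𝟙 _) ((Category.id_comp _).trans hγ)⟩⟩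
  · obtain ⟨γ, hγ⟩ := exists_factorization σ.obj.hom τ h.τ_le_iff hσ
    exact Or.inr ⟨Simplices.homMk γ hγ⟩

lemma hom_τ_unique (h : IsEar N i e δ d τ) (hT : IsTriangulation T)
    (hear : T.Adj (τ.toOrderHom 0) (τ.toOrderHom 2)) {σ : Simplices T}
    (a b : σ ⟶ Simplices.mk τ (h.isClique_τ hT hear)) : a = b :=
  ObjectProperty.hom_ext _ (Over.OverMorphism.ext (comp_injective τ h.τ_le_iff
    ((Over.w a.hom).trans (Over.w b.hom).symm)))

lemma push_hom_factor (h : IsEar N i e δ d τ) {σ : Simplices T}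
    {k l : Simplices (T.comap d.toOrderHom : SimpleGraph (Fin (N + 1)))}
    (a : σ ⟶ (Simplices.push d T).obj k) (b : σ ⟶ (Simplices.push d T).obj l) :
    ∃ (m : Simplices (T.comap d.toOrderHom : SimpleGraph (Fin (N + 1))))
      (s : σ ⟶ (Simplices.push d T).obj m) (a' : m ⟶ k) (b' : m ⟶ l),
      s ≫ (Simplices.push d T).map a' = a ∧ s ≫ (Simplices.push d T).map b' = b := by
  have hk : (a.hom.left ≫ k.obj.hom) ≫ d = σ.obj.hom :=
    (Category.assoc _ _ _).trans (Over.w a.hom)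
  have hl : (b.hom.left ≫ l.obj.hom) ≫ d = σ.obj.hom :=
    (Category.assoc _ _ _).trans (Over.w b.hom)
  have hkl := comp_injective d h.d_le_iff (hk.trans hl.symm)
  have hc : (T.comap d.toOrderHom : SimpleGraph (Fin (N + 1))).IsClique
      (Set.range (a.hom.left ≫ k.obj.hom).toOrderHom) := by
    rintro _ ⟨p, rfl⟩ _ ⟨q, rfl⟩ hpq
    exact k.property ⟨_, rfl⟩ ⟨_, rfl⟩ hpq
  exact ⟨Simplices.mk (a.hom.left ≫ k.obj.hom) hc,
    Simplices.homMk (𝟙 _) ((Category.id_comp _).trans hk), Simplices.homMk a.hom.left rfl,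
    Simplices.homMk b.hom.left hkl.symm,
    ObjectProperty.hom_ext _ (Over.OverMorphism.ext (Category.id_comp _)),
    ObjectProperty.hom_ext _ (Over.OverMorphism.ext (Category.id_comp _))⟩

lemma exists_hom_e (h : IsEar N i e δ d τ) (hT : IsTriangulation T)
    (hear : T.Adj (τ.toOrderHom 0) (τ.toOrderHom 2)) {σ : Simplices T}
    {k : Simplices (T.comap d.toOrderHom : SimpleGraph (Fin (N + 1)))}
    (a : σ ⟶ (Simplices.push d T).obj k) (b : σ ⟶ Simplices.mk τ (h.isClique_τ hT hear)) :
    Nonempty (σ ⟶ (Simplices.push d T).obj (Simplices.mk e (h.isClique_e hT hear))) := by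
  have hed : ∀ p q, (e ≫ d).toOrderHom p ≤ (e ≫ d).toOrderHom q ↔ p ≤ q := fun p q => by
    refine (h.d_le_iff _ _).trans ?_
    rw [Fin.le_def, Fin.le_def, h.e_val, h.e_val]
    omega
  obtain ⟨γ, hγ⟩ := exists_factorization σ.obj.hom (e ≫ d) hed (by
    rintro _ ⟨j, rfl⟩
    refine h.range_d_inter_range_τ ?_ ?_
    · rw [← Over.w a.hom]
      exact ⟨_, rfl⟩
    · rw [← Over.w b.hom]
      exact ⟨_, rfl⟩)
  exact ⟨Simplices.homMk γ hγ⟩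

/-- The two-Segal map of a triangulation is an equivalence if this is the case for the
triangulation obtained by removing an ear. -/
lemma isEquivalence_twoSegalMap (h : IsEar N i e δ d τ) (hT : IsTriangulation T)
    (hear : T.Adj (τ.toOrderHom 0) (τ.toOrderHom 2)) (hX : IsLocalSq X h.comm)
    (H : (twoSegalMap X (T.comap d.toOrderHom : SimpleGraph (Fin (N + 1)))).IsEquivalence) :
    (twoSegalMap X T).IsEquivalence := by
  let tτ : Simplices T := Simplices.mk τ (h.isClique_τ hT hear)
  let te : Simplices (T.comap d.toOrderHom : SimpleGraph (Fin (N + 1))) :=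
    Simplices.mk e (h.isClique_e hT hear)
  let tδ : (Simplices.push d T).obj te ⟶ tτ := Simplices.homMk δ h.comm.symm
  have hd : ∀ σ : Simplices (T.comap d.toOrderHom : SimpleGraph (Fin (N + 1))),
      X.map (σ.obj.hom ≫ d).op = X.map d.op ≫ X.map σ.obj.hom.op := fun σ =>
    X.map_comp d.op (Quiver.Hom.op (Y := SimplexCategory.mk N) σ.obj.hom)
  have hdm : ∀ (σ : Simplices (T.comap d.toOrderHom : SimpleGraph (Fin (N + 1))))
      {x y : X.obj (op (SimplexCategory.mk (N + 1)))} (f : x ⟶ y),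
      HEq ((X.map (σ.obj.hom ≫ d).op).map f) ((X.map σ.obj.hom.op).map ((X.map d.op).map f)) :=
    fun σ x y f => Functor.hcongr_hom (hd σ) f
  have hfaith : (twoSegalMap X T).Faithful := by
    -- A morphism is determined by its restriction to the smaller polygon, itself determined on the
    -- smaller triangulation, and by its restriction to the ear.
    refine ⟨fun {x y} f g hfg => hX.hom_ext ?_ ?_⟩
    · refine (twoSegalMap X (T.comap d.toOrderHom : SimpleGraph (Fin (N + 1)))).map_injective ?_
      refine HoLim.Hom.ext (funext fun σ => ?_)
      refine eq_of_heq ((hdm σ.unop f).symm.trans (HEq.trans ?_ (hdm σ.unop g)))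
      exact heq_of_eq (congrArg (fun t : HoLim.Hom _ _ =>
        t.app (op ((Simplices.push d T).obj σ.unop))) hfg)
    · exact congrArg (fun t : HoLim.Hom _ _ => t.app (op tτ)) hfg
  have hfull : (twoSegalMap X T).Full := by
    refine ⟨fun {x y} F => ?_⟩
    have hF : ∀ {σ ρ : (Simplices T)ᵒᵖ} (a : σ ⟶ ρ),
        HEq (((simplexDiagram X T).map a).map (F.app σ)) (F.app ρ) := fun {σ ρ} a =>
      (comp_eqToHom_eq_iff_heq _ _ (Functor.congr_obj (simplexDiagram_obj_map X T a) x)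
        (Functor.congr_obj (simplexDiagram_obj_map X T a) y)).1 (F.w a).symm
    have hex : ∀ k : Simplices (T.comap d.toOrderHom : SimpleGraph (Fin (N + 1))),
        ∃ f : (X.map k.obj.hom.op).obj ((X.map d.op).obj x) ⟶
          (X.map k.obj.hom.op).obj ((X.map d.op).obj y),
          HEq f (F.app (op ((Simplices.push d T).obj k))) := fun k =>
      exists_heq_hom (Functor.congr_obj (hd k) x).symm (Functor.congr_obj (hd k) y).symm _
    choose f hf using hex
    let G : (twoSegalMap X (T.comap d.toOrderHom : SimpleGraph (Fin (N + 1)))).obj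
        ((X.map d.op).obj x) ⟶ (twoSegalMap X _).obj ((X.map d.op).obj y) :=
      { app := fun k => f k.unop
        w := fun {k l} a => Eq.symm <| (comp_eqToHom_eq_iff_heq _ _
          (Functor.congr_obj (simplexDiagram_obj_map X _ a) ((X.map d.op).obj x))
          (Functor.congr_obj (simplexDiagram_obj_map X _ a) ((X.map d.op).obj y))).2 <|
          (map_heq (X.map a.unop.hom.left.op) (Functor.congr_obj (hd k.unop) x).symm
            (Functor.congr_obj (hd k.unop) y).symm (hf k.unop)).trans
            ((hF ((Simplices.push d T).op.map a)).trans (hf l.unop).symm) }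
    obtain ⟨u, hu⟩ := (twoSegalMap X
      (T.comap d.toOrderHom : SimpleGraph (Fin (N + 1)))).map_surjective G
    have hu' : ∀ k : Simplices (T.comap d.toOrderHom : SimpleGraph (Fin (N + 1))),
        (X.map k.obj.hom.op).map u = f k := fun k =>
      congrArg (fun t : HoLim.Hom _ _ => t.app (op k)) hu
    -- On the common edge both pieces restrict to the component of `F` there.
    obtain ⟨c, hc, hc'⟩ := hX.hom u (F.app (op tτ)) ((comp_eqToHom_eq_iff_heq _ _ _ _).2
      ((heq_of_eq (hu' te)).trans ((hf te).trans (hF tδ.op).symm)))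
    refine ⟨c, HoLim.hom_ext_of_cover (h.cover hT hear) (fun k => ?_) hc'⟩
    refine eq_of_heq ((hdm k c).trans (HEq.trans (heq_of_eq ?_) (hf k)))
    rw [hc, hu']
  have hsurj : (twoSegalMap X T).EssSurj := by
    refine ⟨fun z => ?_⟩
    obtain ⟨y, ⟨φ⟩⟩ := H.essSurj.mem_essImage (pullHoLim X d z)
    let ψ : ∀ k : Simplices (T.comap d.toOrderHom : SimpleGraph (Fin (N + 1))),
      (X.map k.obj.hom.op).obj y ⟶ z.pt (op ((Simplices.push d T).obj k)) :=
        fun k => HoLim.Hom.app φ.hom (op k)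
    have hψ : ∀ {k l : Simplices (T.comap d.toOrderHom : SimpleGraph (Fin (N + 1)))} (a : k ⟶ l),
        eqToHom (Functor.congr_obj (simplexDiagram_obj_map X _ a.op) y) ≫ ψ k =
        (X.map a.hom.left.op).map (ψ l) ≫ z.iso ((Simplices.push d T).map a).op := fun a =>
      HoLim.Hom.w φ.hom a.op
    let ze : X.obj (op (SimplexCategory.mk 1)) := z.pt (op ((Simplices.push d T).obj te))
    let ζ : (X.map δ.op).obj (z.pt (op tτ)) ⟶ ze := z.iso tδ.op
    let ψe : (X.map e.op).obj y ⟶ ze := ψ te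
    -- The gluing isomorphism over `X_1` compares `y` and the value of `z` on the ear with the value
    -- of `z` on the common edge.
    obtain ⟨x, a, b, hab⟩ := hX.obj y (z.pt (op tτ)) (asIso (ψe ≫ inv ζ))
    have hab' : (X.map e.op).map a.hom ≫ ψe = eqToHom (Functor.congr_obj
      (map_comp_map_eq X h.comm) x) ≫ (X.map δ.op).map b.hom ≫ ζ := by
      have hab : (X.map e.op).map a.hom ≫ ψe ≫ inv ζ = eqToHom (Functor.congr_obj
        (map_comp_map_eq X h.comm) x) ≫ (X.map δ.op).map b.hom := hab
      rw [← Category.assoc, IsIso.comp_inv_eq] at hab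
      exact hab.trans (Category.assoc _ _ _)
    have : Nonempty ((twoSegalMap X T).obj x ⟶ z) := by
      refine HoLim.exists_hom_of_cover (h.cover hT hear) (fun a b => h.push_hom_factor a b)
        (fun a b => h.hom_τ_unique hT hear a b) tδ (fun a b => h.exists_hom_e hT hear a b)
        (fun k => eqToHom (Functor.congr_obj (hd k) x) ≫ (X.map k.obj.hom.op).map a.hom ≫ ψ k)
        (fun {k l} α => ?_) b.hom ?_
      · exact eqToHom_comp_eq_map_comp (L := X.map l.obj.hom.op) (M := X.map k.obj.hom.op)
          (G := X.map α.hom.left.op) (simplexDiagram_obj_map X _ α.op) a.hom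
          (Functor.congr_obj (hd l) x) (Functor.congr_obj (hd k) x)
          (Functor.congr_obj (simplexDiagram_obj_map X T ((Simplices.push d T).map α).op) x) (hψ α)
      · exact eqToHom_comp_comp_eq (Functor.congr_obj (simplexDiagram_obj_map X T tδ.op) x)
          (Functor.congr_obj (hd te) x) hab'
    obtain ⟨g⟩ := this
    exact ⟨x, ⟨asIso g⟩⟩
  exact { }

end IsEar

end EarInduction

end RelSdot

namespace RelSdot

/-! ### The triangle as base case, and the criterion by ears. -/

section TwoSegalCriterion

/-- A terminal object of `J` is initial in `Jᵒᵖ`, so all components are transported from the one at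
`t`. -/
lemma HoLim.exists_hom_of_terminal {J : Type w} [Category.{w} J] {K : Jᵒᵖ ⥤ Grpd.{v, u}}
    {x y : HoLim K} {t : J} (p : ∀ i, i ⟶ t) (hp : ∀ {i} (a : i ⟶ t), a = p i)
    (g : x.pt (op t) ⟶ y.pt (op t)) : Nonempty (x ⟶ y) := by
  choose q hq using fun i => Compat.exists (p i) g
  refine ⟨⟨fun i => q i.unop, fun {i j} a => (hq i.unop).of_comp ?_⟩⟩
  rw [hp (i := j.unop) (_ ≫ _)]
  exact hq j.unop

lemma IsTriangulation.eq_top {T : SimpleGraph (Fin (2 + 1))} (hT : IsTriangulation T) :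
    T = ⊤ :=
  top_le_iff.1 (hT.2 (fun i k j l hik hkj hjl => by
    simp only [Fin.lt_def] at hik hkj hjl
    omega) le_top)

/-- The two-Segal map of a simplex is an equivalence. -/
lemma isEquivalence_twoSegalMap_top (X : SimplicialObject Grpd.{v, u}) (n : ℕ) :
    (twoSegalMap X (⊤ : SimpleGraph (Fin (n + 1)))).IsEquivalence := by
  let t : Simplices (⊤ : SimpleGraph (Fin (n + 1))) :=
    Simplices.mk (𝟙 (SimplexCategory.mk n)) fun _ _ _ _ h => h
  let p : ∀ σ : Simplices (⊤ : SimpleGraph (Fin (n + 1))), σ ⟶ t := fun σ =>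
    Simplices.homMk σ.obj.hom (Category.comp_id _)
  have hp : ∀ {σ : Simplices (⊤ : SimpleGraph (Fin (n + 1)))} (a : σ ⟶ t), a = p σ := fun a =>
    ObjectProperty.hom_ext _ (Over.OverMorphism.ext ((Category.comp_id _).symm.trans (Over.w a.hom)))
  have hid : X.map (𝟙 (SimplexCategory.mk n)).op = 𝟙 _ := X.map_id _
  have hidm : ∀ {x y : X.obj (op (SimplexCategory.mk n))} (f : x ⟶ y),
      HEq ((X.map (𝟙 (SimplexCategory.mk n)).op).map f) f := fun f => Functor.hcongr_hom hid f
  have hfaith : (twoSegalMap X (⊤ : SimpleGraph (Fin (n + 1)))).Faithful :=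
    ⟨fun {x y} f g hfg => eq_of_heq ((hidm f).symm.trans ((heq_of_eq
      (congrArg (fun t' : HoLim.Hom _ _ => t'.app (op t)) hfg)).trans (hidm g)))⟩
  have hfull : (twoSegalMap X (⊤ : SimpleGraph (Fin (n + 1)))).Full := by
    refine ⟨fun {x y} F => ?_⟩
    obtain ⟨f, hf⟩ := exists_heq_hom (Functor.congr_obj hid x).symm (Functor.congr_obj hid y).symm
      (F.app (op t))
    refine ⟨f, HoLim.hom_ext_of_cover (Φ := Functor.empty _) (t := t)
      (fun σ => Or.inr ⟨p σ⟩) (fun k => k.as.elim) (eq_of_heq ((hidm f).trans hf))⟩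
  have hsurj : (twoSegalMap X (⊤ : SimpleGraph (Fin (n + 1)))).EssSurj := by
    refine ⟨fun z => ?_⟩
    obtain ⟨g⟩ := HoLim.exists_hom_of_terminal (x := (twoSegalMap X ⊤).obj (z.pt (op t))) (y := z)
      p hp (eqToHom (Functor.congr_obj hid (z.pt (op t))))
    exact ⟨z.pt (op t), ⟨asIso g⟩⟩
  exact { }

/-- A simplicial groupoid is two-Segal if gluing an ear to a polygon yields homotopy pullbacks. -/
theorem isTwoSegal_of_isLocalSq {X : SimplicialObject Grpd.{v, u}}
    (hX : ∀ {N i : ℕ} {e : SimplexCategory.mk 1 ⟶ SimplexCategory.mk N}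
      {δ : SimplexCategory.mk 1 ⟶ SimplexCategory.mk 2}
      {d : SimplexCategory.mk N ⟶ SimplexCategory.mk (N + 1)}
      {τ : SimplexCategory.mk 2 ⟶ SimplexCategory.mk (N + 1)} (h : IsEar N i e δ d τ),
      IsLocalSq X h.comm) : IsTwoSegal X := by
  intro n hn
  induction n, hn using Nat.le_induction with
  | base =>
    intro T hT
    rw [hT.eq_top]
    exact isEquivalence_twoSegalMap_top X 2
  | succ N hN ih =>
    intro T hT
    obtain ⟨a, b, hab, hb⟩ := hT.exists_ear (by omega)
    have hb' := b.2
    obtain ⟨e, δ, d, τ, h⟩ := exists_isEar (N := N) (i := a.val) (by omega)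
    have hear : T.Adj (τ.toOrderHom 0) (τ.toOrderHom 2) := by
      have h0 : τ.toOrderHom 0 = a := Fin.ext (h.τ_val 0)
      have h2 : τ.toOrderHom 2 = b := Fin.ext ((h.τ_val 2).trans hb.symm)
      rwa [h0, h2]
    exact h.isEquivalence_twoSegalMap hT hear (hX h) (ih _ (h.isTriangulation_comap hT hear))

end TwoSegalCriterion

end RelSdot

theorem mainTheorem12 {A B : Type u}
    [Category.{v} A] [Preadditive A] [HasFiniteBiproducts A] [RelSdot.ExactCategory A]
    [Category.{v} B] [Preadditive B] [HasFiniteBiproducts B] [RelSdot.ExactCategory B]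
    (F : A ⥤ B) [RelSdot.ExactFunctor F] :
    RelSdot.IsTwoSegal (RelSdot.relSdot F) := by
  exact RelSdot.isTwoSegal_of_isLocalSq fun h => RelSdot.isLocalSq_relSdot F h
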